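/- All digraphs are finite and may have parallel arcs. For a digraph $D=(V,A)$, an $s$-$t$-path is a simple path, identified with its set of arcs. For a set $\mathcal P$ of paths, $x\in\mathbb Q_+^{\mathcal P}$ and $S\subseteq A$, write $\lambda(x,S):=\sum_{P\in\mathcal P:\,P\cap S\neq\emptyset}x_P$ for the flow lost when $S$ fails; $\delta^+(U)$ and $\delta^-(U)$ are the sets of arcs leaving and entering $U\subseteq V$. MRF$^\star$: given $D=(V,A)$, distinct $s,t\in V$, capacities $u\in\mathbb Q_+^A$, a budget $k\in\mathbb N$ and $L\in\mathbb Q_+$, decide whether there is $x\in\mathbb Q_+^{\mathcal P}$, where $\mathcal P$ is the set of $s$-$t$-paths, with $\sum_{P\ni a}x_P\le u_a$ for all $a\in A$ and $\sum_{P\in\mathcal P:\,P\cap S=\emptyset}x_P\ge L$ for every $S\subseteq A$ with $|S|\le k$. MRF-M$^\star$: given $D=(V,A)$, capacities $u\in\mathbb Q_+^A$, a budget $k$ and a finite set $K$ of commodities with sources $s_i$, sinks $t_i$ and demands $d_i\in\mathbb Q_+$, let $\mathcal P_i$ be the set of $s_i$-$t_i$-paths, $\mathcal P=\bigcup_{i\in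 K}\mathcal P_i$, $M:=\max_{a\in A}u_a$, and let $X_K$ be the set of all $x\in\mathbb Q_+^{\mathcal P}$ with $\sum_{P\ni a}x_P\le u_a$ for all $a\in A$ and $\sum_{P\in\mathcal P_i}x_P=d_i$ for all $i\in K$. Decide whether there is $x\in X_K$ with $\lambda(x,S)\le kM-1$ for every $S\subseteq A$ with $|S|\le k$. The integral version of each problem requires in addition that all values $x_P$ are integers. For a polynomial $p$, let $\mathcal C_p$ be the class of all MRF-M$^\star$ instances with $k\ge 2$ and the following properties: 1. All capacities are integral and $M\le p(|A|)$. 2. For all $i\in K$: $\sum_{a\in\delta^+(s_i)}u_a=\sum_{a\in\delta^-(t_i)}u_a=d_i$ and $\delta^-(s_i)=\delta^+(t_i)=\emptyset$. 3. There is $i_0\in K$ such that $\sum_{i\in K\setminus\{i_0\}}d_i\le M-3$, and 4. for the same $i_0$ and every $x\in X_K$, $\sum_{P\in\mathcal P_i:\,a\in P}x_P\ge 2$ for all $i\in K\setminus\{i_0\}$ and all $a\in A$ with $u_a\ge M-2$. 5. There is $U\subseteq V$ with $s_i\in U$ and $t_i\notin U$ for all $i\in K$, $\sum_{a\in\delta^+(U)}u_a=\sum_{i\in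 K}d_i$ and $|\{a\in\delta^+(U):u_a=M\}|=k-1$. Theorem. There is a transformation $f$ from MRF-M$^\star$ instances to MRF$^\star$ instances such that, for every polynomial $p$, $f$ is computable in polynomial time on the instances in $\mathcal C_p$, and for every instance $I\in\mathcal C_p$: the budget of $f(I)$ equals the budget of $I$; $I$ is a YES instance of MRF-M$^\star$ if and only if $f(I)$ is a YES instance of MRF$^\star$; and $I$ is a YES instance of integral MRF-M$^\star$ if and only if $f(I)$ is a YES instance of integral MRF$^\star$. -/

import Mathlib

/-! # Random access machines with a step count

A structured random access machine. It has registers `R 0, R 1, …` (a program names finitely many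
of them), a memory addressed indirectly through registers, and a write-only output list. The only
arithmetic is addition and truncated subtraction, so a number grows by at most one bit per step,
and polynomial time on this machine, with the input measured in bits, is polynomial time on Turing
machines. -/

namespace RAM

/-- Programs. -/
inductive Cmd : Type
  /-- do nothing -/
  | skip : Cmd
  /-- `R x := n` -/
  | const (x n : ℕ) : Cmd
  /-- `R x := R y + R z` -/
  | add (x y z : ℕ) : Cmd
  /-- `R x := R y - R z` (zero if `R y < R z`) -/
  | sub (x y z : ℕ) : Cmd
  /-- `R x := memory[R y]` -/
  | load (x y : ℕ) : Cmd
  /-- `memory[R x] := R y` -/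
  | store (x y : ℕ) : Cmd
  /-- append `R x` to the output -/
  | emit (x : ℕ) : Cmd
  /-- first `c`, then `d` -/
  | seq (c d : Cmd) : Cmd
  /-- if `R x ≠ 0` then `c` else `d` -/
  | branch (x : ℕ) (c d : Cmd) : Cmd
  /-- while `R x ≠ 0` do `c` -/
  | loop (x : ℕ) (c : Cmd) : Cmd

/-- Configurations of the machine. -/
structure State : Type where
  reg : ℕ → ℕ
  mem : ℕ → ℕ
  out : List ℕ

/-- The initial configuration: the input stands in memory from address `0` on, its length is in
register `0`, everything else is zero, and the output is empty. -/
def State.initial (w : List ℕ) : State where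
  reg := fun x => if x = 0 then w.length else 0
  mem := fun i => w.getD i 0
  out := []

/-- Set a register. -/
def State.setReg (σ : State) (x v : ℕ) : State := { σ with reg := Function.update σ.reg x v }

/-- Set a memory cell. -/
def State.setMem (σ : State) (i v : ℕ) : State := { σ with mem := Function.update σ.mem i v }

/-- `Exec c σ n τ`: started in `σ`, the program `c` halts in `τ` after exactly `n` steps. Every
elementary instruction and every evaluation of a test is one step. -/
inductive Exec : Cmd → State → ℕ → State → Prop
  | skip (σ : State) : Exec .skip σ 1 σ
  | const (σ : State) (x n : ℕ) : Exec (.const x n) σ 1 (σ.setReg x n)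
  | add (σ : State) (x y z : ℕ) : Exec (.add x y z) σ 1 (σ.setReg x (σ.reg y + σ.reg z))
  | sub (σ : State) (x y z : ℕ) : Exec (.sub x y z) σ 1 (σ.setReg x (σ.reg y - σ.reg z))
  | load (σ : State) (x y : ℕ) : Exec (.load x y) σ 1 (σ.setReg x (σ.mem (σ.reg y)))
  | store (σ : State) (x y : ℕ) : Exec (.store x y) σ 1 (σ.setMem (σ.reg x) (σ.reg y))
  | emit (σ : State) (x : ℕ) : Exec (.emit x) σ 1 { σ with out := σ.out ++ [σ.reg x] }
  | seq {c d : Cmd} {σ τ υ : State} {m n : ℕ} (hc : Exec c σ m τ) (hd : Exec d τ n υ) :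
      Exec (.seq c d) σ (m + n) υ
  | branch_pos {x : ℕ} {c d : Cmd} {σ τ : State} {n : ℕ} (hx : σ.reg x ≠ 0)
      (hc : Exec c σ n τ) : Exec (.branch x c d) σ (n + 1) τ
  | branch_zero {x : ℕ} {c d : Cmd} {σ τ : State} {n : ℕ} (hx : σ.reg x = 0)
      (hd : Exec d σ n τ) : Exec (.branch x c d) σ (n + 1) τ
  | loop_pos {x : ℕ} {c : Cmd} {σ τ υ : State} {m n : ℕ} (hx : σ.reg x ≠ 0)
      (hc : Exec c σ m τ) (hl : Exec (.loop x c) τ n υ) : Exec (.loop x c) σ (m + n + 1) υ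
  | loop_zero {x : ℕ} {c : Cmd} {σ : State} (hx : σ.reg x = 0) : Exec (.loop x c) σ 1 σ

/-- Number of bits of a list of natural numbers: the binary lengths plus one separator each. -/
def bitSize (w : List ℕ) : ℕ := (w.map fun n => Nat.size n + 1).sum

/-- On all objects of the class `C`, the function `f` is computed by one program within a number
of steps that is polynomial in the bit size of the input; `encA` and `encB` encode inputs and
outputs. (Nothing is required outside `C`.) -/
def PolyTimeOn {α β : Type} (C : α → Prop) (encA : α → List ℕ) (encB : β → List ℕ)
    (f : α → β) : Prop :=
  ∃ (c : Cmd) (q : Polynomial ℕ), ∀ a : α, C a → ∃ (n : ℕ) (τ : State),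
    Exec c (State.initial (encA a)) n τ ∧ τ.out = encB (f a) ∧ n ≤ q.eval (bitSize (encA a))

end RAM

/-! # Robust flows -/

namespace RobustFlow

/-- A finite digraph (parallel arcs allowed) with nonnegative rational arc capacities. -/
structure Network : Type where
  numV : ℕ
  numA : ℕ
  tail : Fin numA → Fin numV
  head : Fin numA → Fin numV
  cap : Fin numA → ℚ≥0

namespace Network

variable (N : Network)

/-- The list of arcs is a walk from the first to the second node. -/
def IsWalk : Fin N.numV → List (Fin N.numA) → Fin N.numV → Prop
  | v, [], w => v = w
  | v, a :: l, w => N.tail a = v ∧ IsWalk (N.head a) l w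

/-- The set `P` of arcs is (the arc set of) a path from `s` to `t`: no node is repeated. -/
def IsPath (s t : Fin N.numV) (P : Finset (Fin N.numA)) : Prop :=
  ∃ l : List (Fin N.numA), N.IsWalk s l t ∧ (s :: l.map N.head).Nodup ∧ l.toFinset = P

open Classical in
/-- The set of all `s`-`t`-paths, each path being a set of arcs. -/
noncomputable def paths (s t : Fin N.numV) : Finset (Finset (Fin N.numA)) :=
  Finset.univ.filter fun P => N.IsPath s t P

/-- Arcs leaving `U`. -/
def outArcs (U : Finset (Fin N.numV)) : Finset (Fin N.numA) :=
  Finset.univ.filter fun a => N.tail a ∈ U ∧ N.head a ∉ U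

/-- Arcs entering `U`. -/
def inArcs (U : Finset (Fin N.numV)) : Finset (Fin N.numA) :=
  Finset.univ.filter fun a => N.tail a ∉ U ∧ N.head a ∈ U

/-- Encoding of the arcs: tail, head, numerator and denominator of the capacity. -/
def encodeArcs : List ℕ :=
  (List.finRange N.numA).flatMap fun a =>
    [(N.tail a : ℕ), (N.head a : ℕ), (N.cap a).num, (N.cap a).den]

end Network

/-! A path flow is given by its values `x P`; only the values on the relevant set `Ps` of paths
are ever looked at. -/

/-- Flow on the arc `a`. -/
def arcFlow {m : ℕ} (Ps : Finset (Finset (Fin m))) (x : Finset (Fin m) → ℚ≥0) (a : Fin m) : ℚ≥0 :=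
  ∑ P ∈ Ps with a ∈ P, x P

/-- Flow lost when the arcs of `S` fail. -/
def lost {m : ℕ} (Ps : Finset (Finset (Fin m))) (x : Finset (Fin m) → ℚ≥0)
    (S : Finset (Fin m)) : ℚ≥0 :=
  ∑ P ∈ Ps with (P ∩ S).Nonempty, x P

/-- Flow that survives the failure of the arcs of `S`. -/
def surviving {m : ℕ} (Ps : Finset (Finset (Fin m))) (x : Finset (Fin m) → ℚ≥0)
    (S : Finset (Fin m)) : ℚ≥0 :=
  ∑ P ∈ Ps with P ∩ S = ∅, x P

/-- The flow value on every path of `Ps` is an integer. -/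
def IntegralOn {m : ℕ} (Ps : Finset (Finset (Fin m))) (x : Finset (Fin m) → ℚ≥0) : Prop :=
  ∀ P ∈ Ps, ∃ n : ℕ, x P = n

/-! ## The single-commodity problem -/

/-- An instance: a network with source, sink, interdiction budget and target value. -/
structure MRFInstance : Type extends Network where
  source : Fin numV
  sink : Fin numV
  source_ne_sink : source ≠ sink
  budget : ℕ
  target : ℚ≥0

namespace MRFInstance

variable (I : MRFInstance)

/-- The set of source-sink-paths. -/
noncomputable def stPaths : Finset (Finset (Fin I.numA)) := I.paths I.source I.sink

/-- `x` respects the capacities. -/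
def IsFlow (x : Finset (Fin I.numA) → ℚ≥0) : Prop :=
  ∀ a, arcFlow I.stPaths x a ≤ I.cap a

/-- YES instance: some flow keeps at least the target value in every failure scenario. -/
def Yes : Prop :=
  ∃ x, I.IsFlow x ∧
    ∀ S : Finset (Fin I.numA), S.card ≤ I.budget → I.target ≤ surviving I.stPaths x S

/-- YES instance of the integral version. -/
def IntegralYes : Prop :=
  ∃ x, I.IsFlow x ∧ IntegralOn I.stPaths x ∧
    ∀ S : Finset (Fin I.numA), S.card ≤ I.budget → I.target ≤ surviving I.stPaths x S

/-- Encoding of instances: the node set is listed explicitly, numbers are in binary. -/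
def encode : List ℕ :=
  [I.numV, I.numA, (I.source : ℕ), (I.sink : ℕ), I.budget, I.target.num, I.target.den] ++
    List.range I.numV ++ I.encodeArcs

end MRFInstance

/-! ## The multi-commodity problem -/

/-- An instance: a network with commodities (source, sink, demand) and interdiction budget. -/
structure MRFMInstance : Type extends Network where
  numK : ℕ
  source : Fin numK → Fin numV
  sink : Fin numK → Fin numV
  demand : Fin numK → ℚ≥0
  budget : ℕ

namespace MRFMInstance

variable (I : MRFMInstance)

/-- The paths of commodity `i`. -/
noncomputable def comPaths (i : Fin I.numK) : Finset (Finset (Fin I.numA)) :=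
  I.paths (I.source i) (I.sink i)

/-- The paths of all commodities. -/
noncomputable def allPaths : Finset (Finset (Fin I.numA)) :=
  Finset.univ.biUnion I.comPaths

/-- `x` is a multi-commodity flow that respects the capacities and satisfies all demands. -/
def IsFlow (x : Finset (Fin I.numA) → ℚ≥0) : Prop :=
  (∀ a, arcFlow I.allPaths x a ≤ I.cap a) ∧ ∀ i, ∑ P ∈ I.comPaths i, x P = I.demand i

/-- The maximum capacity of an arc. -/
def maxCap : ℚ≥0 := Finset.univ.sup I.cap

/-- YES instance: some multi-commodity flow loses at most `k * M - 1` in every failure scenario,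
where `k` is the budget and `M` the maximum capacity. -/
def Yes : Prop :=
  ∃ x, I.IsFlow x ∧ ∀ S : Finset (Fin I.numA), S.card ≤ I.budget →
    (lost I.allPaths x S : ℚ) ≤ I.budget * I.maxCap - 1

/-- YES instance of the integral version. -/
def IntegralYes : Prop :=
  ∃ x, I.IsFlow x ∧ IntegralOn I.allPaths x ∧ ∀ S : Finset (Fin I.numA), S.card ≤ I.budget →
    (lost I.allPaths x S : ℚ) ≤ I.budget * I.maxCap - 1

/-- Encoding of instances: the node set is listed explicitly, numbers are in binary. -/
def encode : List ℕ :=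
  [I.numV, I.numA, I.numK, I.budget] ++ List.range I.numV ++ I.encodeArcs ++
    (List.finRange I.numK).flatMap fun i =>
      [(I.source i : ℕ), (I.sink i : ℕ), (I.demand i).num, (I.demand i).den]

/-- The capacities are integral and the largest one is at most `p (|A|)`. -/
def IntegralCapsBoundedBy (p : Polynomial ℕ) : Prop :=
  (∀ a, ∃ n : ℕ, I.cap a = n) ∧ I.maxCap ≤ (p.eval I.numA : ℕ)

/-- The demand of each commodity is the capacity leaving its source and the capacity entering its
sink; no arc enters a source, no arc leaves a sink. -/
def TightTerminals : Prop :=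
  ∀ i, ∑ a ∈ I.outArcs {I.source i}, I.cap a = I.demand i ∧
    ∑ a ∈ I.inArcs {I.sink i}, I.cap a = I.demand i ∧
    I.inArcs {I.source i} = ∅ ∧ I.outArcs {I.sink i} = ∅

/-- The demands of the commodities other than `i₀` sum up to at most `M - 3`. -/
def SmallDemandsExcept (i₀ : Fin I.numK) : Prop :=
  ((∑ i with i ≠ i₀, I.demand i : ℚ≥0) : ℚ) ≤ I.maxCap - 3

/-- Every multi-commodity flow sends, for each commodity other than `i₀`, at least two units
through every arc of capacity at least `M - 2`. -/
def SharesLargeArcsExcept (i₀ : Fin I.numK) : Prop :=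
  ∀ x, I.IsFlow x → ∀ i, i ≠ i₀ → ∀ a, (I.maxCap : ℚ) - 2 ≤ I.cap a →
    2 ≤ arcFlow (I.comPaths i) x a

/-- There is a set of nodes separating all sources from all sinks whose outgoing capacity is the
total demand and that is left by exactly `k - 1` arcs of maximum capacity. -/
def HasTightCut : Prop :=
  ∃ U : Finset (Fin I.numV), (∀ i, I.source i ∈ U) ∧ (∀ i, I.sink i ∉ U) ∧
    ∑ a ∈ I.outArcs U, I.cap a = ∑ i, I.demand i ∧
    ((I.outArcs U).filter fun a => I.cap a = I.maxCap).card + 1 = I.budget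

/-- The class of instances, for the polynomial bound `p` on the capacities. -/
structure Special (p : Polynomial ℕ) : Prop where
  two_le_budget : 2 ≤ I.budget
  caps : I.IntegralCapsBoundedBy p
  terminals : I.TightTerminals
  commodities : ∃ i₀, I.SmallDemandsExcept i₀ ∧ I.SharesLargeArcsExcept i₀
  cut : I.HasTightCut

end MRFMInstance

end RobustFlow

/-! A rational path flow is replaced by a finite family of unit paths, `N` of them making up one
unit of flow; `N = 1` is the integral case. For each fixed `N`, one instance has a robust family iff
the other has (`singleYes_iff_multiYes`), which gives the fractional and the integral claim
together.

Construction. Every arc `a` of the given network is copied as `.inn a`, `.mid a`, `.out a`, and the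
capacity of `.mid a` is raised by `2 * H + r₀`, so that the maximum `M` becomes `Q + 2`. A chain of
`H = K + 3` bundle arcs `.e l` of capacity `Q + k + 1` is added, one per commodity and three spare
ones. Bundle `l` receives `Q` units of its own by `.sp l`, and `k + 1` chain units are meant to run
through all bundles. Its own units feed two units into each raised arc, one unit into the absorbing
arc of each unit of demand of the other commodities, the demand of its own commodity into the
source, and `w` units straight into the sink. Each raised arc also carries `r₀` units of filler.
There are absorbing arcs `.st φ` and `k - 2` direct arcs `.psi j`, all of capacity `Q + 1`. The
intended flow has value `target + k * (Q + 2) - 1`, so robustness means losing at most `k * (Q + 2)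
- 1`.

From multi to single. In the intended solution the failure of `.e l` costs at most `Q + k + 1`, but
then any other arc that is not direct costs at most `Q` more, because raised arcs share two units
and absorbing arcs one unit with every bundle (`cnt_not_bundle_le`). With the direct arcs the loss
is at most `(Q + k + 1) + Q + (k - 2) * (Q + 1) = k * (Q + 2) - 1`. If no bundle arc fails, only
raised arcs can carry `Q + 2`, so one arc of another type already saves a unit, and failures of
raised arcs alone are handled by the robustness of the given solution (`lost_kind_le`).

From single to multi. If the first bundle arc, another one and all direct arcs fail, the arcs on
which surviving paths can start have total capacity exactly `target`; hence they are saturated and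
their paths avoid both bundles (`Solution.start`). This bounds the total flow, and then any
non-direct arc carries at most `Q` units outside any given bundle (`cnt_and_not_e_le`). Applied to
the absorbing arcs, whose filler comes from `s`, this forces the structure: chain units that reach
the end have met all bundles (`e_of_po`), a unit that leaves the copy at the sink of a commodity
came from the bundle of that commodity (`e_of_tf`), and each of the two absorbing arcs of `a`
receives one unit per bundle (`cnt_wg_inClass`). So the paths of one bundle trace strands in the
copy that start at the source or with some arc and end at the sink or with some arc, two starts and
two ends per arc. `exists_uncrossed` recombines the strands to source-sink walks, which use each arc
at least two units less. Removing these `2 * H` units and the filler `r₀` turns the loss bound `k *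
(Q + 2) - 1` into `k * M - 1` (`Solution.multiYes`).

Running time. The reduction is written in a small language with bounded loops, compiled to the
machine (`Prog.compile_spec`). Units of demand and of budget become nodes and arcs, so the total
demand and the budget must be polynomial in value; this follows from the tight terminals with
bounded capacities, and from the tight cut. -/

namespace RobustFlow

/-! ## Walks in a digraph given by tails and heads of its arcs -/

section Walks

variable {V A : Type*} {tl hd : A → V}

/-- The list of arcs is a walk from the first to the second node. -/
def Walk (tl hd : A → V) : V → List A → V → Prop
  | v, [], w => v = w
  | v, a :: l, w => tl a = v ∧ Walk tl hd (hd a) l w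

/-- A walk that repeats no node. -/
def SimplePath (tl hd : A → V) (s : V) (l : List A) (t : V) : Prop :=
  Walk tl hd s l t ∧ (s :: l.map hd).Nodup

theorem walk_append {l₁ l₂ : List A} {u w : V} :
    Walk tl hd u (l₁ ++ l₂) w ↔ ∃ v, Walk tl hd u l₁ v ∧ Walk tl hd v l₂ w := by
  induction l₁ generalizing u with
  | nil => simp [Walk]
  | cons a l ih => simp only [List.cons_append, Walk, ih]; grind

theorem Walk.tails_eq {l : List A} {u w : V} (h : Walk tl hd u l w) :
    l.map tl ++ [w] = u :: l.map hd := by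
  induction l generalizing u with
  | nil => simpa [Walk] using h.symm
  | cons a l ih => simp [h.1, ih h.2]

theorem Walk.exists_enter {l : List A} {u w : V} (h : Walk tl hd u l w) (W : V → Prop)
    (hu : ¬ W u) (ho : ∃ o ∈ l, W (tl o)) : ∃ o ∈ l, ¬ W (tl o) ∧ W (hd o) := by
  induction l generalizing u with
  | nil => simp at ho
  | cons a l ih =>
    by_cases ha : W (hd a)
    · exact ⟨a, by simp, by rw [h.1]; exact hu, ha⟩
    · obtain ⟨o, ho, hW⟩ := ho
      have hol : o ∈ l := by
        rcases List.mem_cons.1 ho with rfl | h'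
        · rw [h.1] at hW; exact absurd hW hu
        · exact h'
      obtain ⟨o', ho', h'⟩ := ih h.2 ha ⟨o, hol, hW⟩
      exact ⟨o', by simp [ho'], h'⟩

theorem Walk.exists_leave {l : List A} {u w : V} (h : Walk tl hd u l w) (W : V → Prop)
    (hw : ¬ W w) (ho : W u ∨ ∃ o ∈ l, W (hd o)) : ∃ o ∈ l, W (tl o) ∧ ¬ W (hd o) := by
  induction l generalizing u with
  | nil =>
    simp only [Walk] at h
    subst h
    simp [hw] at ho
  | cons a l ih =>
    by_cases ha : W (hd a)
    · obtain ⟨o, h1, h2⟩ := ih h.2 (Or.inl ha)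
      exact ⟨o, by simp [h1], h2⟩
    · by_cases hu : W u
      · exact ⟨a, by simp, by rw [h.1]; exact hu, ha⟩
      · obtain ⟨o, ho, hW⟩ := ho.resolve_left hu
        have hol : o ∈ l := by
          rcases List.mem_cons.1 ho with rfl | h'
          · exact absurd hW ha
          · exact h'
        obtain ⟨o', h1, h2⟩ := ih h.2 (Or.inr ⟨o, hol, hW⟩)
        exact ⟨o', by simp [h1], h2⟩

/-- Closed detours are cut out. Only the inclusion of arcs is kept, since it is what guarantees that
no failure set is met more often. -/
theorem Walk.exists_simplePath {l : List A} {u w : V} (h : Walk tl hd u l w) :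
    ∃ l', SimplePath tl hd u l' w ∧ l' ⊆ l := by
  classical
  induction l generalizing u with
  | nil => exact ⟨[], ⟨h, by simp⟩, by simp⟩
  | cons a l ih =>
    obtain ⟨l', hl', hsub⟩ := ih h.2
    by_cases hu : u ∈ hd a :: l'.map hd
    · rcases List.mem_cons.1 hu with rfl | hu
      · exact ⟨l', hl', fun x hx => by simp [hsub hx]⟩
      · obtain ⟨b, hb, rfl⟩ := List.mem_map.1 hu
        obtain ⟨p, q, rfl⟩ := List.append_of_mem hb
        refine ⟨q, ⟨?_, ?_⟩, fun x hx => by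
          have := hsub (a := x) (by simp [hx])
          simp [this]⟩
        · obtain ⟨v, -, h2⟩ := walk_append.1 hl'.1
          exact h2.2
        · have := hl'.2
          simp only [List.map_append, List.map_cons] at this
          have h3 := (List.nodup_cons.1 this).2
          exact (List.nodup_append.1 h3).2.1
    · refine ⟨a :: l', ⟨⟨h.1, hl'.1⟩, ?_⟩, ?_⟩
      · simp only [List.map_cons]
        exact List.nodup_cons.2 ⟨hu, hl'.2⟩
      · intro x hx
        rcases List.mem_cons.1 hx with rfl | hx
        · simp
        · simp [hsub hx]

namespace SimplePath

variable {s t : V} {l : List A}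

theorem nodup_tails (h : SimplePath tl hd s l t) : (l.map tl ++ [t]).Nodup := by
  rw [h.1.tails_eq]; exact h.2

theorem head_inj (h : SimplePath tl hd s l t) {o o' : A} (ho : o ∈ l) (ho' : o' ∈ l)
    (e : hd o = hd o') : o = o' :=
  List.inj_on_of_nodup_map (List.nodup_cons.1 h.2).2 ho ho' e

theorem tail_inj (h : SimplePath tl hd s l t) {o o' : A} (ho : o ∈ l) (ho' : o' ∈ l)
    (e : tl o = tl o') : o = o' :=
  List.inj_on_of_nodup_map (List.nodup_append.1 h.nodup_tails).1 ho ho' e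

theorem head_ne (h : SimplePath tl hd s l t) {o : A} (ho : o ∈ l) : hd o ≠ s := by
  rintro rfl
  exact (List.nodup_cons.1 h.2).1 (List.mem_map_of_mem ho)

theorem tail_ne (h : SimplePath tl hd s l t) {o : A} (ho : o ∈ l) : tl o ≠ t := by
  intro e
  have := (List.nodup_append.1 h.nodup_tails).2.2 (tl o) (List.mem_map_of_mem ho) t (by simp)
  exact this e

theorem exists_pred (h : SimplePath tl hd s l t) {o : A} (ho : o ∈ l) (hs : tl o ≠ s) :
    ∃ o' ∈ l, hd o' = tl o := by
  have : tl o ∈ l.map tl ++ [t] := by simp only [List.mem_append]; left; exact List.mem_map_of_mem ho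
  rw [h.1.tails_eq] at this
  simpa [hs] using this

theorem exists_succ (h : SimplePath tl hd s l t) {o : A} (ho : o ∈ l) (ht : hd o ≠ t) :
    ∃ o' ∈ l, tl o' = hd o := by
  have : hd o ∈ s :: l.map hd := by simp only [List.mem_cons]; right; exact List.mem_map_of_mem ho
  rw [← h.1.tails_eq] at this
  simpa [ht] using this

theorem exists_first (h : SimplePath tl hd s l t) (hst : s ≠ t) : ∃ o ∈ l, tl o = s := by
  have : s ∈ s :: l.map hd := by simp
  rw [← h.1.tails_eq] at this
  simpa [hst] using this

theorem exists_last (h : SimplePath tl hd s l t) (hst : s ≠ t) : ∃ o ∈ l, hd o = t := by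
  have : t ∈ l.map tl ++ [t] := by simp
  rw [h.1.tails_eq] at this
  simpa [hst.symm] using this

theorem ne_of_ne_nil (h : SimplePath tl hd s l t) (hl : l ≠ []) : s ≠ t := by
  rintro rfl
  cases l with
  | nil => exact hl rfl
  | cons a l => exact h.tail_ne (o := a) (by simp) h.1.1

/-- A nonempty set of arcs is the arc set of a simple path for at most one pair of end nodes. -/
theorem ends_eq {s' t' : V} {l' : List A} (h : SimplePath tl hd s l t)
    (h' : SimplePath tl hd s' l' t') (hl : l ≠ []) (e : ∀ a, a ∈ l ↔ a ∈ l') :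
    s = s' ∧ t = t' := by
  have hl' : l' ≠ [] := by
    rintro rfl
    obtain ⟨a, ha⟩ := List.exists_mem_of_ne_nil l hl
    simpa using (e a).1 ha
  have h1 := h.ne_of_ne_nil hl
  have h2 := h'.ne_of_ne_nil hl'
  constructor
  -- If `s` were not the start of the second path, the arc that leaves `s` would have a predecessor
  -- there; this predecessor lies on the first path and would enter its start.
  · obtain ⟨o, ho, hs⟩ := h.exists_first h1
    by_contra hne
    obtain ⟨o', ho', hp⟩ := h'.exists_pred ((e o).1 ho) (by rw [hs]; exact hne)
    exact h.head_ne ((e o').2 ho') (hp.trans hs)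
  · obtain ⟨o, ho, hs⟩ := h.exists_last h1
    by_contra hne
    obtain ⟨o', ho', hp⟩ := h'.exists_succ ((e o).1 ho) (by rw [hs]; exact hne)
    exact h.tail_ne ((e o').2 ho') (hp.trans hs)

end SimplePath

end Walks

/-! ## Counting -/

open Classical in
/-- The number of elements with a property. -/
noncomputable def cnt {ι : Type} [Fintype ι] (p : ι → Prop) : ℕ :=
  Fintype.card {i // p i}

section Counting

variable {ι : Type} [Fintype ι] {p q : ι → Prop}

theorem cnt_eq_card [DecidablePred p] : cnt p = (Finset.univ.filter p).card := by
  unfold cnt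
  convert Fintype.card_subtype p

theorem cnt_mono (h : ∀ i, p i → q i) : cnt p ≤ cnt q := by
  classical
  simp only [cnt_eq_card]
  exact Finset.card_le_card fun i => by simpa using h i

theorem cnt_congr (h : ∀ i, p i ↔ q i) : cnt p = cnt q :=
  le_antisymm (cnt_mono fun i => (h i).1) (cnt_mono fun i => (h i).2)

theorem cnt_or_le : cnt (fun i => p i ∨ q i) ≤ cnt p + cnt q := by
  classical
  simp only [cnt_eq_card]
  have : (Finset.univ.filter fun i => p i ∨ q i) = Finset.univ.filter p ∪ Finset.univ.filter q := by
    ext i; simp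
  rw [this]
  exact Finset.card_union_le _ _

theorem cnt_or_eq (h : ∀ i, p i → ¬ q i) : cnt (fun i => p i ∨ q i) = cnt p + cnt q := by
  classical
  simp only [cnt_eq_card]
  have : (Finset.univ.filter fun i => p i ∨ q i) = Finset.univ.filter p ∪ Finset.univ.filter q := by
    ext i; simp
  rw [this, Finset.card_union_of_disjoint]
  rw [Finset.disjoint_filter]
  exact fun i _ => h i

theorem cnt_split (p q : ι → Prop) : cnt p = cnt (fun i => p i ∧ q i) + cnt (fun i => p i ∧ ¬ q i) := by
  rw [← cnt_or_eq (by tauto)]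
  exact cnt_congr (by tauto)

theorem cnt_eq_zero_iff : cnt p = 0 ↔ ∀ i, ¬ p i := by
  classical
  simp [cnt_eq_card, Finset.filter_eq_empty_iff]

/-- If `p` implies `q` and there are as many elements with `p` as with `q`, then `q` implies `p`. -/
theorem imp_of_cnt_le (h : ∀ i, p i → q i) (hc : cnt q ≤ cnt p) (i : ι) (hi : q i) : p i := by
  have h1 := cnt_split q p
  have h2 : cnt (fun i => q i ∧ p i) = cnt p := cnt_congr fun i => ⟨fun h => h.2, fun hp => ⟨h i hp, hp⟩⟩
  have h3 : cnt (fun i => q i ∧ ¬ p i) = 0 := by omega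
  rw [cnt_eq_zero_iff] at h3
  by_contra hp
  exact h3 i ⟨hi, hp⟩

theorem cnt_exists_le {κ : Type} [Fintype κ] (r : κ → ι → Prop) :
    cnt (fun i => ∃ k, r k i) ≤ ∑ k, cnt (r k) := by
  classical
  simp only [cnt_eq_card]
  calc _ ≤ (Finset.univ.biUnion fun k => Finset.univ.filter (r k)).card :=
        Finset.card_le_card fun i => by simp
    _ ≤ _ := Finset.card_biUnion_le

theorem cnt_exists_eq {κ : Type} [Fintype κ] (r : κ → ι → Prop)
    (h : ∀ i k k', r k i → r k' i → k = k') :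
    cnt (fun i => ∃ k, r k i) = ∑ k, cnt (r k) := by
  classical
  simp only [cnt_eq_card]
  rw [← Finset.card_biUnion]
  · congr 1; ext i; simp
  · intro k _ k' _ hne
    rw [Function.onFun, Finset.disjoint_filter]
    exact fun i _ h1 h2 => hne (h i k k' h1 h2)

theorem cnt_mem_exists_le {κ : Type} (s : Finset κ) (r : κ → ι → Prop) :
    cnt (fun i => ∃ k ∈ s, r k i) ≤ ∑ k ∈ s, cnt (r k) := by
  classical
  simp only [cnt_eq_card]
  calc _ ≤ (s.biUnion fun k => Finset.univ.filter (r k)).card :=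
        Finset.card_le_card fun i => by simp
    _ ≤ _ := Finset.card_biUnion_le

theorem cnt_mem_exists_eq {κ : Type} (s : Finset κ) (r : κ → ι → Prop)
    (h : ∀ i, ∀ k ∈ s, ∀ k' ∈ s, r k i → r k' i → k = k') :
    cnt (fun i => ∃ k ∈ s, r k i) = ∑ k ∈ s, cnt (r k) := by
  classical
  simp only [cnt_eq_card]
  rw [← Finset.card_biUnion]
  · congr 1; ext i; simp
  · intro k hk k' hk' hne
    rw [Function.onFun, Finset.disjoint_filter]
    exact fun i _ h1 h2 => hne (h i k hk k' hk' h1 h2)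

theorem cnt_true : cnt (fun _ : ι => True) = Fintype.card ι := by
  classical
  simp [cnt_eq_card]

theorem cnt_le_card : cnt p ≤ Fintype.card ι := by
  rw [← cnt_true]; exact cnt_mono fun _ _ => trivial

/-- If the parts of a sum are bounded by the parts of another sum that is no larger, then the parts
agree. -/
theorem eq_of_sum_le {κ : Type} {s : Finset κ} {f g : κ → ℕ} (h : ∀ k ∈ s, f k ≤ g k)
    (hs : ∑ k ∈ s, g k ≤ ∑ k ∈ s, f k) : ∀ k ∈ s, f k = g k :=
  (Finset.sum_eq_sum_iff_of_le h).1 (le_antisymm (Finset.sum_le_sum h) hs)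

end Counting

end RobustFlow

/-! ### The single-commodity network and the local structure of its paths -/

namespace RobustFlow

theorem SimplePath.eq_singleton {V A : Type*} {tl hd : A → V} {s t : V} {l : List A}
    (h : SimplePath tl hd s l t) {o : A} (ho : o ∈ l) (hs : tl o = s) (ht : hd o = t) :
    l = [o] := by
  cases l with
  | nil => simp at ho
  | cons a l =>
    obtain rfl : o = a := h.tail_inj ho (by simp) (hs.trans h.1.1.symm)
    cases l with
    | nil => rfl
    | cons b l =>
      exact absurd (h.1.2.1.trans ht) (h.tail_ne (by simp))

/-- The data of a multi-commodity instance with integral capacities and demands. -/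
structure Data : Type where
  nV : ℕ
  n : ℕ
  K : ℕ
  tl : Fin n → Fin nV
  hd : Fin n → Fin nV
  u : Fin n → ℕ
  src : Fin K → Fin nV
  snk : Fin K → Fin nV
  d : Fin K → ℕ
  k : ℕ
  M : ℕ

namespace Data

variable (X : Data)

/-- Total demand. -/
def D : ℕ := ∑ i, X.d i
/-- Number of bundles: one per commodity and three more. -/
def H : ℕ := X.K + 3
/-- Filler on each arc that does not belong to a bundle. -/
def r₀ : ℕ := X.D + 2 * X.n + X.k + 3
/-- The raised maximum capacity minus two. -/
def Q : ℕ := X.M + 2 * X.H + X.D + 2 * X.n + X.k + 1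
/-- Part of each bundle that is sent directly to the sink. -/
def w : ℕ := X.M + 2 * X.H + X.k + 1
/-- Filler of an absorbing arc that is shared by all bundles. -/
def B : ℕ := X.M + X.H + X.D + 2 * X.n + X.k + 2

/-- The bundle of a commodity. -/
def bun (i : Fin X.K) : Fin X.H := Fin.castAdd 3 i

/-- Indices of the absorbing arcs. -/
abbrev Abs : Type := (Σ i : Fin X.K, Fin (X.d i)) ⊕ (Fin X.n × Bool) ⊕ Fin (X.k + 1)

/-- Nodes of the single-commodity network. -/
inductive GV : Type
  | base (v : Fin X.nV)
  | s
  | t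
  | p (l : Fin (X.H + 1))
  | q (l : Fin X.H)
  | vi (a : Fin X.n)
  | wo (a : Fin X.n)
  | ab (φ : X.Abs)

/-- Arcs of the single-commodity network. -/
inductive GA : Type
  | sp (l : Fin X.H)
  | zin
  | e (l : Fin X.H)
  | ch (l : Fin X.H)
  | qt (l : Fin X.H)
  | qs (i : Fin X.K)
  | qf (l : Fin X.H) (f : Σ i : Fin X.K, Fin (X.d i))
  | qv (l : Fin X.H) (a : Fin X.n)
  | inn (a : Fin X.n)
  | mid (a : Fin X.n)
  | out (a : Fin X.n)
  | sv (a : Fin X.n)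
  | wt (a : Fin X.n)
  | wg (a : Fin X.n) (b : Bool)
  | tf (f : Σ i : Fin X.K, Fin (X.d i))
  | po (j : Fin (X.k + 1))
  | ss (φ : X.Abs)
  | st (φ : X.Abs)
  | psi (j : Fin (X.k - 2))
  deriving DecidableEq

variable {X}

/-- Tails of the arcs. -/
def gtl : X.GA → X.GV
  | .sp _ => .s
  | .zin => .s
  | .e l => .p l.castSucc
  | .ch l => .q l
  | .qt l => .q l
  | .qs i => .q (X.bun i)
  | .qf l _ => .q l
  | .qv l _ => .q l
  | .inn a => .base (X.tl a)
  | .mid a => .vi a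
  | .out a => .wo a
  | .sv _ => .s
  | .wt a => .wo a
  | .wg a _ => .wo a
  | .tf f => .base (X.snk f.1)
  | .po _ => .p (Fin.last _)
  | .ss _ => .s
  | .st φ => .ab φ
  | .psi _ => .s

/-- Heads of the arcs. -/
def ghd : X.GA → X.GV
  | .sp l => .p l.castSucc
  | .zin => .p 0
  | .e l => .q l
  | .ch l => .p l.succ
  | .qt _ => .t
  | .qs i => .base (X.src i)
  | .qf _ f => .ab (.inl f)
  | .qv _ a => .vi a
  | .inn a => .vi a
  | .mid a => .wo a
  | .out a => .base (X.hd a)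
  | .sv a => .vi a
  | .wt _ => .t
  | .wg a b => .ab (.inr (.inl (a, b)))
  | .tf f => .ab (.inl f)
  | .po j => .ab (.inr (.inr j))
  | .ss φ => .ab φ
  | .st _ => .t
  | .psi _ => .t

/-- Capacities of the arcs into the absorbing arcs. -/
def ssCap : X.Abs → ℕ
  | .inl _ => X.B
  | .inr (.inl _) => X.B
  | .inr (.inr _) => X.Q

/-- Capacities of the arcs. -/
def gcap : X.GA → ℕ
  | .sp _ => X.Q
  | .zin => X.k + 1
  -- `Q` units of its own and the `k + 1` units that run along the whole chain.
  | .e _ => X.Q + X.k + 1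
  | .ch _ => X.k + 1
  | .qt _ => X.w
  | .qs i => X.d i
  -- The bundle of the commodity of `f` sends no unit here; its unit is to reach the same absorbing
  -- arc through the copy, by `.qs` and `.tf`.
  | .qf l f => if l = X.bun f.1 then 0 else 1
  | .qv _ _ => 2
  | .inn a => X.u a
  -- Two units from each of the `H` bundles and `r₀` units from `s` are added; `M + 2 * H + r₀ = Q +
  -- 2`.
  | .mid a => X.u a + (2 * X.H + X.r₀)
  | .out a => X.u a
  | .sv _ => X.r₀
  | .wt _ => X.r₀
  | .wg _ _ => X.H
  | .tf _ => 1
  | .po _ => 1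
  | .ss φ => ssCap φ
  | .st _ => X.Q + 1
  | .psi _ => X.Q + 1

variable (X)

/-- Target value of the single-commodity instance. -/
def target : ℕ := (X.K + 1) * X.Q + X.n * X.r₀ + ∑ φ : X.Abs, ssCap φ

/-- There is a family of unit paths, `N` of them making up one unit of flow, that is a robust
solution of the single-commodity instance. -/
def SingleYes (N : ℕ) : Prop :=
  ∃ (ι : Type) (_ : Fintype ι) (L : ι → List X.GA),
    (∀ i, SimplePath gtl ghd .s (L i) .t) ∧ (∀ o, cnt (fun i => o ∈ L i) ≤ N * gcap o) ∧
    ∀ S : Finset X.GA, S.card ≤ X.k → N * X.target ≤ cnt fun i => ∀ o ∈ L i, o ∉ S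

/-- There is a family of unit paths, `N` of them making up one unit of flow, that is a robust
solution of the multi-commodity instance. -/
def MultiYes (N : ℕ) : Prop :=
  ∃ (ι : Type) (_ : Fintype ι) (c : ι → Fin X.K) (P : ι → List (Fin X.n)),
    (∀ i, SimplePath X.tl X.hd (X.src (c i)) (P i) (X.snk (c i))) ∧
    (∀ j, cnt (fun i => c i = j) = N * X.d j) ∧ (∀ a, cnt (fun i => a ∈ P i) ≤ N * X.u a) ∧
    ∀ S : Finset (Fin X.n), S.card ≤ X.k → cnt (fun i => ∃ a ∈ P i, a ∈ S) + N ≤ N * (X.k * X.M)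

variable {X}

/-! ### Paths of the single-commodity network -/

section Paths

variable {L : List X.GA} (h : SimplePath gtl ghd .s L .t)
include h

theorem e_of_sp {l : Fin X.H} (ho : .sp l ∈ L) : .e l ∈ L := by
  obtain ⟨o', ho', e⟩ := h.exists_succ ho (by simp [ghd])
  cases o' <;> simp [gtl, ghd] at e
  · exact e ▸ ho'
  · exact absurd e.symm (Fin.castSucc_lt_last l).ne

theorem e_of_zin (ho : .zin ∈ L) : .e (0 : Fin (X.K + 3)) ∈ L := by
  obtain ⟨o', ho', e⟩ := h.exists_succ ho (by simp [ghd])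
  cases o' <;> simp [gtl, ghd] at e
  · rename_i l
    have : l = (0 : Fin (X.K + 3)) := by
      apply Fin.ext
      have := congrArg Fin.val e
      simpa using this
    exact this ▸ ho'
  · simp [H] at e

/-- The only arc into `.q l` is `.e l`. -/
theorem e_of_tl {l : Fin X.H} {o : X.GA} (ho : o ∈ L) (ht : gtl o = .q l) : .e l ∈ L := by
  obtain ⟨o', ho', e⟩ := h.exists_pred ho (by simp [ht])
  rw [ht] at e
  cases o' <;> simp [ghd] at e
  exact e ▸ ho'

theorem e_succ_of_ch {l l' : Fin X.H} (hl : l.val + 1 = l'.val) (ho : .ch l ∈ L) : .e l' ∈ L := by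
  obtain ⟨o', ho', e⟩ := h.exists_succ ho (by simp [ghd])
  cases o' <;> simp [gtl, ghd] at e
  · rename_i m
    have : m = l' := by
      apply Fin.ext
      have := congrArg Fin.val e
      simp at this; omega
    exact this ▸ ho'
  · have := congrArg Fin.val e
    simp at this; omega

theorem po_of_ch_last {l : Fin X.H} (hl : l.val + 1 = X.H) (ho : .ch l ∈ L) : ∃ j, .po j ∈ L := by
  obtain ⟨o', ho', e⟩ := h.exists_succ ho (by simp [ghd])
  cases o' <;> simp [gtl, ghd] at e
  · rename_i m
    have := congrArg Fin.val e
    simp at this; omega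
  · exact ⟨_, ho'⟩

theorem st_of_hd {φ : X.Abs} {o : X.GA} (ho : o ∈ L) (hh : ghd o = .ab φ) : .st φ ∈ L := by
  obtain ⟨o', ho', e⟩ := h.exists_succ ho (by simp [hh])
  rw [hh] at e
  cases o' <;> simp [gtl] at e
  exact e ▸ ho'

theorem e_pred {l : Fin X.H} (ho : .e l ∈ L) :
    .sp l ∈ L ∨ (l.val = 0 ∧ .zin ∈ L) ∨ ∃ l' : Fin X.H, l'.val + 1 = l.val ∧ .ch l' ∈ L := by
  obtain ⟨o', ho', e⟩ := h.exists_pred ho (by simp [gtl])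
  cases o' <;> simp [gtl, ghd] at e
  · exact Or.inl (e ▸ ho')
  · right; left
    have := congrArg Fin.val e
    simp at this
    exact ⟨this.symm, ho'⟩
  · right; right
    have := congrArg Fin.val e
    simp at this
    exact ⟨_, this, ho'⟩

theorem e_succ {l : Fin X.H} (ho : .e l ∈ L) :
    .ch l ∈ L ∨ .qt l ∈ L ∨ (∃ i, X.bun i = l ∧ .qs i ∈ L) ∨ (∃ f, .qf l f ∈ L) ∨
      ∃ a, .qv l a ∈ L := by
  obtain ⟨o', ho', e⟩ := h.exists_succ ho (by simp [ghd])
  cases o' <;> simp [gtl, ghd] at e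
  · subst e; simp [ho']
  · subst e; simp [ho']
  · right; right; left; exact ⟨_, e, ho'⟩
  · subst e; right; right; right; left; exact ⟨_, ho'⟩
  · subst e; right; right; right; right; exact ⟨_, ho'⟩

theorem first_cases :
    (∃ l, .sp l ∈ L) ∨ .zin ∈ L ∨ (∃ a, .sv a ∈ L) ∨ (∃ φ, .ss φ ∈ L) ∨ ∃ j, .psi j ∈ L := by
  obtain ⟨o, ho, e⟩ := h.exists_first (by simp)
  cases o <;> simp [gtl] at e
  · exact Or.inl ⟨_, ho⟩
  · exact Or.inr (Or.inl ho)
  · exact Or.inr (Or.inr (Or.inl ⟨_, ho⟩))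
  · exact Or.inr (Or.inr (Or.inr (Or.inl ⟨_, ho⟩)))
  · exact Or.inr (Or.inr (Or.inr (Or.inr ⟨_, ho⟩)))

theorem psi_only {j : Fin (X.k - 2)} {o : X.GA} (hj : .psi j ∈ L) (ho : o ∈ L) : o = .psi j := by
  rw [h.eq_singleton hj rfl rfl] at ho
  simpa using ho

end Paths

/-- Nodes of the raised copy of the multi-commodity network. -/
def InCopy : X.GV → Prop
  | .base _ => True
  | .vi _ => True
  | .wo _ => True
  | _ => False

section Copy

variable {L : List X.GA} (h : SimplePath gtl ghd .s L .t)
include h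

theorem exists_exit {o : X.GA} (ho : o ∈ L) (hc : InCopy (ghd o)) :
    (∃ f, .tf f ∈ L) ∨ (∃ a b, .wg a b ∈ L) ∨ ∃ a, .wt a ∈ L := by
  obtain ⟨o', ho', h1, h2⟩ := h.1.exists_leave InCopy (by simp [InCopy]) (Or.inr ⟨o, ho, hc⟩)
  cases o' <;> simp [gtl, ghd, InCopy] at h1 h2
  · exact Or.inr (Or.inr ⟨_, ho'⟩)
  · exact Or.inr (Or.inl ⟨_, _, ho'⟩)
  · exact Or.inl ⟨_, ho'⟩

theorem exists_entry {o : X.GA} (ho : o ∈ L) (hc : InCopy (gtl o)) :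
    (∃ i, .qs i ∈ L) ∨ (∃ l a, .qv l a ∈ L) ∨ ∃ a, .sv a ∈ L := by
  obtain ⟨o', ho', h1, h2⟩ := h.1.exists_enter InCopy (by simp [InCopy]) ⟨o, ho, hc⟩
  cases o' <;> simp [gtl, ghd, InCopy] at h1 h2
  · exact Or.inl ⟨_, ho'⟩
  · exact Or.inr (Or.inl ⟨_, _, ho'⟩)
  · exact Or.inr (Or.inr ⟨_, ho'⟩)

/-- A path leaves the copy at most once. -/
theorem exit_inj {o o' : X.GA} (ho : o ∈ L) (ho' : o' ∈ L) (h1 : InCopy (gtl o))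
    (h2 : InCopy (gtl o')) (h3 : ¬ InCopy (ghd o)) (h4 : ¬ InCopy (ghd o')) : o = o' := by
  -- An arc that leaves the copy ends in `t` or in an absorbing node with a single way on, so it
  -- determines the last arc of the path, and that arc determines it.
  have key : ∀ o ∈ L, InCopy (gtl o) → ¬ InCopy (ghd o) →
      ∃ o₁ ∈ L, ghd o₁ = .t ∧ (o₁ = o ∨ ∃ φ, ghd o = .ab φ ∧ o₁ = .st φ) := by
    intro o ho h1 h3
    by_cases ht : ghd o = .t
    · exact ⟨o, ho, ht, Or.inl rfl⟩
    · have : ∃ φ, ghd o = .ab φ := by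
        cases o <;> simp [gtl, ghd, InCopy] at h1 h3 ht ⊢
      obtain ⟨φ, hφ⟩ := this
      exact ⟨.st φ, st_of_hd h ho hφ, rfl, Or.inr ⟨φ, hφ, rfl⟩⟩
  obtain ⟨a, ha, hat, hac⟩ := key o ho h1 h3
  obtain ⟨b, hb, hbt, hbc⟩ := key o' ho' h2 h4
  obtain rfl : a = b := h.head_inj ha hb (hat.trans hbt.symm)
  rcases hac with rfl | ⟨φ, hφ, rfl⟩
  · rcases hbc with rfl | ⟨φ, hφ, rfl⟩
    · rfl
    · simp [gtl, InCopy] at h1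
  · rcases hbc with rfl | ⟨φ', hφ', e⟩
    · simp [gtl, InCopy] at h2
    · simp only [GA.st.injEq] at e
      subst e
      exact h.head_inj ho ho' (hφ.trans hφ'.symm)

end Copy

end Data

end RobustFlow

/-! ### What robustness forces: saturated starts and bounded pairs of arcs -/

namespace RobustFlow
namespace Data

variable {X : Data} {N : ℕ} {ι : Type} [Fintype ι] {L : ι → List X.GA}

/-- A robust solution of the single-commodity instance. -/
structure Solution (N : ℕ) (L : ι → List X.GA) : Prop where
  two_le : 2 ≤ X.k
  path : ∀ i, SimplePath gtl ghd .s (L i) .t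
  cap : ∀ o, cnt (fun i => o ∈ L i) ≤ N * gcap o
  rob : ∀ S : Finset X.GA, S.card ≤ X.k → N * X.target ≤ cnt fun i => ∀ o ∈ L i, o ∉ S

/-- The path uses a direct arc from source to sink. -/
def UsesPsi (L : List X.GA) : Prop := ∃ j, .psi j ∈ L

/-- The arcs `o`, `o'` together with all direct arcs from source to sink. -/
def attack (o o' : X.GA) : Finset X.GA := insert o (insert o' (Finset.univ.image GA.psi))

/-- The direct arcs number `k - 2`, which leaves room in the budget for two further arcs. -/
theorem card_attack (hk : 2 ≤ X.k) (o o' : X.GA) : (attack o o').card ≤ X.k := by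
  unfold attack
  have h1 : (Finset.univ.image (GA.psi (X := X))).card ≤ X.k - 2 := by
    simpa using Finset.card_image_le (s := Finset.univ) (f := GA.psi (X := X))
  have h2 := Finset.card_insert_le o (insert o' (Finset.univ.image (GA.psi (X := X))))
  have h3 := Finset.card_insert_le o' (Finset.univ.image (GA.psi (X := X)))
  omega

theorem avoids_attack_iff {o o' : X.GA} {L : List X.GA} :
    (∀ x ∈ L, x ∉ attack o o') ↔ o ∉ L ∧ o' ∉ L ∧ ¬ UsesPsi L := by
  simp only [attack, UsesPsi, Finset.mem_insert, Finset.mem_image, Finset.mem_univ, true_and]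
  constructor
  · intro h
    exact ⟨fun ho => h _ ho (Or.inl rfl), fun ho => h _ ho (Or.inr (Or.inl rfl)),
      fun ⟨j, hj⟩ => h _ hj (Or.inr (Or.inr ⟨j, rfl⟩))⟩
  · rintro ⟨h1, h2, h3⟩ x hx (rfl | rfl | ⟨j, rfl⟩)
    · exact h1 hx
    · exact h2 hx
    · exact h3 ⟨j, hx⟩

/-- The first bundle. -/
def zero (X : Data) : Fin X.H := (0 : Fin (X.K + 3))
/-- The second bundle. -/
def one (X : Data) : Fin X.H := (1 : Fin (X.K + 3))
/-- The third bundle. -/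
def two (X : Data) : Fin X.H := (2 : Fin (X.K + 3))

theorem val_zero : X.zero.val = 0 := rfl
theorem val_one : X.one.val = 1 := by simp [one]
theorem val_two : X.two.val = 2 := by
  simp [two]

theorem one_ne_zero : X.one ≠ X.zero := by
  intro e
  have := congrArg Fin.val e
  rw [val_one, val_zero] at this
  omega

theorem two_ne_zero : X.two ≠ X.zero := by
  intro e
  have := congrArg Fin.val e
  rw [val_two, val_zero] at this
  omega

/-- First arcs of paths that avoid the bundle `l₀`, the first bundle, and the direct arcs. -/
def startArc (l₀ : Fin X.H) (κ : Fin X.H ⊕ Fin X.n ⊕ X.Abs) (L : List X.GA) : Prop :=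
  match κ with
  | .inl l => (l ≠ X.zero ∧ l ≠ l₀) ∧ .sp l ∈ L
  | .inr (.inl a) => .sv a ∈ L
  | .inr (.inr φ) => .ss φ ∈ L

/-- Capacities of these arcs. -/
def startCap (l₀ : Fin X.H) (κ : Fin X.H ⊕ Fin X.n ⊕ X.Abs) : ℕ :=
  match κ with
  | .inl l => if l ≠ X.zero ∧ l ≠ l₀ then X.Q else 0
  | .inr (.inl _) => X.r₀
  | .inr (.inr φ) => ssCap φ

/-- The target is defined to make this true: of the `K + 3` arcs `.sp l`, those of two failed
bundles drop out. -/
theorem sum_startCap {l₀ : Fin X.H} (h : l₀ ≠ X.zero) : ∑ κ, startCap l₀ κ = X.target := by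
  have : ((Finset.univ.filter fun l : Fin X.H => l ≠ X.zero ∧ l ≠ l₀)).card = X.K + 1 := by
    have : (Finset.univ.filter fun l : Fin X.H => l ≠ X.zero ∧ l ≠ l₀) =
        (Finset.univ.erase X.zero).erase l₀ := by
      ext l; simp [and_comm]
    rw [this, Finset.card_erase_of_mem (by simp [h]), Finset.card_erase_of_mem (by simp)]
    rw [Finset.card_univ, Fintype.card_fin]
    simp [H]
  rw [Fintype.sum_sum_type, Fintype.sum_sum_type]
  simp only [startCap, target]
  rw [← Finset.sum_filter, Finset.sum_const, Finset.sum_const, this]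
  simp [add_assoc]

namespace Solution

variable (h : Solution N L)
include h

theorem cnt_startArc_le (l₀ : Fin X.H) (κ) :
    cnt (fun i => startArc l₀ κ (L i)) ≤ N * startCap l₀ κ := by
  rcases κ with l | a | φ
  · simp only [startArc, startCap]
    split_ifs with hc
    · exact (cnt_mono fun i hi => hi.2).trans (h.cap (.sp l))
    · simp only [mul_zero, Nat.le_zero, cnt_eq_zero_iff]
      exact fun i hi => hc hi.1
  · exact h.cap (.sv a)
  · exact h.cap (.ss φ)

/-- Let the first bundle, the bundle `l₀` and all direct arcs fail. Each surviving path has one of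
the listed first arcs, and the capacities of these add up to exactly the target. So all of them are
saturated, and by surviving paths alone: a path on such an arc avoids both failed bundles. -/
theorem start {l₀ : Fin X.H} (h0 : l₀ ≠ X.zero) (κ) :
    cnt (fun i => startArc l₀ κ (L i)) = N * startCap l₀ κ ∧
      ∀ i, startArc l₀ κ (L i) → .e X.zero ∉ L i ∧ .e l₀ ∉ L i := by
  have h1 := h.rob _ (card_attack h.two_le (.e X.zero) (.e l₀))
  have h2 : cnt (fun i => ∀ o ∈ L i, o ∉ attack (.e X.zero) (.e l₀)) ≤
      cnt (fun i => ∃ κ, startArc l₀ κ (L i) ∧ .e X.zero ∉ L i ∧ .e l₀ ∉ L i) := by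
    refine cnt_mono fun i hi => ?_
    obtain ⟨a, b, c⟩ := avoids_attack_iff.1 hi
    rcases first_cases (h.path i) with ⟨l, hl⟩ | hz | ⟨x, hx⟩ | ⟨x, hx⟩ | hp
    · refine ⟨.inl l, ⟨⟨?_, ?_⟩, hl⟩, a, b⟩
      · rintro rfl; exact a (e_of_sp (h.path i) hl)
      · rintro rfl; exact b (e_of_sp (h.path i) hl)
    · exact absurd (e_of_zin (h.path i) hz) a
    · exact ⟨.inr (.inl x), hx, a, b⟩
    · exact ⟨.inr (.inr x), hx, a, b⟩
    · exact absurd hp c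
  have h3 := cnt_exists_le (ι := ι)
    (fun κ i => startArc l₀ κ (L i) ∧ .e X.zero ∉ L i ∧ .e l₀ ∉ L i)
  have h4 : ∀ κ, cnt (fun i => startArc l₀ κ (L i) ∧ .e X.zero ∉ L i ∧ .e l₀ ∉ L i) ≤
      cnt (fun i => startArc l₀ κ (L i)) := fun κ => cnt_mono fun i hi => hi.1
  have h5 := eq_of_sum_le (s := Finset.univ)
    (f := fun κ => cnt (fun i => startArc l₀ κ (L i) ∧ .e X.zero ∉ L i ∧ .e l₀ ∉ L i))
    (g := fun κ => N * startCap l₀ κ)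
    (fun κ _ => (h4 κ).trans (h.cnt_startArc_le l₀ κ)) (by
      rw [← Finset.mul_sum, sum_startCap h0]
      exact h1.trans (h2.trans h3)) κ (by simp)
  have h6 := h.cnt_startArc_le l₀ κ
  have h7 := h4 κ
  refine ⟨by omega, fun i hi => ?_⟩
  exact (imp_of_cnt_le (fun i (hi : startArc l₀ κ (L i) ∧ .e X.zero ∉ L i ∧ .e l₀ ∉ L i) => hi.1)
    (by omega) i hi).2

omit h in
theorem exists_other (l : Fin X.H) : ∃ l₀ : Fin X.H, l₀ ≠ X.zero ∧ l₀ ≠ l := by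
  by_cases hl : l = X.one
  · refine ⟨X.two, ?_, ?_⟩ <;> intro e
    · have := congrArg Fin.val e
      rw [val_two, val_zero] at this
      omega
    · have := congrArg Fin.val (e.trans hl)
      rw [val_two, val_one] at this
      omega
  · refine ⟨X.one, ?_, fun e => hl e.symm⟩
    intro e
    have := congrArg Fin.val e
    rw [val_one, val_zero] at this
    omega

theorem cnt_sp {l : Fin X.H} (hl : l ≠ X.zero) : cnt (fun i => .sp l ∈ L i) = N * X.Q := by
  obtain ⟨l₀, h0, h1⟩ := exists_other l
  have := (h.start h0 (.inl l)).1
  simp only [startArc, startCap, if_pos (And.intro hl h1.symm)] at this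
  rw [← this]
  exact cnt_congr fun i => ⟨fun x => ⟨⟨hl, h1.symm⟩, x⟩, fun x => x.2⟩

/-- Let the bundle `l'` itself fail together with the first one; if `l'` is the first one, any
second bundle other than `l` will do. -/
theorem e_of_sp_iff {l l' : Fin X.H} (hl : l ≠ X.zero) {i : ι} (hi : .sp l ∈ L i)
    (hl' : .e l' ∈ L i) : l' = l := by
  by_contra hne
  by_cases h0 : l' = X.zero
  · subst h0
    obtain ⟨l₀, h0, h1⟩ := exists_other l
    exact ((h.start h0 (.inl l)).2 i ⟨⟨hl, h1.symm⟩, hi⟩).1 hl'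
  · exact ((h.start h0 (.inl l)).2 i ⟨⟨hl, fun e => hne e.symm⟩, hi⟩).2 hl'

theorem cnt_sv (a) : cnt (fun i => .sv a ∈ L i) = N * X.r₀ :=
  (h.start one_ne_zero (.inr (.inl a))).1

theorem cnt_ss (φ) : cnt (fun i => .ss φ ∈ L i) = N * ssCap φ :=
  (h.start one_ne_zero (.inr (.inr φ))).1

theorem not_e_of_sv {a} {i : ι} (hi : .sv a ∈ L i) (l : Fin X.H) : .e l ∉ L i := by
  by_cases h0 : l = X.zero
  · subst h0; exact ((h.start one_ne_zero (.inr (.inl a))).2 i hi).1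
  · exact ((h.start h0 (.inr (.inl a))).2 i hi).2

theorem not_e_of_ss {φ} {i : ι} (hi : .ss φ ∈ L i) (l : Fin X.H) : .e l ∉ L i := by
  by_cases h0 : l = X.zero
  · subst h0; exact ((h.start one_ne_zero (.inr (.inr φ))).2 i hi).1
  · exact ((h.start h0 (.inr (.inr φ))).2 i hi).2

/-- Sort the paths by their first arc: those into the first bundle use `.e X.zero`, those on `.sp
X.one` number `N * Q`, and the remaining ones are direct or belong to the saturated starts that add
up to the target. -/
theorem card_le : Fintype.card ι ≤ cnt (fun i => .e X.zero ∈ L i) + N * X.Q +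
    cnt (fun i => UsesPsi (L i)) + N * X.target := by
  rw [← cnt_true]
  have h1 : cnt (fun _ : ι => True) ≤ cnt (fun i => (((.e X.zero ∈ L i) ∨ .sp X.one ∈ L i) ∨
      UsesPsi (L i)) ∨ ∃ κ, startArc X.one κ (L i)) := by
    refine cnt_mono fun i _ => ?_
    rcases first_cases (h.path i) with ⟨l, hl⟩ | hz | ⟨x, hx⟩ | ⟨x, hx⟩ | hp
    · by_cases h0 : l = X.zero
      · subst h0; exact Or.inl (Or.inl (Or.inl (e_of_sp (h.path i) hl)))
      · by_cases h1 : l = X.one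
        · subst h1; exact Or.inl (Or.inl (Or.inr hl))
        · exact Or.inr ⟨.inl l, ⟨h0, h1⟩, hl⟩
    · exact Or.inl (Or.inl (Or.inl (e_of_zin (h.path i) hz)))
    · exact Or.inr ⟨.inr (.inl x), hx⟩
    · exact Or.inr ⟨.inr (.inr x), hx⟩
    · exact Or.inl (Or.inr hp)
  have h2 := cnt_exists_le (ι := ι) (fun κ i => startArc X.one κ (L i))
  have h3 : ∑ κ, cnt (fun i => startArc X.one κ (L i)) = N * X.target := by
    rw [← sum_startCap one_ne_zero, Finset.mul_sum]
    exact Finset.sum_congr rfl fun κ _ => (h.start one_ne_zero κ).1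
  rw [h3] at h2
  have h4 := h.cnt_sp one_ne_zero
  refine h1.trans (cnt_or_le.trans (Nat.add_le_add (cnt_or_le.trans (Nat.add_le_add
    (cnt_or_le.trans ?_) le_rfl)) h2))
  omega

/-- Any two arcs carry a bounded amount of flow. -/
theorem cnt_pair_le {o o' : X.GA} (ho : ∀ j, o ≠ .psi j) (ho' : ∀ j, o' ≠ .psi j) :
    cnt (fun i => o ∈ L i ∨ o' ∈ L i) ≤ cnt (fun i => .e X.zero ∈ L i) + N * X.Q := by
  -- Survivors, paths through `o` or `o'`, and direct paths are disjoint classes. The first has at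
  -- least `N * target` members, and the total is bounded by `card_le`, where the direct paths
  -- cancel.
  have h1 := h.rob _ (card_attack h.two_le o o')
  have h2 := h.card_le
  have h3 : cnt (fun i => (∀ x ∈ L i, x ∉ attack o o') ∨ ((o ∈ L i ∨ o' ∈ L i) ∨ UsesPsi (L i))) =
      _ := cnt_or_eq fun i hi => by
    have := avoids_attack_iff.1 hi
    tauto
  have h4 : cnt (fun i => (o ∈ L i ∨ o' ∈ L i) ∨ UsesPsi (L i)) = _ := cnt_or_eq fun i hi => by
    rintro ⟨j, hj⟩
    rcases hi with hi | hi
    · exact ho j (psi_only (h.path i) hj hi)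
    · exact ho' j (psi_only (h.path i) hj hi)
  have h5 := cnt_le_card (p := fun i =>
    (∀ x ∈ L i, x ∉ attack o o') ∨ ((o ∈ L i ∨ o' ∈ L i) ∨ UsesPsi (L i)))
  omega

end Solution

/-! ### The arcs that leave a bundle -/

/-- The path leaves the bundle `l` by an arc other than the one to the next bundle. -/
def leaves (l : Fin X.H) (κ : Unit ⊕ Fin X.K ⊕ (Σ i : Fin X.K, Fin (X.d i)) ⊕ Fin X.n)
    (L : List X.GA) : Prop :=
  match κ with
  | .inl _ => .qt l ∈ L
  | .inr (.inl i) => X.bun i = l ∧ .qs i ∈ L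
  | .inr (.inr (.inl f)) => .qf l f ∈ L
  | .inr (.inr (.inr a)) => .qv l a ∈ L

/-- Capacities of these arcs. -/
def leaveCap (l : Fin X.H) (κ : Unit ⊕ Fin X.K ⊕ (Σ i : Fin X.K, Fin (X.d i)) ⊕ Fin X.n) : ℕ :=
  match κ with
  | .inl _ => X.w
  | .inr (.inl i) => if X.bun i = l then X.d i else 0
  | .inr (.inr (.inl f)) => if l = X.bun f.1 then 0 else 1
  | .inr (.inr (.inr _)) => 2

/-- A bundle serves all `D` units of demand, its own commodity by `.qs` and the others by `.qf`, and
each arc with two units; `w` is the rest up to `Q`. -/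
theorem sum_leaveCap (l : Fin X.H) : ∑ κ, leaveCap l κ = X.Q := by
  rw [Fintype.sum_sum_type, Fintype.sum_sum_type, Fintype.sum_sum_type, Fintype.sum_sigma]
  simp only [leaveCap, Finset.sum_const, Finset.card_univ, Fintype.card_fin, smul_eq_mul]
  have : (∑ i : Fin X.K, if X.bun i = l then X.d i else 0) +
      ∑ i : Fin X.K, X.d i * (if l = X.bun i then 0 else 1) = X.D := by
    rw [← Finset.sum_add_distrib, D]
    refine Finset.sum_congr rfl fun i _ => ?_
    by_cases hi : X.bun i = l
    · simp [hi]
    · simp [hi, Ne.symm hi]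
  have h2 : (∑ i : Fin X.K, ∑ _j : Fin (X.d i), if l = X.bun i then 0 else 1) =
      ∑ i : Fin X.K, X.d i * (if l = X.bun i then 0 else 1) := by
    refine Finset.sum_congr rfl fun i _ => ?_
    rw [Finset.sum_const, Finset.card_univ, Fintype.card_fin, smul_eq_mul]
  rw [h2]
  simp only [Fintype.card_unit]
  simp only [Q, w]
  omega

theorem exists_leaves {L : List X.GA} (h : SimplePath gtl ghd .s L .t) {l : Fin X.H}
    (ho : .e l ∈ L) : .ch l ∈ L ∨ ∃ κ, leaves l κ L := by
  rcases e_succ h ho with h1 | h1 | ⟨i, h1⟩ | ⟨f, h1⟩ | ⟨a, h1⟩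
  · exact Or.inl h1
  · exact Or.inr ⟨.inl (), h1⟩
  · exact Or.inr ⟨.inr (.inl i), h1⟩
  · exact Or.inr ⟨.inr (.inr (.inl f)), h1⟩
  · exact Or.inr ⟨.inr (.inr (.inr a)), h1⟩

theorem leaves_tail {L : List X.GA} {l : Fin X.H} {κ} (hκ : leaves l κ L) :
    ∃ o ∈ L, gtl o = .q l ∧ o ≠ .ch l := by
  rcases κ with _ | i | f | a
  · exact ⟨_, hκ, rfl, by simp⟩
  · exact ⟨_, hκ.2, by simp [gtl, hκ.1], by simp⟩
  · exact ⟨_, hκ, rfl, by simp⟩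
  · exact ⟨_, hκ, rfl, by simp⟩

namespace Solution

variable (h : Solution N L)
include h

theorem cnt_leaves_le (l : Fin X.H) (κ) : cnt (fun i => leaves l κ (L i)) ≤ N * leaveCap l κ := by
  rcases κ with _ | i | f | a
  · exact h.cap (.qt l)
  · simp only [leaves, leaveCap]
    split_ifs with hc
    · exact (cnt_mono fun i hi => hi.2).trans (h.cap (.qs i))
    · simp only [mul_zero, Nat.le_zero, cnt_eq_zero_iff]
      exact fun i hi => hc hi.1
  · exact h.cap (.qf l f)
  · exact h.cap (.qv l a)

theorem cnt_exists_leaves_le (l : Fin X.H) : cnt (fun i => ∃ κ, leaves l κ (L i)) ≤ N * X.Q := by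
  refine (cnt_exists_le fun κ i => leaves l κ (L i)).trans ?_
  rw [← sum_leaveCap l, Finset.mul_sum]
  exact Finset.sum_le_sum fun κ _ => h.cnt_leaves_le l κ

theorem cnt_e_le (l : Fin X.H) :
    cnt (fun i => .e l ∈ L i) ≤ N * X.Q + cnt (fun i => .ch l ∈ L i) := by
  have h1 := h.cnt_exists_leaves_le l
  have h2 : cnt (fun i => .e l ∈ L i) ≤ cnt (fun i => (∃ κ, leaves l κ (L i)) ∨ .ch l ∈ L i) :=
    cnt_mono fun i hi => (exists_leaves (h.path i) hi).symm
  exact h2.trans (cnt_or_le.trans (by omega))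

theorem not_sp_of_ch {l l' : Fin X.H} (hl : l'.val + 1 = l.val) {i : ι} (hc : .ch l' ∈ L i) :
    .sp l ∉ L i := by
  intro hs
  have h1 := e_of_tl (h.path i) hc rfl
  have h2 := h.e_of_sp_iff (fun e => by rw [e, val_zero] at hl; omega) hs h1
  rw [h2] at hl
  omega

theorem le_cnt_e {l l' : Fin X.H} (hl : l'.val + 1 = l.val) :
    N * X.Q + cnt (fun i => .ch l' ∈ L i) ≤ cnt (fun i => .e l ∈ L i) := by
  rw [← h.cnt_sp (l := l) (fun e => by rw [e, val_zero] at hl; omega), ← cnt_or_eq]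
  · refine cnt_mono fun i hi => ?_
    rcases hi with hi | hi
    · exact e_of_sp (h.path i) hi
    · exact e_succ_of_ch (h.path i) hl hi
  · exact fun i h1 h2 => h.not_sp_of_ch hl h2 h1

/-- At each later bundle `Q` units join by `.sp` and at most `Q` leave for good, so the flow along
the chain cannot decrease. -/
theorem cnt_ch_mono {l : Fin X.H} :
    cnt (fun i => .ch X.zero ∈ L i) ≤ cnt (fun i => .ch l ∈ L i) := by
  obtain ⟨m, hm⟩ := l
  induction m with
  | zero => exact le_rfl
  | succ m ih =>
    have h1 := h.le_cnt_e (l := ⟨m + 1, hm⟩) (l' := ⟨m, by omega⟩) rfl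
    have h2 := h.cnt_e_le ⟨m + 1, hm⟩
    have h3 := ih (by omega)
    omega

/-- This lets any bundle play the role of the first one in the bound on pairs of arcs. -/
theorem cnt_e_zero_le (l : Fin X.H) :
    cnt (fun i => .e X.zero ∈ L i) ≤ cnt (fun i => .e l ∈ L i) := by
  obtain ⟨m, hm⟩ := l
  cases m with
  | zero => exact le_rfl
  | succ m =>
    have h1 := h.le_cnt_e (l := ⟨m + 1, hm⟩) (l' := ⟨m, by omega⟩) rfl
    have h2 := h.cnt_ch_mono (l := ⟨m, by omega⟩)
    have h3 := h.cnt_e_le X.zero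
    omega

/-- The flow on an arc that avoids a given bundle is bounded. -/
theorem cnt_and_not_e_le {o : X.GA} (ho : ∀ j, o ≠ .psi j) (l : Fin X.H) :
    cnt (fun i => o ∈ L i ∧ .e l ∉ L i) ≤ N * X.Q := by
  -- Of the allowance `cnt (e X.zero) + N * Q` for this pair, `.e l` alone consumes at least the
  -- first term.
  have h1 := h.cnt_pair_le (o := .e l) (o' := o) (by simp) ho
  have h2 : cnt (fun i => .e l ∈ L i ∨ (o ∈ L i ∧ .e l ∉ L i)) = _ :=
    cnt_or_eq fun i h1 h2 => h2.2 h1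
  have h3 : cnt (fun i => .e l ∈ L i ∨ (o ∈ L i ∧ .e l ∉ L i)) =
    cnt (fun i => .e l ∈ L i ∨ o ∈ L i) := cnt_congr fun i => by tauto
  have h4 := h.cnt_e_zero_le l
  omega

/-- The arc `.ss` already brings `Q` units to this absorbing arc, none of which meets a bundle. That
is all the arc may carry outside the bundle `l`, so units from `.po` must pass through `l`. -/
theorem e_of_po {j} {i : ι} (hi : .po j ∈ L i) (l : Fin X.H) : .e l ∈ L i := by
  by_contra hl
  have h1 := h.cnt_and_not_e_le (o := .st (.inr (.inr j))) (by simp) l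
  have h2 := h.cnt_ss (.inr (.inr j))
  simp only [ssCap] at h2
  have h3 : cnt (fun i => .ss (.inr (.inr j)) ∈ L i ∨ (.po j ∈ L i ∧ .e l ∉ L i)) = _ :=
    cnt_or_eq fun i h1 h2 => by
      have := (h.path i).head_inj h1 h2.1 rfl
      simp at this
  have h4 : cnt (fun i => .ss (.inr (.inr j)) ∈ L i ∨ (.po j ∈ L i ∧ .e l ∉ L i)) ≤
      cnt (fun i => .st (.inr (.inr j)) ∈ L i ∧ .e l ∉ L i) := by
    refine cnt_mono fun i hi => ?_
    rcases hi with hi | hi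
    · exact ⟨st_of_hd (h.path i) hi rfl, h.not_e_of_ss hi l⟩
    · exact ⟨st_of_hd (h.path i) hi.1 rfl, hi.2⟩
  have h5 : cnt (fun i => .po j ∈ L i ∧ .e l ∉ L i) = 0 := by omega
  exact cnt_eq_zero_iff.1 h5 i ⟨hi, hl⟩

/-- Going on along the chain would lead into a second bundle, or from the last bundle to some `.po
j` and hence, by `e_of_po`, through the first bundle. A path on `.sp l` meets only the bundle `l`.
-/
theorem exists_leaves_of_sp {l : Fin X.H} (hl : l ≠ X.zero) {i : ι} (hi : .sp l ∈ L i) :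
    ∃ κ, leaves l κ (L i) := by
  rcases exists_leaves (h.path i) (e_of_sp (h.path i) hi) with h1 | h1
  · exfalso
    by_cases hm : l.val + 1 < X.H
    · have h2 := h.e_of_sp_iff hl hi (e_succ_of_ch (h.path i) (l' := ⟨l.val + 1, hm⟩) rfl h1)
      have := congrArg Fin.val h2
      simp at this
    · obtain ⟨j, hj⟩ := po_of_ch_last (h.path i) (by omega) h1
      exact hl (h.e_of_sp_iff hl hi (h.e_of_po hj X.zero)).symm
  · exact h1

theorem le_cnt_exists_leaves (l : Fin X.H) : N * X.Q ≤ cnt (fun i => ∃ κ, leaves l κ (L i)) := by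
  by_cases hl : l = X.zero
  · subst hl
    -- For the first bundle, compare with the next two. The paths on `.sp X.two` are disjoint from
    -- those on `.e X.one`, so the pair bound gives that `.e X.one` carries no more than `.e
    -- X.zero`. It carries at least `N * Q` plus the flow on `.ch X.zero`, and removing the latter
    -- leaves `N * Q` paths that leave for good.
    have h1 := h.cnt_pair_le (o := .e X.one) (o' := .e X.two) (by simp) (by simp)
    have h2 : cnt (fun i => .e X.one ∈ L i ∨ .sp X.two ∈ L i) = _ := cnt_or_eq fun i h1 h2 => by
      have := congrArg Fin.val (h.e_of_sp_iff two_ne_zero h2 h1)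
      rw [val_one, val_two] at this
      omega
    have h3 : cnt (fun i => .e X.one ∈ L i ∨ .sp X.two ∈ L i) ≤
        cnt (fun i => .e X.one ∈ L i ∨ .e X.two ∈ L i) :=
      cnt_mono fun i => Or.imp_right (e_of_sp (h.path i))
    have h4 := h.le_cnt_e (l := X.one) (l' := X.zero) (by rw [val_one, val_zero])
    have h5 := h.cnt_sp two_ne_zero
    have h6 : cnt (fun i => .e X.zero ∈ L i) ≤
        cnt (fun i => (∃ κ, leaves X.zero κ (L i)) ∨ .ch X.zero ∈ L i) :=
      cnt_mono fun i hi => (exists_leaves (h.path i) hi).symm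
    have h7 := h6.trans cnt_or_le
    omega
  · rw [← h.cnt_sp hl]
    exact cnt_mono fun i hi => h.exists_leaves_of_sp hl hi

theorem cnt_leaves (l : Fin X.H) (κ) : cnt (fun i => leaves l κ (L i)) = N * leaveCap l κ := by
  refine eq_of_sum_le (s := Finset.univ) (f := fun κ => cnt (fun i => leaves l κ (L i)))
    (g := fun κ => N * leaveCap l κ) (fun κ _ => h.cnt_leaves_le l κ) ?_ κ (by simp)
  rw [← Finset.mul_sum, sum_leaveCap]
  exact (h.le_cnt_exists_leaves l).trans (cnt_exists_le fun κ i => leaves l κ (L i))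

theorem e_of_leaves {l : Fin X.H} {κ} {i : ι} (hi : leaves l κ (L i)) : .e l ∈ L i := by
  obtain ⟨o, ho, h1, -⟩ := leaves_tail hi
  exact e_of_tl (h.path i) ho h1

/-- A path that leaves the bundle `l` for good visits no other bundle. -/
theorem eq_of_leaves {l l' : Fin X.H} {κ} {i : ι} (hi : leaves l κ (L i)) (he : .e l' ∈ L i) :
    l' = l := by
  by_cases hl : l = X.zero
  · subst hl
    obtain ⟨o, ho, h1, h2⟩ := leaves_tail hi
    have h0 := h.e_of_leaves hi
    obtain ⟨m, hm⟩ := l'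
    cases m with
    | zero => rfl
    | succ m =>
      exfalso
      -- Backwards from a later bundle the path cannot have started by `.sp`, as it also meets the
      -- first bundle. So it came along the chain from `.ch X.zero`, and two different arcs of the
      -- path would leave the same node.
      have key : ∀ m (hm : m + 1 < X.H), .e ⟨m + 1, hm⟩ ∈ L i → .ch X.zero ∈ L i := by
        intro m
        induction m with
        | zero =>
          intro hm hc
          rcases e_pred (h.path i) hc with h3 | h3 | ⟨l'', h3, h4⟩
          · have := congrArg Fin.val (h.e_of_sp_iff (fun e => by
              simpa [val_zero] using congrArg Fin.val e) h3 h0)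
            simp [val_zero] at this
          · simp at h3
          · have : l'' = X.zero := Fin.ext (by rw [val_zero]; simpa using h3)
            exact this ▸ h4
        | succ m ih =>
          intro hm hc
          rcases e_pred (h.path i) hc with h3 | h3 | ⟨l'', h3, h4⟩
          · have := congrArg Fin.val (h.e_of_sp_iff (fun e => by
              simpa [val_zero] using congrArg Fin.val e) h3 h0)
            simp [val_zero] at this
          · simp at h3
          · have : l'' = ⟨m + 1, by omega⟩ := Fin.ext (by simpa using h3)
            exact ih (by omega) (this ▸ e_of_tl (h.path i) h4 rfl)
      exact h2 ((h.path i).tail_inj ho (key m hm he) h1)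
  -- The paths on `.sp l` leave for good at `l`, and there are as many of them as can leave at all;
  -- so no others do.
  · have h1 := imp_of_cnt_le (p := fun i => .sp l ∈ L i) (q := fun i => ∃ κ, leaves l κ (L i))
      (fun i hi => h.exists_leaves_of_sp hl hi) (by
        rw [h.cnt_sp hl]; exact h.cnt_exists_leaves_le l) i ⟨κ, hi⟩
    exact h.e_of_sp_iff hl h1 he

end Solution

end Data
end RobustFlow

namespace RobustFlow

/-! ### Uncrossing -/

section Uncross

variable {V A : Type} (tl hd : A → V) (s t : V)

/-- A walk that starts at `s` or with a given arc, and that ends at `t` or with a given arc. -/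
def Strand (x : Option A × List A × Option A) : Prop :=
  ∃ u v, Walk tl hd u x.2.1 v ∧ (x.1 = none → u = s) ∧ (∀ a, x.1 = some a → ∃ l, x.2.1 = a :: l) ∧
    (x.2.2 = none → v = t) ∧ ∀ a, x.2.2 = some a → ∃ l, x.2.1 = l ++ [a]

variable {tl hd s t}

open Classical in
/-- Strands that begin with each arc as often as they end with it can be recombined to walks and
single arcs, without increasing the number of elements that meet any given set of arcs. -/
theorem exists_uncrossed (m : Multiset (Option A × List A × Option A))
    (hm : ∀ x ∈ m, Strand tl hd s t x)
    (hb : ∀ a, m.countP (fun x => x.1 = some a) = m.countP fun x => x.2.2 = some a) :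
    ∃ W : Multiset (List A), (∀ l ∈ W, Walk tl hd s l t) ∧
      Multiset.card W = m.countP (fun x => x.1 = none) ∧
      ∀ S : Finset A, W.countP (fun l => ∃ a ∈ l, a ∈ S) +
        ∑ a ∈ S, m.countP (fun x => x.1 = some a) ≤ m.countP fun x => ∃ a ∈ x.2.1, a ∈ S := by
  induction hc : Multiset.card m using Nat.strong_induction_on generalizing m with
  | _ c ih =>
  by_cases hx : ∃ x ∈ m, ∃ a, x.1 = some a
  · obtain ⟨⟨α, l, β⟩, hx, a, ha⟩ := hx
    simp only at ha
    subst ha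
    obtain ⟨m', rfl⟩ := Multiset.exists_cons_of_mem hx
    obtain ⟨u, v, hw, -, h2, h3, h4⟩ := hm _ hx
    obtain ⟨l, rfl⟩ := h2 a rfl
    simp only at hw h3 h4
    -- A strand that begins and ends with the same arc is discarded; its use of `a` pays for the
    -- term of `a` in the sum.
    by_cases hβ : β = some a
    · subst hβ
      obtain ⟨W, hW1, hW2, hW3⟩ := ih _ (by rw [← hc]; simp) m'
        (fun x hx => hm x (Multiset.mem_cons_of_mem hx)) (fun b => by
          have := hb b
          simp only [Multiset.countP_cons] at this
          omega) rfl
      refine ⟨W, hW1, by simp [hW2], fun S => ?_⟩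
      have := hW3 S
      simp only [Multiset.countP_cons, Finset.sum_add_distrib, Option.some.injEq,
        Finset.sum_ite_eq, List.mem_cons]
      split_ifs with h5 h6 h6
      · omega
      · exact absurd ⟨a, Or.inl rfl, h5⟩ h6
      · omega
      · omega
    -- By balance some other strand ends with `a`. The two are glued with a single copy of `a`, so
    -- the number of strands drops and one use of `a` is saved.
    · have hpos : 0 < (((some a, a :: l, β) ::ₘ m')).countP (fun x => x.2.2 = some a) := by
        rw [← hb]
        exact Multiset.countP_pos.2 ⟨_, hx, rfl⟩
      obtain ⟨⟨α', l', β'⟩, hy, hye⟩ := Multiset.countP_pos.1 hpos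
      simp only at hye
      subst hye
      have hy' : (α', l', some a) ∈ m' := by
        rcases Multiset.mem_cons.1 hy with e | e
        · simp only [Prod.mk.injEq] at e
          exact absurd e.2.2.symm hβ
        · exact e
      obtain ⟨m'', rfl⟩ := Multiset.exists_cons_of_mem hy'
      obtain ⟨u', v', hw', g1, g2, -, g4⟩ := hm _ hy
      obtain ⟨l', rfl⟩ := g4 a rfl
      simp only at hw' g1 g2
      have hwalk : Walk tl hd u' ((l' ++ [a]) ++ l) v := by
        obtain ⟨z, hz1, hz2⟩ := walk_append.1 hw'
        rw [List.append_assoc]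
        exact walk_append.2 ⟨z, hz1, hz2.1, hw.2⟩
      obtain ⟨W, hW1, hW2, hW3⟩ := ih _ (by rw [← hc]; simp) ((α', (l' ++ [a]) ++ l, β) ::ₘ m'')
        (fun x hx => by
          rcases Multiset.mem_cons.1 hx with rfl | hx
          · refine ⟨u', v, hwalk, g1, fun b hb' => ?_, h3, fun b hb' => ?_⟩
            · obtain ⟨q, hq⟩ := g2 b hb'
              exact ⟨q ++ l, by simp only; rw [hq]; rfl⟩
            · obtain ⟨q, hq⟩ := h4 b hb'
              cases q with
              | nil =>
                simp only [List.nil_append, List.cons.injEq] at hq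
                exact absurd (hq.1 ▸ hb') hβ
              | cons c q =>
                simp only [List.cons_append, List.cons.injEq] at hq
                exact ⟨l' ++ [a] ++ q, by simp [hq.2]⟩
          · exact hm x (by simp [hx])) (fun b => by
          have := hb b
          simp only [Multiset.countP_cons] at this ⊢
          omega) rfl
      refine ⟨W, hW1, by simpa [Multiset.countP_cons] using hW2, fun S => ?_⟩
      have := hW3 S
      simp only [Multiset.countP_cons, Finset.sum_add_distrib, Option.some.injEq,
        Finset.sum_ite_eq] at this ⊢
      -- If `a` lies in `S`, both old strands were hit, which pays for the new strand and for the
      -- saved use of `a`. Otherwise any hit of the new strand was a hit of one of the old ones.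
      have key : (if ∃ b ∈ l' ++ [a] ++ l, b ∈ S then 1 else 0) + (if a ∈ S then 1 else 0) ≤
          (if ∃ b ∈ a :: l, b ∈ S then 1 else 0) + if ∃ b ∈ l' ++ [a], b ∈ S then 1 else 0 := by
        by_cases h5 : a ∈ S
        · rw [if_pos (⟨a, by simp, h5⟩ : ∃ b ∈ a :: l, b ∈ S),
            if_pos (⟨a, by simp, h5⟩ : ∃ b ∈ l' ++ [a], b ∈ S), if_pos h5]
          split_ifs <;> omega
        · rw [if_neg h5]
          by_cases h6 : ∃ b ∈ l' ++ [a] ++ l, b ∈ S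
          · rw [if_pos h6]
            obtain ⟨b, hb1, hb2⟩ := h6
            rcases List.mem_append.1 hb1 with h7 | h7
            · rw [if_pos (⟨b, h7, hb2⟩ : ∃ b ∈ l' ++ [a], b ∈ S)]; omega
            · rw [if_pos (⟨b, by simp [h7], hb2⟩ : ∃ b ∈ a :: l, b ∈ S)]; omega
          · rw [if_neg h6]; omega
      omega
  · push Not at hx
    have h1 : ∀ x ∈ m, x.1 = none := fun x hx' => by
      cases e : x.1 with
      | none => rfl
      | some a => exact absurd e (hx x hx' a)
    have h0 : ∀ a, m.countP (fun x => x.1 = some a) = 0 := fun a => by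
      rw [Multiset.countP_eq_zero]
      exact fun x hx' => hx x hx' a
    have h2 : ∀ x ∈ m, x.2.2 = none := fun x hx' => by
      cases e : x.2.2 with
      | none => rfl
      | some a =>
        have := h0 a
        rw [hb a, Multiset.countP_eq_zero] at this
        exact absurd e (this x hx')
    refine ⟨m.map fun x => x.2.1, ?_, ?_, fun S => ?_⟩
    · intro l hl
      obtain ⟨x, hx', rfl⟩ := Multiset.mem_map.1 hl
      obtain ⟨u, v, hw, g1, -, g3, -⟩ := hm x hx'
      rw [← g1 (h1 x hx'), ← g3 (h2 x hx')]
      exact hw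
    · rw [Multiset.card_map, Multiset.countP_eq_card.2 h1]
    · rw [Multiset.countP_map, ← Multiset.countP_eq_card_filter]
      simp [h0]

end Uncross

namespace Data

variable {X : Data} {N : ℕ} {ι : Type} [Fintype ι] {L : ι → List X.GA}

/-! ### Entries and exits of the copy -/

/-- Arcs entering the copy. -/
def entryArc : Fin X.K ⊕ (Fin X.H × Fin X.n) ⊕ Fin X.n → X.GA
  | .inl i => .qs i
  | .inr (.inl (l, a)) => .qv l a
  | .inr (.inr a) => .sv a

/-- Arcs leaving the copy. -/
def exitArc : (Σ i : Fin X.K, Fin (X.d i)) ⊕ (Fin X.n × Bool) ⊕ Fin X.n → X.GA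
  | .inl f => .tf f
  | .inr (.inl (a, b)) => .wg a b
  | .inr (.inr a) => .wt a

theorem exitArc_tl (ξ) : InCopy (gtl (X := X) (exitArc ξ)) := by
  rcases ξ with f | ⟨a, b⟩ | a <;> simp [exitArc, gtl, InCopy]

theorem exitArc_hd (ξ) : ¬ InCopy (ghd (X := X) (exitArc ξ)) := by
  rcases ξ with f | ⟨a, b⟩ | a <;> simp [exitArc, ghd, InCopy]

theorem sum_entry : ∑ κ, gcap (X := X) (entryArc κ) = X.D + X.H * X.n * 2 + X.n * X.r₀ := by
  rw [Fintype.sum_sum_type, Fintype.sum_sum_type]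
  simp [entryArc, gcap, D, add_assoc]

/-- The copy has equal capacity on the way in and out: two units per bundle and arc enter by `.qv`,
and `H` units leave by each of the two arcs `.wg a b`. Saturated entries therefore saturate the
exits. -/
theorem sum_exit : ∑ κ, gcap (X := X) (exitArc κ) = X.D + X.H * X.n * 2 + X.n * X.r₀ := by
  rw [Fintype.sum_sum_type, Fintype.sum_sum_type]
  simp [exitArc, gcap, D]
  ring

/-- The path enters the copy from the bundle `l`. -/
def InClass (l : Fin X.H) (L : List X.GA) : Prop :=
  (∃ i, X.bun i = l ∧ .qs i ∈ L) ∨ ∃ a, .qv l a ∈ L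

theorem exists_leaves_of_inClass {l : Fin X.H} {L : List X.GA} (h : InClass l L) :
    ∃ κ, leaves l κ L := by
  rcases h with ⟨i, hi⟩ | ⟨a, ha⟩
  · exact ⟨.inr (.inl i), hi⟩
  · exact ⟨.inr (.inr (.inr a)), ha⟩

namespace Solution

variable (h : Solution N L)
include h

theorem e_of_inClass {l : Fin X.H} {i : ι} (hi : InClass l (L i)) : .e l ∈ L i :=
  h.e_of_leaves (exists_leaves_of_inClass hi).choose_spec

theorem inClass_eq {l l' : Fin X.H} {i : ι} (hi : InClass l (L i)) (he : .e l' ∈ L i) : l' = l :=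
  h.eq_of_leaves (exists_leaves_of_inClass hi).choose_spec he

theorem cnt_qs (i₀ : Fin X.K) : cnt (fun i => .qs i₀ ∈ L i) = N * X.d i₀ := by
  have := h.cnt_leaves (X.bun i₀) (.inr (.inl i₀))
  simpa [leaves, leaveCap] using this

theorem cnt_qv (l a) : cnt (fun i => .qv l a ∈ L i) = N * 2 :=
  h.cnt_leaves l (.inr (.inr (.inr a)))

theorem cnt_qf (l : Fin X.H) (f) :
    cnt (fun i => .qf l f ∈ L i) = N * if l = X.bun f.1 then 0 else 1 :=
  h.cnt_leaves l (.inr (.inr (.inl f)))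

theorem cnt_entry (κ) : cnt (fun i => entryArc κ ∈ L i) = N * gcap (X := X) (entryArc κ) := by
  rcases κ with i | ⟨l, a⟩ | a
  · exact h.cnt_qs i
  · exact h.cnt_qv l a
  · exact h.cnt_sv a

omit [Fintype ι] h in
theorem entry_cases (κ) {i : ι} (hi : entryArc κ ∈ L i) :
    (∃ l, InClass l (L i) ∧ gtl (X := X) (entryArc κ) = .q l) ∨ ∃ a, κ = .inr (.inr a) ∧ .sv a ∈ L i := by
  rcases κ with j | ⟨l, a⟩ | a
  · exact Or.inl ⟨_, Or.inl ⟨j, rfl, hi⟩, rfl⟩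
  · exact Or.inl ⟨_, Or.inr ⟨a, hi⟩, rfl⟩
  · exact Or.inr ⟨a, rfl, hi⟩

omit [Fintype ι] h in
theorem entryArc_injective : Function.Injective (entryArc (X := X)) := by
  intro κ κ' e
  rcases κ with i | ⟨l, a⟩ | a <;> rcases κ' with i' | ⟨l', a'⟩ | a' <;> simp_all [entryArc]

omit [Fintype ι] h in
theorem exitArc_injective : Function.Injective (exitArc (X := X)) := by
  intro κ κ' e
  rcases κ with i | ⟨l, a⟩ | a <;> rcases κ' with i' | ⟨l', a'⟩ | a' <;> simp_all [exitArc]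

/-- Entry arcs start at `s` or at a bundle. A path on `.sv` meets no bundle, and one that enters
from a bundle meets no other, so two entries on one path have the same tail. -/
theorem entry_inj {i : ι} {κ κ'} (h1 : entryArc κ ∈ L i) (h2 : entryArc κ' ∈ L i) : κ = κ' := by
  apply entryArc_injective
  apply (h.path i).tail_inj h1 h2
  rcases entry_cases κ h1 with ⟨l, hl, e⟩ | ⟨a, rfl, ha⟩ <;>
    rcases entry_cases κ' h2 with ⟨l', hl', e'⟩ | ⟨a', rfl, ha'⟩
  · rw [e, e', h.inClass_eq hl (h.e_of_inClass hl')]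
  · exact absurd (h.e_of_inClass hl) (h.not_e_of_sv ha' _)
  · exact absurd (h.e_of_inClass hl') (h.not_e_of_sv ha _)
  · rfl

theorem exit_eq {i : ι} {κ κ'} (h1 : exitArc κ ∈ L i) (h2 : exitArc κ' ∈ L i) : κ = κ' :=
  exitArc_injective (exit_inj (h.path i) h1 h2 (exitArc_tl _) (exitArc_tl _) (exitArc_hd _)
    (exitArc_hd _))

/-- All entries are saturated, each path enters at most once and has to leave again, and the total
exit capacity equals the total entry capacity. -/
theorem cnt_exit (ξ) : cnt (fun i => exitArc ξ ∈ L i) = N * gcap (X := X) (exitArc ξ) := by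
  refine eq_of_sum_le (s := Finset.univ) (f := fun ξ => cnt (fun i => exitArc ξ ∈ L i))
    (g := fun ξ => N * gcap (X := X) (exitArc ξ)) (fun ξ _ => h.cap _) ?_ ξ (by simp)
  rw [← Finset.mul_sum, sum_exit, ← sum_entry, Finset.mul_sum]
  calc ∑ κ, N * gcap (X := X) (entryArc κ) = ∑ κ, cnt (fun i => entryArc κ ∈ L i) :=
        Finset.sum_congr rfl fun κ _ => (h.cnt_entry κ).symm
    _ = cnt (fun i => ∃ κ, entryArc κ ∈ L i) :=
        (cnt_exists_eq (fun κ i => entryArc κ ∈ L i) fun i κ κ' => h.entry_inj).symm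
    _ ≤ cnt (fun i => ∃ ξ, exitArc ξ ∈ L i) := by
        refine cnt_mono fun i hi => ?_
        obtain ⟨κ, hκ⟩ := hi
        have hc : InCopy (ghd (entryArc κ)) := by
          rcases κ with i | ⟨l, a⟩ | a <;> simp [entryArc, ghd, InCopy]
        rcases exists_exit (h.path i) hκ hc with ⟨f, hf⟩ | ⟨a, b, hab⟩ | ⟨a, ha⟩
        · exact ⟨.inl f, hf⟩
        · exact ⟨.inr (.inl (a, b)), hab⟩
        · exact ⟨.inr (.inr a), ha⟩
    _ ≤ _ := cnt_exists_le fun ξ i => exitArc ξ ∈ L i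

theorem inClass_of_exit {i : ι} {ξ} (hi : exitArc ξ ∈ L i) {l : Fin X.H} (he : .e l ∈ L i) :
    InClass l (L i) := by
  rcases exists_entry (h.path i) hi (exitArc_tl ξ) with ⟨j, hj⟩ | ⟨l', a, ha⟩ | ⟨a, ha⟩
  · have hc : InClass (X.bun j) (L i) := Or.inl ⟨j, rfl, hj⟩
    rw [h.inClass_eq hc he]; exact hc
  · have hc : InClass l' (L i) := Or.inr ⟨a, ha⟩
    rw [h.inClass_eq hc he]; exact hc
  · exact absurd he (h.not_e_of_sv ha l)

/-- Outside the bundle of its commodity, the absorbing arc of `f` already receives `B` units from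
`s` and one unit from each of the other `H - 1` bundles. Since `B + (H - 1) = Q`, nothing else may
reach it without passing through that bundle. -/
theorem e_of_tf {f} {i : ι} (hi : .tf f ∈ L i) : .e (X.bun f.1) ∈ L i := by
  by_contra hne
  have h1 := h.cnt_and_not_e_le (o := .st (.inl f)) (by simp) (X.bun f.1)
  have h2 := h.cnt_ss (.inl f)
  simp only [ssCap] at h2
  have h3 : cnt (fun i => ∃ l, .qf l f ∈ L i) = N * (X.H - 1) := by
    rw [cnt_exists_eq (fun l i => .qf l f ∈ L i) (fun i l l' h1 h2 => by
      simpa using (h.path i).head_inj h1 h2 rfl)]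
    simp only [h.cnt_qf]
    rw [← Finset.mul_sum, Finset.sum_ite, Finset.sum_const, Finset.sum_const, Finset.filter_ne',
      Finset.card_erase_of_mem (by simp), Finset.card_univ, Fintype.card_fin]
    simp
  have h4 : cnt (fun i => (.ss (.inl f) ∈ L i ∨ ∃ l, .qf l f ∈ L i) ∨
      (.tf f ∈ L i ∧ .e (X.bun f.1) ∉ L i)) = _ := cnt_or_eq fun i h1 h2 => by
    rcases h1 with h1 | ⟨l, h1⟩
    · simpa using (h.path i).head_inj h1 h2.1 rfl
    · simpa using (h.path i).head_inj h1 h2.1 rfl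
  have h5 : cnt (fun i => .ss (.inl f) ∈ L i ∨ ∃ l, .qf l f ∈ L i) = _ :=
    cnt_or_eq fun i h1 ⟨l, h2⟩ => by
      simpa using (h.path i).head_inj h1 h2 rfl
  have h6 : cnt (fun i => (.ss (.inl f) ∈ L i ∨ ∃ l, .qf l f ∈ L i) ∨
      (.tf f ∈ L i ∧ .e (X.bun f.1) ∉ L i)) ≤
      cnt (fun i => .st (.inl f) ∈ L i ∧ .e (X.bun f.1) ∉ L i) := by
    refine cnt_mono fun i hi => ?_
    rcases hi with (hi | ⟨l, hi⟩) | hi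
    · exact ⟨st_of_hd (h.path i) hi rfl, h.not_e_of_ss hi _⟩
    · refine ⟨st_of_hd (h.path i) hi rfl, fun he => ?_⟩
      have := h.eq_of_leaves (l := l) (κ := .inr (.inr (.inl f))) hi he
      have h0 := h.cnt_qf l f
      rw [if_pos this.symm, mul_zero, cnt_eq_zero_iff] at h0
      exact h0 i hi
    · exact ⟨st_of_hd (h.path i) hi.1 rfl, hi.2⟩
  have h7 : X.B + (X.H - 1) = X.Q := by simp only [B, Q, H]; omega
  have h8 : N * X.B + N * (X.H - 1) = N * X.Q := by rw [← mul_add, h7]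
  have h9 : cnt (fun i => .tf f ∈ L i ∧ .e (X.bun f.1) ∉ L i) = 0 := by omega
  exact cnt_eq_zero_iff.1 h9 i ⟨hi, hne⟩

/-- `B + H = Q + 1` units reach this absorbing arc, but at most `Q` of them avoid a given bundle. So
each of the `H` bundles supplies at least one of the `H` units from the copy, hence exactly one. -/
theorem cnt_wg_inClass (a b) (l : Fin X.H) :
    cnt (fun i => .wg a b ∈ L i ∧ InClass l (L i)) = N := by
  have h0 : ∀ l, N ≤ cnt (fun i => .wg a b ∈ L i ∧ InClass l (L i)) := by
    intro l
    have h1 := h.cnt_and_not_e_le (o := .st (.inr (.inl (a, b)))) (by simp) l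
    have h2 := h.cnt_ss (.inr (.inl (a, b)))
    simp only [ssCap] at h2
    have h3 : cnt (fun i => .ss (.inr (.inl (a, b))) ∈ L i ∨ (.wg a b ∈ L i ∧ .e l ∉ L i)) = _ :=
      cnt_or_eq fun i h1 h2 => by simpa using (h.path i).head_inj h1 h2.1 rfl
    have h4 : cnt (fun i => .ss (.inr (.inl (a, b))) ∈ L i ∨ (.wg a b ∈ L i ∧ .e l ∉ L i)) ≤
        cnt (fun i => .st (.inr (.inl (a, b))) ∈ L i ∧ .e l ∉ L i) := by
      refine cnt_mono fun i hi => ?_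
      rcases hi with hi | hi
      · exact ⟨st_of_hd (h.path i) hi rfl, h.not_e_of_ss hi _⟩
      · exact ⟨st_of_hd (h.path i) hi.1 rfl, hi.2⟩
    have h5 := cnt_split (fun i => .wg a b ∈ L i) (fun i => .e l ∈ L i)
    have h6 : cnt (fun i => .wg a b ∈ L i) = N * X.H := h.cnt_exit (.inr (.inl (a, b)))
    have h7 : cnt (fun i => .wg a b ∈ L i ∧ .e l ∈ L i) ≤
        cnt (fun i => .wg a b ∈ L i ∧ InClass l (L i)) :=
      cnt_mono fun i hi => ⟨hi.1, h.inClass_of_exit (ξ := .inr (.inl (a, b))) hi.1 hi.2⟩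
    have h8 : X.B + X.H = X.Q + 1 := by simp only [B, Q]; omega
    have h9 : N * X.B + N * X.H = N * X.Q + N := by rw [← mul_add, h8]; ring
    omega
  refine (eq_of_sum_le (s := Finset.univ) (f := fun _ => N)
    (g := fun l => cnt (fun i => .wg a b ∈ L i ∧ InClass l (L i))) (fun l _ => h0 l) ?_ l
    (by simp)).symm
  rw [← cnt_exists_eq (fun l i => .wg a b ∈ L i ∧ InClass l (L i))
    (fun i l l' h1 h2 => h.inClass_eq h2.2 (h.e_of_inClass h1.2))]
  have h6 : cnt (fun i => .wg a b ∈ L i) ≤ N * X.H := h.cap (.wg a b)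
  rw [Finset.sum_const, Finset.card_univ, Fintype.card_fin, smul_eq_mul, mul_comm]
  exact (cnt_mono fun i ⟨l, hi⟩ => hi.1).trans h6

/-- Paths that enter the copy from the bundle of a commodity leave it towards the absorbing arcs
of this commodity or of the arcs. -/
theorem exit_of_inClass {j : Fin X.K} {i : ι} (hi : InClass (X.bun j) (L i)) :
    (∃ m : Fin (X.d j), .tf ⟨j, m⟩ ∈ L i) ∨ ∃ a b, .wg a b ∈ L i := by
  have h1 : cnt (fun i => InClass (X.bun j) (L i)) ≤ N * X.d j + N * 2 * X.n := by
    refine cnt_or_le.trans (Nat.add_le_add ?_ ?_)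
    · rw [← h.cnt_qs j]
      refine cnt_mono fun i hi => ?_
      obtain ⟨j', hj', hi⟩ := hi
      rwa [← Fin.castAdd_injective _ _ hj']
    · refine (cnt_exists_le fun a i => .qv (X.bun j) a ∈ L i).trans ?_
      simp only [h.cnt_qv, Finset.sum_const, Finset.card_univ, Fintype.card_fin, smul_eq_mul]
      exact le_of_eq (mul_comm _ _)
  have h2 : cnt (fun i => ∃ m : Fin (X.d j), .tf ⟨j, m⟩ ∈ L i) = N * X.d j := by
    rw [cnt_exists_eq (fun (m : Fin (X.d j)) i => .tf ⟨j, m⟩ ∈ L i) (fun i m m' h1 h2 => by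
      have := h.exit_eq (κ := .inl ⟨j, m⟩) (κ' := .inl ⟨j, m'⟩) h1 h2
      simpa using this)]
    have : ∀ m : Fin (X.d j), cnt (fun i => .tf ⟨j, m⟩ ∈ L i) = N * 1 :=
      fun m => h.cnt_exit (.inl ⟨j, m⟩)
    simp only [this, Finset.sum_const, Finset.card_univ, Fintype.card_fin, smul_eq_mul]
    ring
  have h3 : cnt (fun i => ∃ x : Fin X.n × Bool, .wg x.1 x.2 ∈ L i ∧ InClass (X.bun j) (L i)) =
      N * 2 * X.n := by
    rw [cnt_exists_eq (fun (x : Fin X.n × Bool) i => .wg x.1 x.2 ∈ L i ∧ InClass (X.bun j) (L i))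
      (fun i x x' h1 h2 => by
        have := h.exit_eq (κ := .inr (.inl x)) (κ' := .inr (.inl x')) h1.1 h2.1
        simpa using this)]
    simp only [h.cnt_wg_inClass, Finset.sum_const, Finset.card_univ, Fintype.card_prod,
      Fintype.card_fin, Fintype.card_bool, smul_eq_mul]
    ring
  have h4 : cnt (fun i => (∃ m : Fin (X.d j), .tf ⟨j, m⟩ ∈ L i) ∨
      ∃ x : Fin X.n × Bool, .wg x.1 x.2 ∈ L i ∧ InClass (X.bun j) (L i)) = _ :=
    cnt_or_eq fun i ⟨m, h1⟩ ⟨x, h2, _⟩ => by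
      have := h.exit_eq (κ := .inl ⟨j, m⟩) (κ' := .inr (.inl x)) h1 h2
      simp at this
  -- At most `N * (d j + 2 * n)` paths enter from this bundle, and the listed exits already account
  -- for that many of them; nothing is left for `.wt` or foreign sinks.
  have h5 := imp_of_cnt_le (p := fun i => (∃ m : Fin (X.d j), .tf ⟨j, m⟩ ∈ L i) ∨
      ∃ x : Fin X.n × Bool, .wg x.1 x.2 ∈ L i ∧ InClass (X.bun j) (L i))
      (q := fun i => InClass (X.bun j) (L i)) (fun i hi => by
        rcases hi with ⟨m, hm⟩ | ⟨x, -, hx⟩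
        · exact h.inClass_of_exit (ξ := .inl ⟨j, m⟩) hm (h.e_of_tf hm)
        · exact hx) (by omega) i hi
  rcases h5 with h5 | ⟨x, hx, -⟩
  · exact Or.inl h5
  · exact Or.inr ⟨_, _, hx⟩

end Solution

/-! ### Strands -/

/-- The arcs of the multi-commodity network that a path uses. -/
def mids (Λ : List X.GA) : List (Fin X.n) :=
  Λ.filterMap fun | .mid a => some a | _ => none

/-- How a walk that started in the copy may leave it. -/
def Ends (v : Fin X.nV) (l : List (Fin X.n)) (Λ : List X.GA) : Prop :=
  (∃ f, .tf f ∈ Λ ∧ Walk X.tl X.hd v l (X.snk f.1)) ∨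
    ∃ a, ((∃ b, .wg a b ∈ Λ) ∨ .wt a ∈ Λ) ∧ (∃ l', l = l' ++ [a]) ∧ Walk X.tl X.hd v l (X.hd a)

theorem Ends.mono {v : Fin X.nV} {l : List (Fin X.n)} {Λ Λ' : List X.GA} (h : Ends v l Λ)
    (hs : Λ ⊆ Λ') : Ends v l Λ' := by
  rcases h with ⟨f, hf, hw⟩ | ⟨a, ha, hl, hw⟩
  · exact Or.inl ⟨f, hs hf, hw⟩
  · exact Or.inr ⟨a, ha.imp (fun ⟨b, hb⟩ => ⟨b, hs hb⟩) (fun h => hs h), hl, hw⟩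

/-- One induction for all kinds of nodes that a walk can meet after entering the copy, because
consecutive arcs pass from one kind to the next. -/
theorem ends_of_walk (Λ : List X.GA) :
    (∀ v, Walk gtl ghd (.base v) Λ .t → Ends v (mids Λ) Λ) ∧
    (∀ a, Walk gtl ghd (.vi a) Λ .t → (∃ l', mids Λ = a :: l') ∧ Ends (X.tl a) (mids Λ) Λ) ∧
    (∀ a, Walk gtl ghd (.wo a) Λ .t → Ends (X.tl a) (a :: mids Λ) Λ) ∧
    (∀ φ, Walk gtl ghd (.ab φ) Λ .t → mids Λ = []) ∧
    (Walk gtl ghd .t Λ .t → mids Λ = []) := by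
  induction Λ with
  | nil => simp [Walk, mids]
  | cons o Λ ih =>
    obtain ⟨i1, i2, i3, i4, i5⟩ := ih
    refine ⟨?_, ?_, ?_, ?_, ?_⟩
    · rintro v ⟨h1, h2⟩
      cases o <;> simp [gtl] at h1
      · subst h1
        exact (i2 _ h2).2.mono (by simp)
      · rename_i f
        subst h1
        have : mids (GA.tf f :: Λ) = [] := i4 _ h2
        rw [this]
        exact Or.inl ⟨f, by simp, rfl⟩
    · rintro a ⟨h1, h2⟩
      cases o <;> simp [gtl] at h1
      subst h1
      exact ⟨⟨mids Λ, rfl⟩, (i3 _ h2).mono (by simp)⟩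
    · rintro a ⟨h1, h2⟩
      cases o <;> simp [gtl] at h1
      · subst h1
        rename_i a
        rcases i1 _ h2 with ⟨f, hf, hw⟩ | ⟨b, hb, ⟨l', hl⟩, hw⟩
        · exact Or.inl ⟨f, by simp [hf], rfl, hw⟩
        · refine Or.inr ⟨b, hb.imp (fun ⟨c, hc⟩ => ⟨c, by simp [hc]⟩) (fun h => by simp [h]),
            ⟨a :: l', ?_⟩, rfl, hw⟩
          rw [List.cons_append, ← hl]
          rfl
      · subst h1
        rename_i a
        have : mids (GA.wt a :: Λ) = [] := i5 h2
        rw [this]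
        exact Or.inr ⟨a, Or.inr (by simp), ⟨[], rfl⟩, rfl, rfl⟩
      · subst h1
        rename_i a b
        have : mids (GA.wg a b :: Λ) = [] := i4 _ h2
        rw [this]
        exact Or.inr ⟨a, Or.inl ⟨b, by simp⟩, ⟨[], rfl⟩, rfl, rfl⟩
    · rintro a ⟨h1, h2⟩
      cases o <;> simp [gtl] at h1
      exact i5 h2
    · rintro ⟨h1, -⟩
      cases o <;> simp [gtl] at h1

theorem mem_mids {a : Fin X.n} {Λ : List X.GA} (h : a ∈ mids Λ) : .mid a ∈ Λ := by
  obtain ⟨o, ho, e⟩ := List.mem_filterMap.1 h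
  cases o <;> simp at e
  exact e ▸ ho

namespace Solution

variable (h : Solution N L)
include h

/-- The entry arc decides whether the trace in the copy starts at the source or with an arc. At the
other end, `e_of_tf` excludes sinks of other commodities and `exit_of_inClass` excludes `.wt`. -/
theorem exists_strand {j : Fin X.K} {i : ι} (hi : InClass (X.bun j) (L i)) :
    ∃ x, Strand X.tl X.hd (X.src j) (X.snk j) x ∧ (x.1 = none ↔ .qs j ∈ L i) ∧
      (∀ a, x.1 = some a ↔ .qv (X.bun j) a ∈ L i) ∧
      (∀ a, x.2.2 = some a ↔ ∃ b, .wg a b ∈ L i) ∧ ∀ a ∈ x.2.1, .mid a ∈ L i := by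
  have key : ∀ v l, Ends v l (L i) → ∃ z w, Walk X.tl X.hd v l w ∧ (z = none → w = X.snk j) ∧
      (∀ a, z = some a → ∃ l', l = l' ++ [a]) ∧ ∀ a, z = some a ↔ ∃ b, .wg a b ∈ L i := by
    rintro v l (⟨f, hf, hw⟩ | ⟨a, ha, hl, hw⟩)
    · have h1 := h.inClass_eq hi (h.e_of_tf hf)
      have h2 : f.1 = j := Fin.castAdd_injective _ _ h1
      refine ⟨none, _, hw, fun _ => by rw [h2], by simp, fun a => ?_⟩
      simp only [reduceCtorEq, false_iff, not_exists]
      intro b hb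
      have := h.exit_eq (κ := .inl f) (κ' := .inr (.inl (a, b))) hf hb
      simp at this
    · have hwg : ∃ b, .wg a b ∈ L i := by
        rcases ha with ha | ha
        · exact ha
        · rcases h.exit_of_inClass hi with ⟨m, hm⟩ | ⟨a', b, hab⟩
          · have := h.exit_eq (κ := .inl ⟨j, m⟩) (κ' := .inr (.inr a)) hm ha
            simp at this
          · have := h.exit_eq (κ := .inr (.inl (a', b))) (κ' := .inr (.inr a)) hab ha
            simp at this
      refine ⟨some a, _, hw, by simp, fun a' e => by rwa [← Option.some.inj e], fun a' => ?_⟩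
      constructor
      · intro e
        rwa [← Option.some.inj e]
      · rintro ⟨b', hb'⟩
        obtain ⟨b, hb⟩ := hwg
        have := h.exit_eq (κ := .inr (.inl (a, b))) (κ' := .inr (.inl (a', b'))) hb hb'
        simp at this
        rw [this.1]
  rcases hi with ⟨j', hj', hq⟩ | ⟨a, ha⟩
  · obtain rfl : j' = j := Fin.castAdd_injective _ _ hj'
    obtain ⟨pre, post, hpp⟩ := List.append_of_mem hq
    have hw := (h.path i).1
    rw [hpp] at hw
    obtain ⟨v, -, -, hw⟩ := walk_append.1 hw
    have hsub : post ⊆ L i := by rw [hpp]; intro x hx; simp [hx]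
    obtain ⟨z, w, h1, h2, h3, h4⟩ := key _ _ (((ends_of_walk post).1 _ hw).mono hsub)
    refine ⟨(none, mids post, z), ⟨_, w, h1, fun _ => rfl, by simp, h2, h3⟩, by simp [hq], fun a => ?_,
      h4, fun a ha => hsub (mem_mids ha)⟩
    simp only [reduceCtorEq, false_iff]
    intro ha
    have := h.entry_inj (κ := .inl j') (κ' := .inr (.inl (_, a))) hq ha
    simp at this
  · obtain ⟨pre, post, hpp⟩ := List.append_of_mem ha
    have hw := (h.path i).1
    rw [hpp] at hw
    obtain ⟨v, -, -, hw⟩ := walk_append.1 hw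
    have hsub : post ⊆ L i := by rw [hpp]; intro x hx; simp [hx]
    obtain ⟨hl, he⟩ := (ends_of_walk post).2.1 _ hw
    obtain ⟨z, w, h1, h2, h3, h4⟩ := key _ _ (he.mono hsub)
    refine ⟨(some a, mids post, z), ⟨_, w, h1, by simp, fun a' e => ?_, h2, h3⟩, ?_, fun a' => ?_,
      h4, fun a ha => hsub (mem_mids ha)⟩
    · rw [← Option.some.inj e]
      exact hl
    · simp only [reduceCtorEq, false_iff]
      intro hq
      have := h.entry_inj (κ := .inl j) (κ' := .inr (.inl (_, a))) hq ha
      simp at this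
    · constructor
      · intro e
        rwa [← Option.some.inj e]
      · intro ha'
        have := h.entry_inj (κ := .inr (.inl (_, a))) (κ' := .inr (.inl (_, a'))) ha ha'
        simp at this
        rw [this]

open Classical in
/-- The walks of a commodity that are obtained from a solution. -/
theorem exists_walks (j : Fin X.K) :
    ∃ W : Multiset (List (Fin X.n)), (∀ l ∈ W, Walk X.tl X.hd (X.src j) l (X.snk j)) ∧
      Multiset.card W = N * X.d j ∧ ∀ S : Finset (Fin X.n),
        W.countP (fun l => ∃ a ∈ l, a ∈ S) + N * 2 * S.card ≤
          cnt fun i => InClass (X.bun j) (L i) ∧ ∃ a ∈ S, .mid a ∈ L i := by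
  have hex : ∀ i, ∃ x, InClass (X.bun j) (L i) → Strand X.tl X.hd (X.src j) (X.snk j) x ∧
      (x.1 = none ↔ .qs j ∈ L i) ∧ (∀ a, x.1 = some a ↔ .qv (X.bun j) a ∈ L i) ∧
      (∀ a, x.2.2 = some a ↔ ∃ b, .wg a b ∈ L i) ∧ ∀ a ∈ x.2.1, .mid a ∈ L i := by
    intro i
    by_cases hi : InClass (X.bun j) (L i)
    · obtain ⟨x, hx⟩ := h.exists_strand hi
      exact ⟨x, fun _ => hx⟩
    -- A dummy for paths outside the class; they are filtered out of the multiset below.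
    · exact ⟨(none, [], none), fun h => absurd h hi⟩
  choose x hx using hex
  set m : Multiset (Option (Fin X.n) × List (Fin X.n) × Option (Fin X.n)) :=
    (Finset.univ.filter fun i => InClass (X.bun j) (L i)).val.map x with hm
  have hcount : ∀ (p : Option (Fin X.n) × List (Fin X.n) × Option (Fin X.n) → Prop)
      [DecidablePred p], m.countP p = cnt fun i => InClass (X.bun j) (L i) ∧ p (x i) := by
    intro p _
    rw [hm, Multiset.countP_map, cnt_eq_card, ← Finset.filter_filter]
    rfl
  have hstart : ∀ a [DecidablePred fun x : Option (Fin X.n) × List (Fin X.n) × Option (Fin X.n) =>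
      x.1 = some a], m.countP (fun x => x.1 = some a) = N * 2 := by
    intro a _
    rw [hcount, ← h.cnt_qv (X.bun j) a]
    exact cnt_congr fun i => ⟨fun hi => ((hx i hi.1).2.2.1 a).1 hi.2,
      fun hi => ⟨Or.inr ⟨a, hi⟩, ((hx i (Or.inr ⟨a, hi⟩)).2.2.1 a).2 hi⟩⟩
  have hfinish : ∀ a [DecidablePred fun x : Option (Fin X.n) × List (Fin X.n) × Option (Fin X.n) =>
      x.2.2 = some a], m.countP (fun x => x.2.2 = some a) = N * 2 := by
    intro a _
    rw [hcount]
    have : cnt (fun i => InClass (X.bun j) (L i) ∧ (x i).2.2 = some a) =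
        cnt (fun i => ∃ b, .wg a b ∈ L i ∧ InClass (X.bun j) (L i)) :=
      cnt_congr fun i => ⟨fun hi => by
        obtain ⟨b, hb⟩ := ((hx i hi.1).2.2.2.1 a).1 hi.2
        exact ⟨b, hb, hi.1⟩, fun ⟨b, hb, hi⟩ => ⟨hi, ((hx i hi).2.2.2.1 a).2 ⟨b, hb⟩⟩⟩
    rw [this, cnt_exists_eq (fun b i => .wg a b ∈ L i ∧ InClass (X.bun j) (L i))
      (fun i b b' h1 h2 => by
        have := h.exit_eq (κ := .inr (.inl (a, b))) (κ' := .inr (.inl (a, b'))) h1.1 h2.1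
        simpa using this)]
    simp only [h.cnt_wg_inClass, Finset.sum_const, Finset.card_univ, Fintype.card_bool,
      smul_eq_mul]
    ring
  obtain ⟨W, hW1, hW2, hW3⟩ := exists_uncrossed (tl := X.tl) (hd := X.hd) (s := X.src j)
    (t := X.snk j) m (fun y hy => by
      obtain ⟨i, hi, rfl⟩ := Multiset.mem_map.1 hy
      exact (hx i (by simpa using hi)).1) (fun a => by rw [hstart, hfinish])
  refine ⟨W, hW1, ?_, fun S => ?_⟩
  · rw [hW2, hcount, ← h.cnt_qs j]
    exact cnt_congr fun i => ⟨fun hi => (hx i hi.1).2.1.1 hi.2,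
      fun hi => ⟨Or.inl ⟨j, rfl, hi⟩, (hx i (Or.inl ⟨j, rfl, hi⟩)).2.1.2 hi⟩⟩
  · have h1 := hW3 S
    simp only [hstart, Finset.sum_const, smul_eq_mul] at h1
    rw [mul_comm _ S.card]
    refine le_trans (le_of_eq ?_) (h1.trans ?_)
    · congr!
    rw [hcount]
    exact cnt_mono fun i hi => ⟨hi.1, by
      obtain ⟨a, ha, hS⟩ := hi.2
      exact ⟨a, hS, (hx i hi.1).2.2.2.2 a ha⟩⟩

/-- The unit paths of a commodity that are obtained from a solution. -/
theorem exists_paths (j : Fin X.K) :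
    ∃ (κ : Type) (_ : Fintype κ) (P : κ → List (Fin X.n)),
      (∀ x, SimplePath X.tl X.hd (X.src j) (P x) (X.snk j)) ∧ Fintype.card κ = N * X.d j ∧
      ∀ S : Finset (Fin X.n), cnt (fun x => ∃ a ∈ P x, a ∈ S) + N * 2 * S.card ≤
          cnt fun i => InClass (X.bun j) (L i) ∧ ∃ a ∈ S, .mid a ∈ L i := by
  classical
  obtain ⟨W, h1, h2, h3⟩ := h.exists_walks j
  choose P hP using fun x : W => (h1 x.1 (Multiset.coe_mem)).exists_simplePath
  refine ⟨W, inferInstance, P, fun x => (hP x).1, by rw [Multiset.card_coe, h2], fun S => ?_⟩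
  refine le_trans (Nat.add_le_add_right ?_ _) (h3 S)
  calc cnt (fun x => ∃ a ∈ P x, a ∈ S) ≤ cnt (fun x : W => ∃ a ∈ x.1, a ∈ S) :=
        cnt_mono fun x ⟨a, ha, hS⟩ => ⟨a, (hP x).2 ha, hS⟩
    _ = (((Finset.univ : Finset W).val.map fun x : W => x.1)).countP (fun l => ∃ a ∈ l, a ∈ S) := by
        rw [Multiset.countP_map, cnt_eq_card]
        rfl
    _ = _ := by
        rw [Multiset.map_univ_coe]

/-- From `.vi a` the only way on is `.mid a`, so the filler of the arcs in `S` hits `S`; the same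
holds for `.qv` in the next lemma. -/
theorem cnt_sv_and_le (S : Finset (Fin X.n)) :
    N * X.r₀ * S.card ≤ cnt fun i => (∃ a, .sv a ∈ L i) ∧ ∃ a ∈ S, .mid a ∈ L i := by
  calc N * X.r₀ * S.card = cnt (fun i => ∃ a ∈ S, .sv a ∈ L i) := by
        rw [cnt_mem_exists_eq S (fun a i => .sv a ∈ L i) (fun i a _ a' _ h1 h2 => by
          simpa using (h.path i).tail_inj h1 h2 rfl)]
        simp only [h.cnt_sv, Finset.sum_const, smul_eq_mul]
        ring
    _ ≤ _ := cnt_mono fun i ⟨a, ha, hi⟩ => ⟨⟨a, hi⟩, a, ha, by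
        obtain ⟨o, ho, e⟩ := (h.path i).exists_succ hi (by simp [ghd])
        cases o <;> simp [gtl, ghd] at e
        exact e ▸ ho⟩

theorem cnt_inClass_and_le (l : Fin X.H) (S : Finset (Fin X.n)) :
    N * 2 * S.card ≤ cnt fun i => InClass l (L i) ∧ ∃ a ∈ S, .mid a ∈ L i := by
  calc N * 2 * S.card = cnt (fun i => ∃ a ∈ S, .qv l a ∈ L i) := by
        rw [cnt_mem_exists_eq S (fun a i => .qv l a ∈ L i) (fun i a _ a' _ h1 h2 => by
          simpa using (h.path i).tail_inj h1 h2 rfl)]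
        simp only [h.cnt_qv, Finset.sum_const, smul_eq_mul]
        ring
    _ ≤ _ := cnt_mono fun i ⟨a, ha, hi⟩ => ⟨Or.inr ⟨a, hi⟩, a, ha, by
        obtain ⟨o, ho, e⟩ := (h.path i).exists_succ hi (by simp [ghd])
        cases o <;> simp [gtl, ghd] at e
        exact e ▸ ho⟩

/-- The capacities of the first bundle and of the direct arcs enter `card_le`, and `(Q + k + 1) + Q
+ (k - 2) * (Q + 1) + 1 = k * (Q + 2)`. -/
theorem card_le_total : Fintype.card ι + N ≤ N * X.target + N * (X.k * (X.Q + 2)) := by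
  have h1 := h.card_le
  have h2 : cnt (fun i => .e X.zero ∈ L i) ≤ N * (X.Q + X.k + 1) := h.cap (.e X.zero)
  have h3 : cnt (fun i => UsesPsi (L i)) ≤ (X.k - 2) * (N * (X.Q + 1)) := by
    refine (cnt_exists_le fun j i => .psi j ∈ L i).trans ?_
    refine (Finset.sum_le_sum fun j _ => h.cap (.psi j)).trans ?_
    simp [gcap]
  obtain ⟨c, hc⟩ := Nat.exists_eq_add_of_le h.two_le
  have h4 : X.k - 2 = c := by omega
  rw [h4] at h3
  have h5 : N * (X.Q + X.k + 1) + N * X.Q + c * (N * (X.Q + 1)) + N = N * (X.k * (X.Q + 2)) := by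
    rw [hc]; ring
  omega

/-- The number of paths that use a raised arc from a given set. -/
theorem hits_le (P : Fin X.K → ℕ) (S : Finset (Fin X.n))
    (hP : ∀ j, P j + N * 2 * S.card ≤
      cnt fun i => InClass (X.bun j) (L i) ∧ ∃ a ∈ S, .mid a ∈ L i) :
    ∑ j, P j + N * (2 * X.H + X.r₀) * S.card ≤ cnt fun i => ∃ a ∈ S, .mid a ∈ L i := by
  have h1 := h.cnt_sv_and_le S
  have h2 : ∑ l, cnt (fun i => InClass l (L i) ∧ ∃ a ∈ S, .mid a ∈ L i) =
      cnt (fun i => ∃ l, InClass l (L i) ∧ ∃ a ∈ S, .mid a ∈ L i) :=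
    (cnt_exists_eq (fun l i => InClass l (L i) ∧ ∃ a ∈ S, .mid a ∈ L i)
      (fun i l l' h1 h2 => h.inClass_eq h2.1 (h.e_of_inClass h1.1))).symm
  have h3 : cnt (fun i => (∃ l, InClass l (L i) ∧ ∃ a ∈ S, .mid a ∈ L i) ∨
      ((∃ a, .sv a ∈ L i) ∧ ∃ a ∈ S, .mid a ∈ L i)) = _ := cnt_or_eq fun i ⟨l, hl, _⟩ ⟨⟨a, ha⟩, _⟩ =>
    h.not_e_of_sv ha l (h.e_of_inClass hl)
  have h4 : cnt (fun i => (∃ l, InClass l (L i) ∧ ∃ a ∈ S, .mid a ∈ L i) ∨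
      ((∃ a, .sv a ∈ L i) ∧ ∃ a ∈ S, .mid a ∈ L i)) ≤ cnt fun i => ∃ a ∈ S, .mid a ∈ L i :=
    cnt_mono fun i hi => by
      rcases hi with ⟨l, _, hi⟩ | ⟨_, hi⟩ <;> exact hi
  have h5 : ∑ j, P j + X.H * (N * 2 * S.card) ≤
      ∑ l, cnt (fun i => InClass l (L i) ∧ ∃ a ∈ S, .mid a ∈ L i) := by
    -- The first `K` bundles carry the commodities and their fed units, while the three spare
    -- bundles contribute fed units only.
    have e1 : ∑ l : Fin (X.K + 3), cnt (fun i => InClass l (L i) ∧ ∃ a ∈ S, .mid a ∈ L i) = _ :=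
      Fin.sum_univ_add _
    have e2 : ∑ j, (P j + N * 2 * S.card) ≤ ∑ j : Fin X.K, cnt (fun i =>
      InClass (Fin.castAdd 3 j : Fin (X.K + 3)) (L i) ∧ ∃ a ∈ S, .mid a ∈ L i) :=
      Finset.sum_le_sum fun j _ => hP j
    have e3 : ∑ _j : Fin 3, N * 2 * S.card ≤ ∑ j : Fin 3, cnt (fun i =>
      InClass (Fin.natAdd X.K j : Fin (X.K + 3)) (L i) ∧ ∃ a ∈ S, .mid a ∈ L i) :=
      Finset.sum_le_sum fun j _ => h.cnt_inClass_and_le _ S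
    rw [Finset.sum_add_distrib] at e2
    simp only [Finset.sum_const, Finset.card_univ, Fintype.card_fin, smul_eq_mul] at e2 e3
    have e4 : X.H * (N * 2 * S.card) = X.K * (N * 2 * S.card) + 3 * (N * 2 * S.card) := by
      simp only [H]; ring
    rw [e4]
    refine le_trans ?_ e1.ge
    omega
  have h6 : N * (2 * X.H + X.r₀) * S.card = X.H * (N * 2 * S.card) + N * X.r₀ * S.card := by ring
  omega

/-- A robust solution of the single-commodity instance yields one of the multi-commodity
instance. -/
theorem multiYes (hM : 1 ≤ X.M) (hu : ∀ a, X.u a ≤ X.M) : X.MultiYes N := by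
  classical
  choose κ inst P hP hcard hhits using h.exists_paths
  have hc : ∀ S : Finset (Fin X.n),
      cnt (fun x : Σ j, κ j => ∃ a ∈ P x.1 x.2, a ∈ S) = ∑ j, cnt (fun x => ∃ a ∈ P j x, a ∈ S) := by
    intro S
    simp only [cnt_eq_card, Finset.card_filter]
    rw [Fintype.sum_sigma]
  have hbound : ∀ S : Finset (Fin X.n), cnt (fun x : Σ j, κ j => ∃ a ∈ P x.1 x.2, a ∈ S) +
      N * (2 * X.H + X.r₀) * S.card ≤ cnt fun i => ∃ a ∈ S, .mid a ∈ L i := fun S => by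
    rw [hc]
    exact h.hits_le _ S fun j => hhits j S
  have hcap : ∀ a, cnt (fun x : Σ j, κ j => a ∈ P x.1 x.2) ≤ N * X.u a := by
    intro a
    -- For a single arc the added units `2 * H + r₀` cancel against the raise of its capacity.
    have h1 := hbound {a}
    simp only [Finset.mem_singleton, exists_eq_right, exists_eq_left, Finset.card_singleton] at h1
    have h2 : cnt (fun i => .mid a ∈ L i) ≤ N * (X.u a + (2 * X.H + X.r₀)) := h.cap (.mid a)
    rw [mul_add] at h2
    omega
  refine ⟨Σ j, κ j, inferInstance, fun x => x.1, fun x => P x.1 x.2, fun x => hP _ _, fun j => ?_,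
    hcap, fun S hS => ?_⟩
  · rw [cnt_eq_card, Finset.card_filter, Fintype.sum_sigma]
    have e : ∀ x, ∑ _y : κ x, (if x = j then 1 else 0) = if x = j then N * X.d j else 0 := by
      intro x
      split_ifs with hx
      · subst hx; simp [hcard]
      · simp
    exact (Finset.sum_congr rfl fun x _ => e x).trans (by simp)
  · change cnt (fun x : Σ j, κ j => ∃ a ∈ P x.1 x.2, a ∈ S) + N ≤ _
    rcases hS.lt_or_eq with hS | hS
    -- Fewer than `k` failing arcs lose at most `(k - 1) * M` by the capacities, and `1 ≤ M`.
    · have h1 : cnt (fun x : Σ j, κ j => ∃ a ∈ P x.1 x.2, a ∈ S) ≤ S.card * (N * X.M) := by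
        refine (cnt_mono (q := fun x : Σ j, κ j => ∃ a ∈ S, a ∈ P x.1 x.2)
          fun x ⟨a, h1, h2⟩ => ⟨a, h2, h1⟩).trans ((cnt_mem_exists_le S _).trans ?_)
        rw [← smul_eq_mul, ← Finset.sum_const]
        exact Finset.sum_le_sum fun a _ => (hcap a).trans (Nat.mul_le_mul_left _ (hu a))
      have h2 : (S.card + 1) * (N * X.M) ≤ X.k * (N * X.M) := Nat.mul_le_mul_right _ hS
      have h3 : N * 1 ≤ N * X.M := Nat.mul_le_mul_left _ hM
      have h4 : N * (X.k * X.M) = X.k * (N * X.M) := by ring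
      rw [add_mul] at h2
      omega
    -- For exactly `k` arcs the raised copies fail: at most `k * (Q + 2) - 1` units may be lost
    -- there, of which `k * (2 * H + r₀)` are added ones.
    · have h1 := hbound S
      have h2 := h.rob (S.image GA.mid) (Finset.card_image_le.trans hS.le)
      have h3 := h.card_le_total
      have h4 := cnt_split (fun _ : ι => True) (fun i => ∃ a ∈ S, .mid a ∈ L i)
      rw [cnt_true] at h4
      have h5 : cnt (fun i => ∀ o ∈ L i, o ∉ S.image GA.mid) ≤
          cnt (fun i => True ∧ ¬ ∃ a ∈ S, .mid a ∈ L i) := cnt_mono fun i hi =>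
        ⟨trivial, fun ⟨a, ha, hL⟩ => hi _ hL (Finset.mem_image_of_mem _ ha)⟩
      have h6 : cnt (fun i => True ∧ ∃ a ∈ S, .mid a ∈ L i) = cnt (fun i => ∃ a ∈ S, .mid a ∈ L i) :=
        cnt_congr fun i => by simp
      have h7 : N * (X.k * (X.Q + 2)) = N * (X.k * X.M) + N * (2 * X.H + X.r₀) * X.k := by
        have : X.Q + 2 = X.M + (2 * X.H + X.r₀) := by simp only [Q, r₀]; omega
        rw [this]; ring
      rw [hS] at h1
      omega

end Solution

theorem SingleYes.multiYes (hk : 2 ≤ X.k) (hM : 1 ≤ X.M) (hu : ∀ a, X.u a ≤ X.M)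
    (h : X.SingleYes N) : X.MultiYes N := by
  obtain ⟨ι, _, L, h1, h2, h3⟩ := h
  exact Solution.multiYes ⟨hk, h1, h2, h3⟩ hM hu

end Data
end RobustFlow

/-! ### The intended single-commodity solution -/

namespace RobustFlow

theorem cnt_equiv {ι κ : Type} [Fintype ι] [Fintype κ] (E : ι ≃ κ) (p : κ → Prop) :
    cnt (fun i => p (E i)) = cnt p := by
  classical
  exact Fintype.card_congr (E.subtypeEquiv fun _ => Iff.rfl)

open Classical in
theorem cnt_sigma_fin {κ : Type} [Fintype κ] (w : κ → ℕ) (p : κ → Prop) :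
    cnt (fun x : Σ y, Fin (w y) => p x.1) = ∑ y, if p y then w y else 0 := by
  rw [cnt_eq_card, Finset.card_filter, Fintype.sum_sigma]
  refine Finset.sum_congr rfl fun y _ => ?_
  by_cases h : p y <;> simp [h]

/-- The units of a flow that satisfies the demands can be distributed evenly over the units of
demand. -/
theorem exists_distribution {ι κ : Type} [Fintype ι] [Fintype κ] {d : κ → ℕ} {N : ℕ} (c : ι → κ)
    (h : ∀ j, cnt (fun i => c i = j) = N * d j) :
    ∃ g : ι → Σ j, Fin (d j), (∀ i, (g i).1 = c i) ∧ ∀ f, cnt (fun i => g i = f) = N := by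
  classical
  have E : ∀ j, Nonempty ({i // c i = j} ≃ Fin (d j) × Fin N) := fun j =>
    Fintype.card_eq.1 (by
      have := h j
      rw [cnt] at this
      rw [Fintype.card_prod, Fintype.card_fin, Fintype.card_fin, mul_comm, ← this])
  replace E := fun j => (E j).some
  let E' : ι ≃ (Σ j, Fin (d j)) × Fin N := (Equiv.sigmaFiberEquiv c).symm.trans
    ((Equiv.sigmaCongrRight E).trans (Equiv.sigmaProdDistrib _ _).symm)
  refine ⟨fun i => (E' i).1, fun i => rfl, fun f => ?_⟩
  rw [cnt_equiv E' fun y => y.1 = f, cnt_eq_card, Finset.card_filter, Fintype.sum_prod_type]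
  have e : ∀ x, ∑ _y : Fin N, (if x = f then 1 else 0) = if x = f then N else 0 := by
    intro x
    split_ifs <;> simp
  exact (Finset.sum_congr rfl fun x _ => e x).trans (by simp)

namespace Data

variable {X : Data}

/-- The walk through all bundles. -/
def spine (X : Data) : List X.GA := (List.finRange X.H).flatMap fun l => [.e l, .ch l]

/-- The copy of a path of the multi-commodity network. -/
def lift (P : List (Fin X.n)) : List X.GA := P.flatMap fun a => [.inn a, .mid a, .out a]

theorem walk_spine : Walk gtl ghd (.p 0) X.spine (.p (Fin.last X.H)) := by
  have key : ∀ m (hm : m ≤ X.H), Walk gtl ghd (.p (0 : Fin (X.H + 1)))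
      ((List.finRange m).flatMap fun l => [GA.e (X := X) (l.castLE hm), .ch (l.castLE hm)])
      (.p ⟨m, by omega⟩) := by
    intro m
    induction m with
    | zero => intro _; simp [Walk]
    | succ m ih =>
      intro hm
      rw [List.finRange_succ_last, List.flatMap_append, walk_append]
      refine ⟨.p ⟨m, by omega⟩, ?_, ?_⟩
      · rw [List.flatMap_map]
        exact ih (by omega)
      · simp only [List.flatMap_cons, List.flatMap_nil, List.append_nil, Walk, gtl, ghd]
        exact ⟨rfl, trivial, rfl⟩
  exact key X.H le_rfl

theorem walk_lift {P : List (Fin X.n)} {v w : Fin X.nV} (h : Walk X.tl X.hd v P w) :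
    Walk (V := X.GV) gtl ghd (.base v) (lift P) (.base w) := by
  induction P generalizing v with
  | nil => exact congrArg _ h
  | cons a P ih =>
    refine ⟨congrArg _ h.1, rfl, rfl, ?_⟩
    exact ih h.2

theorem simplePath_of {L : List X.GA} (h : Walk gtl ghd (.s : X.GV) L .t)
    (hn : (L.map ghd).Nodup) : SimplePath gtl ghd (.s : X.GV) L .t :=
  ⟨h, List.nodup_cons.2 ⟨fun hm => by
    obtain ⟨o, -, e⟩ := List.mem_map.1 hm
    cases o <;> simp [ghd] at e, hn⟩⟩

theorem nodup_spine : (X.spine.map ghd).Nodup := by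
  rw [spine, List.map_flatMap, List.nodup_flatMap]
  refine ⟨fun l _ => by simp [ghd], ?_⟩
  refine (List.nodup_finRange _).imp fun {a b} hab => ?_
  simp [Function.onFun, ghd, Ne.symm hab]

theorem nodup_lift {P : List (Fin X.n)} (h : (P.map X.hd).Nodup) :
    ((lift P).map (ghd (X := X))).Nodup := by
  rw [lift, List.map_flatMap, List.nodup_flatMap]
  refine ⟨fun l _ => by simp [ghd], ?_⟩
  refine (List.pairwise_map.1 h).imp fun {a b} hab => ?_
  have : a ≠ b := fun e => hab (e ▸ rfl)
  simp [Function.onFun, ghd,  Ne.symm hab, Ne.symm this]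

/-- Kinds of unit paths that make up a solution of the single-commodity instance. -/
abbrev Kind (X : Data) (κ : Type) : Type :=
  (Fin X.H × Σ i : Fin X.K, Fin (X.d i)) ⊕ (Fin X.H × Fin X.n × Bool) ⊕ Fin X.H ⊕ κ ⊕
    Fin (X.k + 1) ⊕ Fin X.n ⊕ X.Abs ⊕ Fin (X.k - 2)

section Forward

variable {κ : Type} (P : κ → List (Fin X.n)) (g : κ → Σ i : Fin X.K, Fin (X.d i))
  (N : ℕ)

/-- The path of each kind. -/
def kindPath : X.Kind κ → List X.GA
  | .inl (l, f) => [.sp l, .e l, .qf l f, .st (.inl f)]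
  | .inr (.inl (l, a, b)) =>
    [.sp l, .e l, .qv l a, .mid a, .wg a b, .st (.inr (.inl (a, b)))]
  | .inr (.inr (.inl l)) => [.sp l, .e l, .qt l]
  | .inr (.inr (.inr (.inl x))) =>
    .sp (X.bun (g x).1) :: .e (X.bun (g x).1) :: .qs (g x).1 ::
      (lift (P x) ++ [.tf (g x), .st (.inl (g x))])
  | .inr (.inr (.inr (.inr (.inl j)))) => .zin :: (X.spine ++ [.po j, .st (.inr (.inr j))])
  | .inr (.inr (.inr (.inr (.inr (.inl a))))) => [.sv a, .mid a, .wt a]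
  | .inr (.inr (.inr (.inr (.inr (.inr (.inl φ)))))) => [.ss φ, .st φ]
  | .inr (.inr (.inr (.inr (.inr (.inr (.inr j)))))) => [.psi j]

/-- The number of units of each kind. -/
def kindWeight : X.Kind κ → ℕ
  | .inl (l, f) => N * gcap (.qf l f)
  | .inr (.inl _) => N
  | .inr (.inr (.inl _)) => N * X.w
  | .inr (.inr (.inr (.inl _))) => 1
  | .inr (.inr (.inr (.inr (.inl _)))) => N
  | .inr (.inr (.inr (.inr (.inr (.inl _))))) => N * X.r₀
  | .inr (.inr (.inr (.inr (.inr (.inr (.inl φ)))))) => N * ssCap φ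
  | .inr (.inr (.inr (.inr (.inr (.inr (.inr _)))))) => N * (X.Q + 1)

theorem simplePath_kindPath
    (hP : ∀ x, SimplePath X.tl X.hd (X.src (g x).1) (P x) (X.snk (g x).1)) (y : X.Kind κ) :
    SimplePath gtl ghd (.s : X.GV) (kindPath P g y) .t := by
  rcases y with ⟨l, f⟩ | ⟨l, a, b⟩ | l | x | j | a | φ | j
  · apply simplePath_of <;> simp [kindPath, Walk, gtl, ghd]
  · apply simplePath_of <;> simp [kindPath, Walk, gtl, ghd]
  · apply simplePath_of <;> simp [kindPath, Walk, gtl, ghd]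
  · apply simplePath_of
    · refine ⟨rfl, rfl, rfl, walk_append.2 ⟨_, walk_lift (hP x).1, ?_⟩⟩
      simp [Walk, gtl, ghd]
    · have h1 : ∀ o ∈ lift (P x), ∃ a ∈ P x, o = .inn a ∨ o = .mid a ∨ o = .out a := by
        simp [lift]
      have h2 := fun a (ha : a ∈ P x) => (hP x).head_ne ha
      simp only [kindPath, ghd, List.nodup_append, nodup_lift (List.nodup_cons.1 (hP x).2).2,
        List.map_cons, List.map_append, List.nodup_cons, List.mem_cons, List.mem_append,
        List.mem_map]
      simp
      refine ⟨fun o ho => ?_, fun o ho => ?_, fun o ho => ?_, fun o ho => ?_⟩ <;>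
        obtain ⟨a, ha, rfl | rfl | rfl⟩ := h1 o ho <;> simp [h2 a ha]
  · apply simplePath_of
    · refine ⟨rfl, walk_append.2 ⟨_, walk_spine, ?_⟩⟩
      simp [Walk, gtl, ghd]
    · have h1 : ∀ o ∈ X.spine, ∃ l, o = .e l ∨ o = .ch l := by
        simp [spine]
      simp [kindPath, ghd, List.nodup_append, nodup_spine]
      refine ⟨fun o ho => ?_, fun o ho => ?_⟩ <;>
        obtain ⟨l, rfl | rfl⟩ := h1 o ho <;> simp [Fin.succ_ne_zero]
  · apply simplePath_of <;> simp [kindPath, Walk, gtl, ghd]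
  · apply simplePath_of <;> simp [kindPath, Walk, gtl, ghd]
  · apply simplePath_of <;> simp [kindPath, Walk, gtl, ghd]

theorem mem_lift {Q : List (Fin X.n)} {o : X.GA} :
    o ∈ lift Q ↔ ∃ a ∈ Q, o = .inn a ∨ o = .mid a ∨ o = .out a := by
  simp [lift]

theorem mem_spine {o : X.GA} : o ∈ X.spine ↔ ∃ l, o = .e l ∨ o = .ch l := by
  simp [spine]

variable [Fintype κ]

/-- Splits a count into the eight kinds of paths, so that the load of any given arc can be
simplified kind by kind. -/
theorem sum_kind (f : X.Kind κ → ℕ) : ∑ y, f y =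
    (∑ l, ∑ φ, f (.inl (l, φ))) + ((∑ l, ∑ a, ∑ b, f (.inr (.inl (l, a, b)))) +
    ((∑ l, f (.inr (.inr (.inl l)))) + ((∑ x, f (.inr (.inr (.inr (.inl x))))) +
    ((∑ j, f (.inr (.inr (.inr (.inr (.inl j)))))) +
    ((∑ a, f (.inr (.inr (.inr (.inr (.inr (.inl a))))))) +
    ((∑ φ, f (.inr (.inr (.inr (.inr (.inr (.inr (.inl φ)))))))) +
    ∑ j, f (.inr (.inr (.inr (.inr (.inr (.inr (.inr j))))))))))))) := by
  simp only [Fintype.sum_sum_type (α₁ := Fin X.H × Σ i : Fin X.K, Fin (X.d i)),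
    Fintype.sum_sum_type (α₁ := Fin X.H × Fin X.n × Bool),
    Fintype.sum_sum_type (α₁ := Fin X.H),
    Fintype.sum_sum_type (α₁ := κ),
    Fintype.sum_sum_type (α₁ := Fin (X.k + 1)),
    Fintype.sum_sum_type (α₁ := Fin X.n),
    Fintype.sum_sum_type (α₁ := X.Abs),
    Fintype.sum_prod_type]

variable {P g N}

open Classical in
theorem cnt_kind (p : List X.GA → Prop) :
    cnt (fun x : Σ y : X.Kind κ, Fin (kindWeight N y) => p (kindPath P g x.1)) =
      ∑ y : X.Kind κ, if p (kindPath P g y) then kindWeight N y else 0 :=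
  cnt_sigma_fin _ fun y => p (kindPath P g y)

open Classical in
theorem cnt_of_distribution (hg : ∀ f, cnt (fun x => g x = f) = N)
    (p : (Σ i : Fin X.K, Fin (X.d i)) → Prop) :
    cnt (fun x => p (g x)) = ∑ f, if p f then N else 0 := by
  rw [cnt_eq_card, Finset.card_eq_sum_card_fiberwise (f := g) (t := Finset.univ)
    (fun _ _ => by simp)]
  refine Finset.sum_congr rfl fun f _ => ?_
  rw [Finset.filter_filter]
  split_ifs with h
  · rw [← hg f, cnt_eq_card]
    congr 1
    ext x
    simp only [Finset.mem_filter, Finset.mem_univ, true_and, and_iff_right_iff_imp]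
    rintro rfl
    exact h
  · rw [Finset.card_eq_zero, Finset.filter_eq_empty_iff]
    rintro x - ⟨h1, rfl⟩
    exact h h1

theorem cnt_eq_of_distribution (hg : ∀ f, cnt (fun x => g x = f) = N)
    (f : Σ i : Fin X.K, Fin (X.d i)) : cnt (fun x => f = g x) = N :=
  (cnt_congr fun _ => eq_comm).trans (hg f)

theorem card_demands : Fintype.card (Σ i : Fin X.K, Fin (X.d i)) = X.D := by
  simp [D]

/-- An additive form of "one unit unless the bundle is the commodity's own", which avoids
subtraction in the sums below. -/
theorem gcap_qf_add (l : Fin X.H) (f : Σ i : Fin X.K, Fin (X.d i)) :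
    N * gcap (.qf l f) + (if l = X.bun f.1 then N else 0) = N := by
  simp only [gcap]
  split_ifs <;> simp

theorem sum_qf_fst (l : Fin X.H) : ∑ f, N * gcap (X := X) (.qf l f) +
    ∑ f : (Σ i : Fin X.K, Fin (X.d i)), (if l = X.bun f.1 then N else 0) = N * X.D := by
  rw [← Finset.sum_add_distrib, Finset.sum_congr rfl fun f _ => gcap_qf_add l f, Finset.sum_const,
    Finset.card_univ, card_demands, smul_eq_mul, mul_comm]

theorem sum_qf_snd (f : Σ i : Fin X.K, Fin (X.d i)) :
    ∑ l, N * gcap (X := X) (.qf l f) + N = N * X.H := by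
  have : ∑ l, (N * gcap (.qf l f) + (if l = X.bun f.1 then N else 0)) = N * X.H := by
    rw [Finset.sum_congr rfl fun l _ => gcap_qf_add l f, Finset.sum_const,
      Finset.card_univ, Fintype.card_fin, smul_eq_mul, mul_comm]
  rw [← this, Finset.sum_add_distrib]
  simp

theorem B_add_H : X.B + X.H = X.Q + 1 := by
  simp only [B, Q]; omega

theorem Q_eq : X.Q = X.D + 2 * X.n + X.w := by
  simp only [w, Q]; omega

/-- At an absorbing arc the supply is `B + (H - 1) + 1` for a unit of demand, `B + H` for an arc and
`Q + 1` at the end of the chain, which is `Q + 1` each time. -/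
theorem cap_kind (hg : ∀ f, cnt (fun x => g x = f) = N)
    (hu : ∀ a, cnt (fun x => a ∈ P x) ≤ N * X.u a) (o : X.GA) :
    cnt (fun x : Σ y : X.Kind κ, Fin (kindWeight N y) => o ∈ kindPath P g x.1) ≤ N * gcap o := by
  classical
  rw [cnt_kind fun L => o ∈ L, sum_kind]
  cases o <;> simp [kindPath, mem_lift, mem_spine, kindWeight]
  case sp l =>
    have h := sum_qf_fst (X := X) (N := N) l
    rw [← cnt_eq_card, cnt_of_distribution hg fun f => l = X.bun f.1]
    simp only [gcap, Q_eq] at h ⊢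
    linarith
  case zin => simp only [gcap]; linarith
  case e l =>
    have h := sum_qf_fst (X := X) (N := N) l
    rw [← cnt_eq_card, cnt_of_distribution hg fun f => l = X.bun f.1]
    simp only [gcap, Q_eq] at h ⊢
    linarith
  case ch l => simp only [gcap]; linarith
  case qt => rfl
  case qs i =>
    rw [← cnt_eq_card, cnt_of_distribution hg fun f => i = f.1, Fintype.sum_sigma]
    have e : ∀ x, ∑ _y : Fin (X.d x), @ite ℕ (i = x) (Classical.propDecidable _) N 0 = if i = x then N * X.d i else 0 := by
      intro x
      split_ifs with h
      · subst h; simp [mul_comm]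
      · simp
    refine ((Finset.sum_congr rfl fun x _ => e x).trans ?_).le
    simp [gcap]
  case qf l f =>
    simp [ite_and]
  case qv l a =>
    simp [ite_and, gcap, mul_comm]
  case inn a => rw [← cnt_eq_card]; exact hu a
  case mid a =>
    have := hu a
    rw [← cnt_eq_card]
    simp only [gcap]
    linarith
  case out a => rw [← cnt_eq_card]; exact hu a
  case sv => rfl
  case wt => rfl
  case wg a b =>
    cases b <;> simp [gcap, mul_comm]
  case tf f =>
    rw [← cnt_eq_card, cnt_eq_of_distribution hg]
    simp [gcap]
  case po j => simp [gcap]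
  case ss φ => rfl
  case st φ =>
    have hB : X.Q + 1 = X.B + X.H := B_add_H.symm
    rcases φ with f | ⟨a, b⟩ | j
    · have h := sum_qf_snd (X := X) (N := N) f
      simp only [Sum.inl.injEq, reduceCtorEq, if_false]
      rw [← cnt_eq_card, cnt_eq_of_distribution hg]
      simp only [gcap, ssCap, hB, mul_ite, mul_zero, mul_one] at h ⊢
      simp
      linarith
    · simp only [gcap, ssCap, hB]
      cases b <;> simp <;> linarith
    · simp only [gcap, ssCap]
      simp
      linarith
  case psi => rfl

theorem cnt_kind_qf (l : Fin X.H) (f : Σ i : Fin X.K, Fin (X.d i)) :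
    cnt (fun x : Σ y : X.Kind κ, Fin (kindWeight N y) => .qf l f ∈ kindPath P g x.1) =
      N * gcap (.qf l f) := by
  classical
  rw [cnt_kind fun L => .qf l f ∈ L, sum_kind]
  simp [kindPath, mem_lift, mem_spine, kindWeight, ite_and]

theorem cnt_kind_qv (l : Fin X.H) (a : Fin X.n) :
    cnt (fun x : Σ y : X.Kind κ, Fin (kindWeight N y) => .qv l a ∈ kindPath P g x.1) =
      N * 2 := by
  classical
  rw [cnt_kind fun L => .qv l a ∈ L, sum_kind]
  simp [kindPath, mem_lift, mem_spine, kindWeight, ite_and, mul_comm]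

theorem cnt_kind_sv (a : Fin X.n) :
    cnt (fun x : Σ y : X.Kind κ, Fin (kindWeight N y) => .sv a ∈ kindPath P g x.1) =
      N * X.r₀ := by
  classical
  rw [cnt_kind fun L => .sv a ∈ L, sum_kind]
  simp [kindPath, mem_lift, mem_spine, kindWeight]

theorem cnt_kind_po (j : Fin (X.k + 1)) :
    cnt (fun x : Σ y : X.Kind κ, Fin (kindWeight N y) => .po j ∈ kindPath P g x.1) = N := by
  classical
  rw [cnt_kind fun L => .po j ∈ L, sum_kind]
  simp [kindPath, mem_lift, mem_spine, kindWeight]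

theorem cnt_kind_tf (hg : ∀ f, cnt (fun x => g x = f) = N) (f : Σ i : Fin X.K, Fin (X.d i)) :
    cnt (fun x : Σ y : X.Kind κ, Fin (kindWeight N y) => .tf f ∈ kindPath P g x.1) = N := by
  classical
  rw [cnt_kind fun L => .tf f ∈ L, sum_kind]
  simp [kindPath, mem_lift, mem_spine, kindWeight]
  rw [← cnt_eq_card, cnt_eq_of_distribution hg]

theorem cnt_kind_wg (l : Fin X.H) (a : Fin X.n) (b : Bool) :
    cnt (fun x : Σ y : X.Kind κ, Fin (kindWeight N y) =>
      .qv l a ∈ kindPath P g x.1 ∧ .wg a b ∈ kindPath P g x.1) = N := by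
  classical
  rw [cnt_kind fun L => .qv l a ∈ L ∧ .wg a b ∈ L, sum_kind]
  cases b <;> simp [kindPath, mem_lift, mem_spine, kindWeight, ite_and]

/-- The total is one unit short of `target + k * (Q + 2)`, so leaving the target intact is the same
as losing at most `k * (Q + 2) - 1`. -/
theorem card_kind (P : κ → List (Fin X.n)) (hg : ∀ f, cnt (fun x => g x = f) = N) (hk : 2 ≤ X.k) :
    Fintype.card (Σ y : X.Kind κ, Fin (kindWeight N y)) + N =
      N * (X.target + X.k * (X.Q + 2)) := by
  classical
  obtain ⟨m, hm⟩ := Nat.exists_eq_add_of_le hk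
  have h1 : Fintype.card κ = N * X.D := by
    have := cnt_of_distribution hg fun _ => True
    rw [cnt_true] at this
    simpa [D, mul_comm, Finset.sum_mul] using this
  have h2 : ∑ l, ∑ f, N * gcap (X := X) (.qf l f) + N * X.D = N * X.D * X.H := by
    rw [Finset.sum_comm]
    have : ∑ f, (∑ l, N * gcap (X := X) (.qf l f) + N) = X.D * (N * X.H) := by
      rw [Finset.sum_congr rfl fun f _ => sum_qf_snd f, Finset.sum_const, Finset.card_univ,
        card_demands, smul_eq_mul]
    rw [Finset.sum_add_distrib, Finset.sum_const, Finset.card_univ, card_demands, smul_eq_mul,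
      mul_comm X.D] at this
    rw [this]; ring
  have h3 : X.k - 2 = m := by omega
  have h4 : X.H = X.K + 3 := rfl
  have h5 : X.k + 1 = m + 3 := by omega
  have h6 : X.k * (X.Q + 2) = (m + 2) * (X.Q + 2) := by rw [hm, add_comm 2 m]
  rw [← cnt_true, cnt_kind (P := P) (g := g) fun _ => True, sum_kind, target, h6]
  simp only [kindWeight, if_true, Finset.sum_const, Finset.card_univ, Fintype.card_bool,
    Fintype.card_fin, smul_eq_mul, h1, ← Finset.mul_sum, h3, h5, mul_one]
  simp only [← Finset.mul_sum] at h2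
  generalize ∑ φ : X.Abs, ssCap φ = T at *
  generalize ∑ l : Fin X.H, ∑ f, gcap (X := X) (.qf l f) = G at *
  rw [h4] at h2 ⊢
  rw [Q_eq]
  nlinarith [h2]

end Forward

end Data
end RobustFlow

/-! ### Robustness of the intended solution -/

namespace RobustFlow
namespace Data

variable {X : Data} {κ : Type} [Fintype κ] {P : κ → List (Fin X.n)}
  {g : κ → Σ i : Fin X.K, Fin (X.d i)} {N : ℕ}

/-- The unit paths of the constructed solution. -/
abbrev Units (X : Data) (κ : Type) (N : ℕ) : Type := Σ y : X.Kind κ, Fin (kindWeight N y)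

/-- If the load exceeds `m` by at most `c`, it suffices to exhibit `c` paths that are shared with
the bundle. -/
theorem le_cnt_and {ι : Type} [Fintype ι] {p q r : ι → Prop} {m c : ℕ} (hp : cnt p ≤ m + c)
    (hr : c ≤ cnt r) (h : ∀ i, r i → p i ∧ q i) : cnt (fun i => p i ∧ ¬ q i) ≤ m := by
  have h1 := cnt_split p q
  have h2 := cnt_mono h
  omega

/-- Apart from the paths through a fixed bundle, an arc outside the bundles carries at most `Q`
units. -/
theorem cnt_not_bundle_le (hg : ∀ f, cnt (fun x => g x = f) = N)
    (hu : ∀ a, cnt (fun x => a ∈ P x) ≤ N * X.u a) (huM : ∀ a, X.u a ≤ X.M)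
    (hP : ∀ x, SimplePath X.tl X.hd (X.src (g x).1) (P x) (X.snk (g x).1))
    (l : Fin X.H) (o : X.GA) (ho : o ≠ .e l) (hpsi : ∀ j, o ≠ .psi j) :
    cnt (fun x : X.Units κ N => o ∈ kindPath P g x.1 ∧ .e l ∉ kindPath P g x.1) ≤ N * X.Q := by
  have hcap := cap_kind (P := P) hg hu
  have hpath := fun y => simplePath_kindPath P g hP y
  have small : ∀ o : X.GA, gcap o ≤ X.Q →
      cnt (fun x : X.Units κ N => o ∈ kindPath P g x.1 ∧ .e l ∉ kindPath P g x.1) ≤ N * X.Q :=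
    fun o ho => (cnt_mono fun _ h => h.1).trans ((hcap o).trans (Nat.mul_le_mul_left _ ho))
  have hQ : X.Q = X.M + 2 * X.H + X.D + 2 * X.n + X.k + 1 := rfl
  have hH : 1 ≤ X.H := by simp [H]
  have hB := X.B_add_H
  cases o
  -- Only the paths through the whole chain meet two bundles, and they meet `l` too; the rest starts
  -- with `.sp l'`.
  case e l' =>
    refine (cnt_mono (q := fun x : X.Units κ N => .sp l' ∈ kindPath P g x.1) ?_).trans
      (hcap (.sp l'))
    rintro ⟨y, _⟩ ⟨h1, h2⟩
    revert h1 h2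
    rcases y with ⟨m, f⟩ | ⟨m, a, b⟩ | m | x | j | a | φ | j <;>
      simp [kindPath, mem_lift, mem_spine] <;> tauto
  -- The capacity is at most `Q + 2`, and the two units fed in by `.qv l a` pass through the bundle
  -- `l`.
  case mid a =>
    refine le_cnt_and (c := N * 2) ((hcap (.mid a)).trans ?_) (cnt_kind_qv l a).ge fun x hx =>
      ⟨?_, e_of_tl (hpath _) hx rfl⟩
    · rw [← mul_add]
      refine Nat.mul_le_mul_left _ ?_
      have := huM a
      simp only [gcap, r₀]
      omega
    · obtain ⟨o, ho, e⟩ := (hpath x.1).exists_succ hx (by simp [ghd])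
      cases o <;> simp [gtl, ghd] at e
      exact e ▸ ho
  -- The capacity is `Q + 1`, and each bundle supplies one unit: through the copy or directly for a
  -- unit of demand, through the copy for an arc, along the chain for the end.
  case st φ =>
    have h1 := hcap (.st φ)
    rw [show gcap (.st φ) = X.Q + 1 from rfl, mul_add, mul_one] at h1
    rcases φ with f | ⟨a, b⟩ | j
    · by_cases hl : l = X.bun f.1
      · refine le_cnt_and h1 (cnt_kind_tf (P := P) hg f).ge fun x hx =>
          ⟨st_of_hd (hpath _) hx rfl, ?_⟩
        subst hl
        revert hx
        obtain ⟨y, _⟩ := x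
        rcases y with ⟨m, f⟩ | ⟨m, a, b⟩ | m | x | j | a | φ | j <;>
          simp [kindPath, mem_lift, mem_spine]
        rintro rfl
        simp
      · refine le_cnt_and h1 (r := fun x => .qf l f ∈ kindPath P g x.1) ?_ fun x hx =>
          ⟨st_of_hd (hpath _) hx rfl, e_of_tl (hpath _) hx rfl⟩
        rw [cnt_kind_qf, gcap, if_neg hl, mul_one]
    · exact le_cnt_and h1 (cnt_kind_wg (P := P) (g := g) l a b).ge fun x hx =>
        ⟨st_of_hd (hpath _) hx.2 rfl, e_of_tl (hpath _) hx.1 rfl⟩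
    · refine le_cnt_and h1 (cnt_kind_po (P := P) (g := g) j).ge fun x hx =>
        ⟨st_of_hd (hpath _) hx rfl, ?_⟩
      revert hx
      obtain ⟨y, _⟩ := x
      rcases y with ⟨m, f⟩ | ⟨m, a, b⟩ | m | x | j | a | φ | j <;>
        simp [kindPath, mem_lift, mem_spine]
  case psi j => exact absurd rfl (hpsi j)
  case qs i =>
    refine small _ ?_
    have : X.d i ≤ X.D := Finset.single_le_sum (f := X.d) (fun _ _ => Nat.zero_le _) (Finset.mem_univ i)
    simp only [gcap]
    omega
  case inn a =>
    have := huM a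
    exact small _ (by simp only [gcap]; omega)
  case out a =>
    have := huM a
    exact small _ (by simp only [gcap]; omega)
  case qv l a =>
    have := a.pos
    exact small _ (by simp only [gcap]; omega)
  case ss φ =>
    refine small _ ?_
    rcases φ with f | ⟨a, b⟩ | j <;> simp only [gcap, ssCap] <;> omega
  case qf l f =>
    refine small _ ?_
    simp only [gcap]
    split_ifs <;> omega
  all_goals
    refine small _ ?_
    simp only [gcap, w, r₀]
    omega

/-- The number of constructed paths that are hit by raised arcs. -/
theorem cnt_mid_le (T : Finset (Fin X.n)) :
    cnt (fun x : X.Units κ N => ∃ a ∈ T, .mid a ∈ kindPath P g x.1) ≤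
      N * (2 * X.H + X.r₀) * T.card + cnt fun x => ∃ a ∈ P x, a ∈ T := by
  classical
  have h1 : cnt (fun x : X.Units κ N => ∃ a ∈ T, .sv a ∈ kindPath P g x.1) ≤
      T.card * (N * X.r₀) := by
    refine (cnt_mem_exists_le T _).trans ?_
    simp only [cnt_kind_sv, Finset.sum_const, smul_eq_mul, le_refl]
  have h2 : cnt (fun x : X.Units κ N => ∃ a ∈ T, ∃ l, .qv l a ∈ kindPath P g x.1) ≤
      T.card * (X.H * (N * 2)) := by
    refine (cnt_mem_exists_le T _).trans ?_
    rw [← smul_eq_mul, ← Finset.sum_const]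
    refine Finset.sum_le_sum fun a _ => (cnt_exists_le _).trans ?_
    simp only [cnt_kind_qv, Finset.sum_const, smul_eq_mul, Finset.card_univ, Fintype.card_fin,
      le_refl]
  have h3 : cnt (fun x : X.Units κ N => ∃ z, x.1 = .inr (.inr (.inr (.inl z))) ∧ ∃ a ∈ P z, a ∈ T) =
      cnt fun x => ∃ a ∈ P x, a ∈ T := by
    rw [cnt_sigma_fin (kindWeight N) fun y : X.Kind κ =>
      ∃ z, y = .inr (.inr (.inr (.inl z))) ∧ ∃ a ∈ P z, a ∈ T, sum_kind, cnt_eq_card]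
    simp [kindWeight]
  have h4 := (cnt_or_le (p := fun x : X.Units κ N => ∃ a ∈ T, .sv a ∈ kindPath P g x.1)
    (q := fun x => ∃ a ∈ T, ∃ l, .qv l a ∈ kindPath P g x.1))
  have h5 := cnt_or_le (p := fun x : X.Units κ N => (∃ a ∈ T, .sv a ∈ kindPath P g x.1) ∨
    ∃ a ∈ T, ∃ l, .qv l a ∈ kindPath P g x.1)
    (q := fun x => ∃ z, x.1 = .inr (.inr (.inr (.inl z))) ∧ ∃ a ∈ P z, a ∈ T)
  have h6 : cnt (fun x : X.Units κ N => ∃ a ∈ T, .mid a ∈ kindPath P g x.1) ≤ _ :=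
    (cnt_mono ?_).trans h5
  · have h7 : N * (2 * X.H + X.r₀) * T.card = T.card * (N * X.r₀) + T.card * (X.H * (N * 2)) := by
      ring
    omega
  -- The paths on a raised arc are its filler, the units fed in from bundles, and the lifted paths
  -- of the given solution.
  · rintro ⟨y, _⟩ ⟨a, ha, h⟩
    revert h
    rcases y with ⟨m, f⟩ | ⟨m, a, b⟩ | m | x | j | a | φ | j <;>
      simp [kindPath, mem_lift, mem_spine]
    · rintro rfl; simp [ha]
    · intro h; exact ⟨_, h, ha⟩
    · rintro rfl; simp [ha]

/-- Every failure scenario leaves enough of the constructed solution. -/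
theorem lost_kind_le (hk : 2 ≤ X.k) (hg : ∀ f, cnt (fun x => g x = f) = N)
    (hu : ∀ a, cnt (fun x => a ∈ P x) ≤ N * X.u a) (huM : ∀ a, X.u a ≤ X.M)
    (hP : ∀ x, SimplePath X.tl X.hd (X.src (g x).1) (P x) (X.snk (g x).1))
    (hrob : ∀ S : Finset (Fin X.n), S.card ≤ X.k →
      cnt (fun x => ∃ a ∈ P x, a ∈ S) + N ≤ N * (X.k * X.M))
    (S : Finset X.GA) (hS : S.card ≤ X.k) :
    cnt (fun x : X.Units κ N => ∃ o ∈ S, o ∈ kindPath P g x.1) + N ≤ N * (X.k * (X.Q + 2)) := by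
  classical
  have hcap := cap_kind (P := P) hg hu
  by_cases he : ∃ l, .e l ∈ S
  -- With a bundle arc in `S`, charge `Q + k + 1` to it, `Q` to each of the other at most `k - 1`
  -- arcs, and one more to each direct arc, of which there are at most `k - 2`.
  · obtain ⟨l, hl⟩ := he
    set S' := S.erase (.e l) with hS'
    have hc : S'.card + 1 = S.card := Finset.card_erase_add_one hl
    have h1 := cnt_split (fun x : X.Units κ N => ∃ o ∈ S, o ∈ kindPath P g x.1)
      (fun x => .e l ∈ kindPath P g x.1)
    have h2 : cnt (fun x : X.Units κ N => (∃ o ∈ S, o ∈ kindPath P g x.1) ∧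
        .e l ∈ kindPath P g x.1) ≤ N * (X.Q + X.k + 1) :=
      (cnt_mono fun x hx => hx.2).trans (hcap (.e l))
    have h3 : cnt (fun x : X.Units κ N => (∃ o ∈ S, o ∈ kindPath P g x.1) ∧
        ¬ .e l ∈ kindPath P g x.1) ≤
        ∑ o ∈ S', cnt (fun x : X.Units κ N => o ∈ kindPath P g x.1 ∧
          .e l ∉ kindPath P g x.1) := by
      refine (cnt_mono ?_).trans (cnt_mem_exists_le S' _)
      rintro x ⟨⟨o, ho, hx⟩, hn⟩
      exact ⟨o, Finset.mem_erase.2 ⟨fun e => hn (e ▸ hx), ho⟩, hx, hn⟩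
    have h4 : ∀ o ∈ S', cnt (fun x : X.Units κ N => o ∈ kindPath P g x.1 ∧
          .e l ∉ kindPath P g x.1) ≤ N * X.Q + if ∃ j, o = .psi j then N else 0 := by
      intro o ho
      split_ifs with hj
      · obtain ⟨j, rfl⟩ := hj
        exact (cnt_mono fun x hx => hx.1).trans (hcap (.psi j))
      · exact cnt_not_bundle_le hg hu huM hP l o (Finset.ne_of_mem_erase ho)
          fun j e => hj ⟨j, e⟩
    have h5 := h3.trans (Finset.sum_le_sum h4)
    rw [Finset.sum_add_distrib, Finset.sum_const, smul_eq_mul, ← Finset.sum_filter,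
      Finset.sum_const, smul_eq_mul] at h5
    have h6 : (S'.filter fun o => ∃ j, o = .psi j).card ≤ X.k - 2 := by
      have : (S'.filter fun o => ∃ j, o = .psi j) ⊆ Finset.univ.image GA.psi := by
        intro o ho
        obtain ⟨-, j, rfl⟩ := Finset.mem_filter.1 ho
        exact Finset.mem_image_of_mem _ (Finset.mem_univ j)
      refine (Finset.card_le_card this).trans (Finset.card_image_le.trans ?_)
      simp
    obtain ⟨m, hm⟩ := Nat.exists_eq_add_of_le hk
    have h7 : S'.card * (N * X.Q) ≤ (m + 1) * (N * X.Q) := Nat.mul_le_mul_right _ (by omega)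
    have h8 : (S'.filter fun o => ∃ j, o = .psi j).card * N ≤ m * N :=
      Nat.mul_le_mul_right _ (by omega)
    have h9 : N * (X.k * (X.Q + 2)) =
        N * (X.Q + X.k + 1) + (m + 1) * (N * X.Q) + m * N + N := by
      rw [hm]; ring
    omega
  · by_cases hm : ∀ o ∈ S, ∃ a, o = .mid a
    -- Only raised arcs fail: the added units number at most `k * (2 * H + r₀)`, and the given
    -- solution bounds the rest.
    · set T : Finset (Fin X.n) := Finset.univ.filter fun a => .mid a ∈ S with hT
      have hTS : T.image GA.mid ⊆ S := by
        intro o ho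
        obtain ⟨a, ha, rfl⟩ := Finset.mem_image.1 ho
        exact (Finset.mem_filter.1 ha).2
      have hTc : T.card ≤ X.k := by
        rw [← Finset.card_image_of_injective T (f := GA.mid (X := X))
          fun a b h => by simpa using h]
        exact (Finset.card_le_card hTS).trans hS
      have h1 : cnt (fun x : X.Units κ N => ∃ o ∈ S, o ∈ kindPath P g x.1) ≤ _ :=
        (cnt_mono fun x ⟨o, ho, hx⟩ => by
          obtain ⟨a, rfl⟩ := hm o ho
          exact ⟨a, Finset.mem_filter.2 ⟨Finset.mem_univ _, ho⟩, hx⟩).trans (cnt_mid_le T)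
      have h2 := hrob T hTc
      have h3 : N * (2 * X.H + X.r₀) * T.card ≤ N * (2 * X.H + X.r₀) * X.k :=
        Nat.mul_le_mul_left _ hTc
      have h4 : N * (X.k * (X.Q + 2)) = N * (X.k * X.M) + N * (2 * X.H + X.r₀) * X.k := by
        have : X.Q + 2 = X.M + (2 * X.H + X.r₀) := by simp only [Q, r₀]; omega
        rw [this]; ring
      omega
    -- One failing arc is neither a bundle arc nor a raised arc. It carries at most `Q + 1` and the
    -- others at most `Q + 2`, which saves the required unit.
    · push Not at hm
      obtain ⟨o, ho, hmid⟩ := hm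
      have hsmall : ∀ o' ∈ S, (∀ a, o' ≠ .mid a) → gcap o' ≤ X.Q + 1 := by
        intro o' ho' hn
        have hQ : X.Q = X.M + 2 * X.H + X.D + 2 * X.n + X.k + 1 := rfl
        have hH : 1 ≤ X.H := by simp [H]
        have hB := X.B_add_H
        cases o'
        case e l => exact absurd ⟨l, ho'⟩ he
        case mid a => exact absurd rfl (hn a)
        case qs i =>
          have : X.d i ≤ X.D :=
            Finset.single_le_sum (f := X.d) (fun _ _ => Nat.zero_le _) (Finset.mem_univ i)
          simp only [gcap]
          omega
        case inn a => have := huM a; simp only [gcap]; omega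
        case out a => have := huM a; simp only [gcap]; omega
        case ss φ => rcases φ with f | ⟨a, b⟩ | j <;> simp only [gcap, ssCap] <;> omega
        case qf l f => simp only [gcap]; split_ifs <;> omega
        all_goals
          simp only [gcap, w, r₀]
          omega
      have hlarge : ∀ o' ∈ S, gcap o' ≤ X.Q + 2 := by
        intro o' ho'
        by_cases h : ∃ a, o' = .mid a
        · obtain ⟨a, rfl⟩ := h
          have := huM a
          simp only [gcap, r₀, Q]
          omega
        · exact (hsmall o' ho' fun a e => h ⟨a, e⟩).trans (Nat.le_succ _)
      have h1 : cnt (fun x : X.Units κ N => ∃ o ∈ S, o ∈ kindPath P g x.1) ≤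
          ∑ o ∈ S, N * gcap o :=
        (cnt_mem_exists_le S _).trans (Finset.sum_le_sum fun o _ => hcap o)
      rw [← Finset.add_sum_erase S _ ho] at h1
      have h2 : N * gcap o ≤ N * (X.Q + 1) := Nat.mul_le_mul_left _ (hsmall o ho hmid)
      have h3 : ∑ o ∈ S.erase o, N * gcap o ≤ (S.erase o).card * (N * (X.Q + 2)) := by
        rw [← smul_eq_mul, ← Finset.sum_const]
        exact Finset.sum_le_sum fun o' ho' =>
          Nat.mul_le_mul_left _ (hlarge o' (Finset.mem_of_mem_erase ho'))
      have hc := Finset.card_erase_add_one ho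
      obtain ⟨m, hm⟩ := Nat.exists_eq_add_of_le hk
      have h4 : (S.erase o).card * (N * (X.Q + 2)) ≤ (m + 1) * (N * (X.Q + 2)) :=
        Nat.mul_le_mul_right _ (by omega)
      have h5 : N * (X.k * (X.Q + 2)) = N * (X.Q + 1) + (m + 1) * (N * (X.Q + 2)) + N := by
        rw [hm]; ring
      omega

/-- A robust solution of the multi-commodity instance yields one of the single-commodity
instance. -/
theorem MultiYes.singleYes (hk : 2 ≤ X.k) (huM : ∀ a, X.u a ≤ X.M) (h : X.MultiYes N) :
    X.SingleYes N := by
  classical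
  obtain ⟨κ, _, c, P, hP, hd, hu, hrob⟩ := h
  -- Each `.tf f` has capacity one, so the paths of a commodity must be spread evenly over its units
  -- of demand.
  obtain ⟨g, hgc, hg⟩ := exists_distribution c hd
  replace hP : ∀ x, SimplePath X.tl X.hd (X.src (g x).1) (P x) (X.snk (g x).1) := fun x => by
    rw [hgc]; exact hP x
  refine ⟨X.Units κ N, inferInstance, fun x => kindPath P g x.1,
    fun x => simplePath_kindPath P g hP x.1, cap_kind hg hu, fun S hS => ?_⟩
  have h1 := lost_kind_le hk hg hu huM hP hrob S hS
  have h2 := card_kind P hg hk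
  have h3 := cnt_split (fun _ : X.Units κ N => True) fun x => ∃ o ∈ S, o ∈ kindPath P g x.1
  rw [cnt_true] at h3
  replace h2 : Fintype.card (X.Units κ N) + N = _ := h2
  have h4 : cnt (fun x : X.Units κ N => True ∧ ∃ o ∈ S, o ∈ kindPath P g x.1) =
      cnt (fun x : X.Units κ N => ∃ o ∈ S, o ∈ kindPath P g x.1) := cnt_congr fun x => by simp
  have h5 : cnt (fun x : X.Units κ N => True ∧ ¬ ∃ o ∈ S, o ∈ kindPath P g x.1) =
      cnt (fun x : X.Units κ N => ∀ o ∈ kindPath P g x.1, o ∉ S) := cnt_congr fun x => by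
    simp only [true_and]
    exact ⟨fun h o ho hS => h ⟨o, hS, ho⟩, fun h ⟨o, hS, ho⟩ => h o ho hS⟩
  rw [h4, h5] at h3
  rw [mul_add] at h2
  change N * X.target ≤ cnt fun x : X.Units κ N => ∀ o ∈ kindPath P g x.1, o ∉ S
  omega

theorem singleYes_iff_multiYes (hk : 2 ≤ X.k) (hM : 1 ≤ X.M) (hu : ∀ a, X.u a ≤ X.M) :
    X.SingleYes N ↔ X.MultiYes N :=
  ⟨SingleYes.multiYes hk hM hu, MultiYes.singleYes hk hu⟩

end Data
end RobustFlow

namespace RobustFlow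

/-! ## Path flows as families of unit paths -/

section Families

variable {m : ℕ} {Ps : Finset (Finset (Fin m))}

-- The family consists of `N * x P` copies of each path `P`. Stating the count for an arbitrary
-- property covers arc loads, demands and failures at once.
open Classical in
theorem exists_family {x : Finset (Fin m) → ℚ≥0} {N : ℕ}
    (hx : ∀ P ∈ Ps, ∃ n : ℕ, (N : ℚ≥0) * x P = n) :
    ∃ (ι : Type) (_ : Fintype ι) (c : ι → Finset (Fin m)), (∀ i, c i ∈ Ps) ∧
      ∀ p : Finset (Fin m) → Prop,
        (cnt (fun i => p (c i)) : ℚ≥0) = N * ∑ P ∈ Ps with p P, x P := by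
  choose w hw using fun P : Ps => hx P.1 P.2
  refine ⟨Σ P : Ps, Fin (w P), inferInstance, fun y => y.1.1, fun y => y.1.2, fun p => ?_⟩
  rw [cnt_sigma_fin w fun P : Ps => p P.1, Finset.mul_sum, Finset.sum_filter,
    ← Finset.sum_coe_sort Ps]
  push_cast
  refine Finset.sum_congr rfl fun P _ => ?_
  split_ifs
  · exact (hw P).symm
  · rfl

open Classical in
theorem exists_flow {ι : Type} [Fintype ι] {c : ι → Finset (Fin m)} (hc : ∀ i, c i ∈ Ps) {N : ℕ}
    (hN : 0 < N) : ∃ x : Finset (Fin m) → ℚ≥0, (∀ P, ∃ n : ℕ, (N : ℚ≥0) * x P = n) ∧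
      ∀ p : Finset (Fin m) → Prop,
        (cnt (fun i => p (c i)) : ℚ≥0) = N * ∑ P ∈ Ps with p P, x P := by
  have hN' : (N : ℚ≥0) ≠ 0 := by exact_mod_cast hN.ne'
  refine ⟨fun P => (cnt fun i => c i = P : ℕ) / N, fun P => ⟨_, mul_div_cancel₀ _ hN'⟩,
    fun p => ?_⟩
  rw [Finset.mul_sum, Finset.sum_congr rfl fun P _ => mul_div_cancel₀ _ hN', ← Nat.cast_sum]
  congr 1
  rw [← cnt_mem_exists_eq (Ps.filter p) (fun P i => c i = P)
    fun i P _ P' _ h h' => h.symm.trans h']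
  exact cnt_congr fun i => ⟨fun h => ⟨c i, Finset.mem_filter.2 ⟨hc i, h⟩, rfl⟩,
    fun ⟨P, hP, e⟩ => e ▸ (Finset.mem_filter.1 hP).2⟩

theorem exists_common_denominator (Ps : Finset (Finset (Fin m))) (x : Finset (Fin m) → ℚ≥0) :
    ∃ N : ℕ, 0 < N ∧ ∀ P ∈ Ps, ∃ n : ℕ, (N : ℚ≥0) * x P = n := by
  classical
  refine ⟨∏ P ∈ Ps, (x P).den, Finset.prod_pos fun P _ => (x P).den_pos, fun P hP => ?_⟩
  rw [← Finset.mul_prod_erase Ps _ hP]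
  refine ⟨(x P).num * ∏ P ∈ Ps.erase P, (x P).den, ?_⟩
  have h : ((x P).den : ℚ≥0) * x P = (x P).num := NNRat.den_mul_eq_num _
  rw [Nat.cast_mul, mul_right_comm, h, Nat.cast_mul]

end Families

theorem walk_iff (N : Network) {v w : Fin N.numV} {l : List (Fin N.numA)} :
    N.IsWalk v l w ↔ Walk N.tail N.head v l w := by
  induction l generalizing v with
  | nil => rfl
  | cons a l ih => exact and_congr Iff.rfl ih

theorem mem_paths_iff {N : Network} {s t : Fin N.numV} {P : Finset (Fin N.numA)} :
    P ∈ N.paths s t ↔ ∃ l, SimplePath N.tail N.head s l t ∧ l.toFinset = P := by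
  classical
  refine Finset.mem_filter.trans ?_
  simp only [Network.IsPath, Finset.mem_univ, true_and, walk_iff, SimplePath, and_assoc]

theorem SimplePath.map_iff {V W A B : Type*} {tl hd : A → V} {tl' hd' : B → W} {ν : V → W}
    {φ : A → B} (hν : Function.Injective ν) (ht : ∀ a, tl' (φ a) = ν (tl a))
    (hh : ∀ a, hd' (φ a) = ν (hd a)) {s t : V} {l : List A} :
    SimplePath tl' hd' (ν s) (l.map φ) (ν t) ↔ SimplePath tl hd s l t := by
  refine ⟨fun h => ⟨?_, ?_⟩, fun h => ⟨?_, ?_⟩⟩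
  · have h1 := h.1
    clear h
    induction l generalizing s with
    | nil => exact hν h1
    | cons a l ih => exact ⟨hν ((ht a).symm.trans h1.1), ih (hh a ▸ h1.2)⟩
  · refine List.Nodup.of_map ν ?_
    have := h.2
    simpa [List.map_map, Function.comp_def, hh] using this
  · have h1 := h.1
    clear h
    induction l generalizing s with
    | nil => exact congrArg ν h1
    | cons a l ih => exact ⟨(ht a).trans (congrArg ν h1.1), hh a ▸ ih h1.2⟩
  · have := h.2.map hν
    simpa [List.map_map, Function.comp_def, hh] using this

/-! ## Families of unit paths of the two problems -/

namespace MRFInstance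

variable (J : MRFInstance)

/-- There is a robust family of unit paths, `N` of them making up one unit of flow. -/
def FamilyYes (N : ℕ) : Prop :=
  ∃ (ι : Type) (_ : Fintype ι) (c : ι → Finset (Fin J.numA)), (∀ i, c i ∈ J.stPaths) ∧
    (∀ a, (cnt fun i => a ∈ c i : ℚ≥0) ≤ N * J.cap a) ∧
    ∀ S : Finset (Fin J.numA), S.card ≤ J.budget →
      (N : ℚ≥0) * J.target ≤ (cnt fun i => c i ∩ S = ∅ : ℕ)

variable {J}

theorem yes_of_family {N : ℕ} (hN : 0 < N) (h : J.FamilyYes N) :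
    ∃ x, (∀ P, ∃ n : ℕ, (N : ℚ≥0) * x P = n) ∧ J.IsFlow x ∧
      ∀ S : Finset (Fin J.numA), S.card ≤ J.budget → J.target ≤ surviving J.stPaths x S := by
  classical
  obtain ⟨ι, _, c, h1, h2, h3⟩ := h
  obtain ⟨x, hx, hc⟩ := exists_flow h1 hN
  have hN' : (0 : ℚ≥0) < N := by exact_mod_cast hN
  refine ⟨x, hx, fun a => ?_, fun S hS => ?_⟩
  · have := h2 a
    rw [hc fun P => a ∈ P] at this
    unfold arcFlow
    convert le_of_mul_le_mul_left this hN'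
  · have := h3 S hS
    rw [hc fun P => P ∩ S = ∅] at this
    unfold surviving
    convert le_of_mul_le_mul_left this hN'

theorem family_of_yes {N : ℕ} {x : Finset (Fin J.numA) → ℚ≥0}
    (hx : ∀ P ∈ J.stPaths, ∃ n : ℕ, (N : ℚ≥0) * x P = n) (h1 : J.IsFlow x)
    (h2 : ∀ S : Finset (Fin J.numA), S.card ≤ J.budget → J.target ≤ surviving J.stPaths x S) :
    J.FamilyYes N := by
  classical
  obtain ⟨ι, _, c, hc, hcp⟩ := exists_family hx
  refine ⟨ι, inferInstance, c, hc, fun a => ?_, fun S hS => ?_⟩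
  · rw [hcp fun P => a ∈ P]
    have := mul_le_mul_right (h1 a) (N : ℚ≥0)
    unfold arcFlow at this
    convert this
  · rw [hcp fun P => P ∩ S = ∅]
    have := mul_le_mul_right (h2 S hS) (N : ℚ≥0)
    unfold surviving at this
    convert this

theorem yes_iff : J.Yes ↔ ∃ N, 0 < N ∧ J.FamilyYes N := by
  constructor
  · rintro ⟨x, h1, h2⟩
    obtain ⟨N, hN, hx⟩ := exists_common_denominator J.stPaths x
    exact ⟨N, hN, family_of_yes hx h1 h2⟩
  · rintro ⟨N, hN, h⟩
    obtain ⟨x, -, h1, h2⟩ := yes_of_family hN h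
    exact ⟨x, h1, h2⟩

/-- An integral flow is itself a family of unit paths, with denominator `1`. -/
theorem integralYes_iff : J.IntegralYes ↔ J.FamilyYes 1 := by
  constructor
  · rintro ⟨x, h1, hx, h2⟩
    exact family_of_yes (fun P hP => by simpa using hx P hP) h1 h2
  · intro h
    obtain ⟨x, hx, h1, h2⟩ := yes_of_family one_pos h
    exact ⟨x, h1, fun P _ => by simpa using hx P, h2⟩

end MRFInstance

namespace MRFMInstance

variable (I : MRFMInstance)

/-- There is a robust family of unit paths, `N` of them making up one unit of flow. -/
def FamilyYes (N : ℕ) : Prop :=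
  ∃ (ι : Type) (_ : Fintype ι) (c : ι → Finset (Fin I.numA)), (∀ i, c i ∈ I.allPaths) ∧
    (∀ a, (cnt fun i => a ∈ c i : ℚ≥0) ≤ N * I.cap a) ∧
    (∀ j, (cnt fun i => c i ∈ I.comPaths j : ℚ≥0) = N * I.demand j) ∧
    ∀ S : Finset (Fin I.numA), S.card ≤ I.budget →
      ((cnt fun i => (c i ∩ S).Nonempty : ℕ) : ℚ≥0) + N ≤ N * (I.budget * I.maxCap)

variable {I}

theorem filter_allPaths (I : MRFMInstance) (j : Fin I.numK)
    (inst : DecidablePred fun P => P ∈ I.comPaths j) :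
    @Finset.filter _ (fun P => P ∈ I.comPaths j) inst I.allPaths = I.comPaths j := by
  ext P
  simp only [Finset.mem_filter, allPaths, Finset.mem_biUnion, Finset.mem_univ, true_and,
    and_iff_right_iff_imp]
  exact fun h => ⟨j, h⟩

/-- Clears the denominator and moves the `1` to the other side, so that the bound can be stated
without subtraction. -/
theorem robust_iff {N : ℕ} (hN : 0 < N) {x c M : ℚ≥0} {k : ℕ} (h : c = N * x) :
    c + N ≤ N * (k * M) ↔ (x : ℚ) ≤ k * M - 1 := by
  have hN' : (0 : ℚ) < N := by exact_mod_cast hN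
  subst h
  rw [le_sub_iff_add_le, ← mul_le_mul_iff_right₀ hN', ← NNRat.coe_le_coe]
  push_cast
  rw [mul_add, mul_one]

theorem yes_of_family {N : ℕ} (hN : 0 < N) (h : I.FamilyYes N) :
    ∃ x, (∀ P, ∃ n : ℕ, (N : ℚ≥0) * x P = n) ∧ I.IsFlow x ∧
      ∀ S : Finset (Fin I.numA), S.card ≤ I.budget →
        (lost I.allPaths x S : ℚ) ≤ I.budget * I.maxCap - 1 := by
  classical
  obtain ⟨ι, _, c, h1, h2, h3, h4⟩ := h
  obtain ⟨x, hx, hc⟩ := exists_flow h1 hN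
  have hN' : (0 : ℚ≥0) < N := by exact_mod_cast hN
  refine ⟨x, hx, ⟨fun a => ?_, fun j => ?_⟩, fun S hS => ?_⟩
  · have := h2 a
    rw [hc fun P => a ∈ P] at this
    unfold arcFlow
    convert le_of_mul_le_mul_left this hN'
  · have := h3 j
    rw [hc fun P => P ∈ I.comPaths j, filter_allPaths I j _] at this
    exact mul_left_cancel₀ hN'.ne' this
  · refine (robust_iff hN ?_).1 (h4 S hS)
    rw [hc fun P => (P ∩ S).Nonempty]
    unfold lost
    congr!

theorem family_of_yes {N : ℕ} (hN : 0 < N) {x : Finset (Fin I.numA) → ℚ≥0}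
    (hx : ∀ P ∈ I.allPaths, ∃ n : ℕ, (N : ℚ≥0) * x P = n) (h1 : I.IsFlow x)
    (h2 : ∀ S : Finset (Fin I.numA), S.card ≤ I.budget →
        (lost I.allPaths x S : ℚ) ≤ I.budget * I.maxCap - 1) :
    I.FamilyYes N := by
  classical
  obtain ⟨ι, _, c, hc, hcp⟩ := exists_family hx
  refine ⟨ι, inferInstance, c, hc, fun a => ?_, fun j => ?_, fun S hS => ?_⟩
  · rw [hcp fun P => a ∈ P]
    have := mul_le_mul_right (h1.1 a) (N : ℚ≥0)
    unfold arcFlow at this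
    convert this
  · rw [hcp fun P => P ∈ I.comPaths j, filter_allPaths I j _, h1.2 j]
  · refine (robust_iff hN ?_).2 (h2 S hS)
    rw [hcp fun P => (P ∩ S).Nonempty]
    unfold lost
    congr!

theorem yes_iff : I.Yes ↔ ∃ N, 0 < N ∧ I.FamilyYes N := by
  constructor
  · rintro ⟨x, h1, h2⟩
    obtain ⟨N, hN, hx⟩ := exists_common_denominator I.allPaths x
    exact ⟨N, hN, family_of_yes hN hx h1 h2⟩
  · rintro ⟨N, hN, h⟩
    obtain ⟨x, -, h1, h2⟩ := yes_of_family hN h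
    exact ⟨x, h1, h2⟩

theorem integralYes_iff : I.IntegralYes ↔ I.FamilyYes 1 := by
  constructor
  · rintro ⟨x, h1, hx, h2⟩
    exact family_of_yes one_pos (fun P hP => by simpa using hx P hP) h1 h2
  · intro h
    obtain ⟨x, hx, h1, h2⟩ := yes_of_family one_pos h
    exact ⟨x, h1, fun P _ => by simpa using hx P, h2⟩

/-- Some earlier commodity has the same source and sink. -/
def Dup (I : MRFMInstance) (i : Fin I.numK) : Prop :=
  ∃ j < i, I.source j = I.source i ∧ I.sink j = I.sink i

open Classical in
/-- The data of an instance with integral capacities and demands. A commodity with the same source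
and sink as an earlier one describes the same set of paths and is dropped. -/
noncomputable def data (I : MRFMInstance) : Data where
  nV := I.numV
  n := I.numA
  K := I.numK
  tl := I.tail
  hd := I.head
  u a := (I.cap a).num
  src := I.source
  snk := I.sink
  d i := if I.Dup i then 0 else (I.demand i).num
  k := I.budget
  M := Finset.univ.sup fun a => (I.cap a).num

/-- Every commodity is represented by the first one with the same source and sink. -/
theorem exists_not_dup (i : Fin I.numK) :
    ∃ j, ¬ I.Dup j ∧ I.source j = I.source i ∧ I.sink j = I.sink i := by
  classical
  induction i using WellFoundedLT.induction with
  | ind i ih =>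
    by_cases h : I.Dup i
    · obtain ⟨j, hj, h1, h2⟩ := h
      obtain ⟨m, hm, h3, h4⟩ := ih j hj
      exact ⟨m, hm, h3.trans h1, h4.trans h2⟩
    · exact ⟨i, h, rfl, rfl⟩

theorem eq_of_not_dup {i j : Fin I.numK} (hi : ¬ I.Dup i) (hj : ¬ I.Dup j)
    (h1 : I.source i = I.source j) (h2 : I.sink i = I.sink j) : i = j := by
  rcases lt_trichotomy i j with h | h | h
  · exact absurd ⟨i, h, h1, h2⟩ hj
  · exact h
  · exact absurd ⟨j, h, h1.symm, h2.symm⟩ hi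

theorem u_le (a : Fin I.data.n) : I.data.u a ≤ I.data.M :=
  Finset.le_sup (f := fun a => (I.cap a).num) (Finset.mem_univ a)

theorem cap_eq (hcap : ∀ a, ∃ n : ℕ, I.cap a = n) (a : Fin I.numA) :
    I.cap a = ((I.cap a).num : ℕ) := by
  obtain ⟨n, hn⟩ := hcap a
  rw [hn]; simp

theorem maxCap_eq (hcap : ∀ a, ∃ n : ℕ, I.cap a = n) : I.maxCap = (I.data.M : ℕ) := by
  change Finset.univ.sup I.cap = ((Finset.univ.sup fun a => (I.cap a).num : ℕ) : ℚ≥0)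
  rw [Finset.apply_sup_eq_sup_comp (g := fun n : ℕ => (n : ℚ≥0))]
  · exact Finset.sup_congr rfl fun a _ => cap_eq hcap a
  · exact fun a b => Nat.mono_cast.map_sup a b
  · simp

theorem demand_num (hcap : ∀ a, ∃ n : ℕ, I.cap a = n) (hT : I.TightTerminals) (i : Fin I.numK) :
    I.demand i = ((I.demand i).num : ℕ) := by
  rw [← (hT i).1, Finset.sum_congr rfl fun a _ => cap_eq hcap a, ← Nat.cast_sum,
    NNRat.num_natCast]

theorem demand_congr (hT : I.TightTerminals) {i j : Fin I.numK} (h : I.source i = I.source j) :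
    I.demand i = I.demand j := by
  rw [← (hT i).1, ← (hT j).1, h]

/-- This rules out the empty path, the only arc set that does not determine its end nodes. -/
theorem demand_eq_zero (hT : I.TightTerminals) {i : Fin I.numK} (h : I.source i = I.sink i) :
    I.demand i = 0 := by
  rw [← (hT i).1, h, (hT i).2.2.2]
  simp

theorem d_of_dup {i : Fin I.numK} (hi : I.Dup i) : I.data.d i = 0 := if_pos hi

theorem d_of_not_dup {i : Fin I.numK} (hi : ¬ I.Dup i) : I.data.d i = (I.demand i).num := if_neg hi

/-- A nonempty path determines its terminals (`ends_eq`), so each unit path can be assigned to the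
first commodity with these terminals. Commodities with equal terminals have the same paths and, by
tightness, the same demand, so keeping one of them changes nothing. -/
theorem family_iff (hcap : ∀ a, ∃ n : ℕ, I.cap a = n) (hT : I.TightTerminals) {N : ℕ} :
    I.FamilyYes N ↔ I.data.MultiYes N := by
  classical
  constructor
  · rintro ⟨ι, _, c, h1, h2, h3, h4⟩
    have h1' : ∀ y, ∃ i, c y ∈ I.comPaths i := fun y => by simpa [allPaths] using h1 y
    have key : ∀ y, ∃ i, ¬ I.Dup i ∧ c y ∈ I.comPaths i := by
      intro y
      obtain ⟨i, hi⟩ := h1' y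
      obtain ⟨j, hj, h5, h6⟩ := I.exists_not_dup i
      refine ⟨j, hj, ?_⟩
      rwa [comPaths, h5, h6]
    choose com hcom hmem using key
    choose l hl hlc using fun y => mem_paths_iff.1 (hmem y)
    have hne : ∀ y, l y ≠ [] := by
      intro y hy
      have h5 : I.source (com y) = I.sink (com y) := by
        have := (hl y).1
        rw [hy] at this
        exact this
      have h6 := h3 (com y)
      rw [demand_eq_zero hT h5, mul_zero, Nat.cast_eq_zero, cnt_eq_zero_iff] at h6
      exact h6 y (hmem y)
    have hiff : ∀ y j, ¬ I.Dup j → (com y = j ↔ c y ∈ I.comPaths j) := by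
      intro y j hj
      refine ⟨fun e => e ▸ hmem y, fun h => ?_⟩
      obtain ⟨l', hl', e⟩ := mem_paths_iff.1 h
      obtain ⟨h5, h6⟩ := (hl y).ends_eq hl' (hne y) fun a => by
        rw [← List.mem_toFinset, ← List.mem_toFinset, hlc, e]
      exact eq_of_not_dup (hcom y) hj h5 h6
    refine ⟨ι, inferInstance, com, l, hl, fun (j : Fin I.numK) => ?_, fun (a : Fin I.numA) => ?_,
      fun (S : Finset (Fin I.numA)) hS => ?_⟩
    · change cnt (fun y => com y = j) = N * I.data.d j
      by_cases hj : I.Dup j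
      · rw [d_of_dup hj, mul_zero, cnt_eq_zero_iff]
        rintro y rfl
        exact hcom y hj
      · have h5 := h3 j
        rw [demand_num hcap hT] at h5
        rw [d_of_not_dup hj, cnt_congr fun y => hiff y j hj]
        exact_mod_cast h5
    · change cnt (fun y => a ∈ l y) ≤ N * (I.cap a).num
      have h5 := h2 a
      rw [cap_eq hcap] at h5
      rw [cnt_congr (q := fun y => a ∈ c y) fun y => by rw [← hlc, List.mem_toFinset]]
      exact_mod_cast h5
    · change cnt (fun y => ∃ a ∈ l y, a ∈ S) + N ≤ N * (I.budget * I.data.M)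
      have h5 := h4 S hS
      rw [maxCap_eq hcap] at h5
      rw [cnt_congr (q := fun y => (c y ∩ S).Nonempty) fun y => by
        rw [← hlc]
        simp [Finset.Nonempty]]
      exact_mod_cast h5
  · rintro ⟨ι, _, com, l, hl, h2, h3, h4⟩
    change ι → Fin I.numK at com
    change ι → List (Fin I.numA) at l
    replace hl : ∀ y, SimplePath I.tail I.head (I.source (com y)) (l y) (I.sink (com y)) := hl
    have hpos : ∀ y, 0 < I.data.d (com y) := by
      intro y
      by_contra h0
      have := h2 (com y)
      rw [Nat.eq_zero_of_not_pos h0, mul_zero, cnt_eq_zero_iff] at this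
      exact this y rfl
    have hdup : ∀ y, ¬ I.Dup (com y) := fun y h => (hpos y).ne' (d_of_dup h)
    have hne : ∀ y, l y ≠ [] := by
      intro y hy
      have h5 : I.source (com y) = I.sink (com y) := by
        have := (hl y).1
        rw [hy] at this
        exact this
      have h6 := hpos y
      rw [d_of_not_dup (hdup y), demand_eq_zero hT h5] at h6
      simp at h6
    have hmem : ∀ y, (l y).toFinset ∈ I.comPaths (com y) := fun y =>
      mem_paths_iff.2 ⟨l y, hl y, rfl⟩
    refine ⟨ι, inferInstance, fun y => (l y).toFinset, fun y => ?_, fun a => ?_, fun i => ?_,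
      fun S hS => ?_⟩
    · rw [allPaths, Finset.mem_biUnion]
      exact ⟨com y, Finset.mem_univ _, hmem y⟩
    · have h5 := h3 a
      change _ ≤ N * (I.cap a).num at h5
      rw [cap_eq hcap, cnt_congr (q := fun y => a ∈ l y) fun y => by simp]
      exact_mod_cast h5
    -- The demand of a dropped commodity is read off from its representative `j`, which has the same
    -- paths and the same demand.
    · obtain ⟨j, hj, h5, h6⟩ := I.exists_not_dup i
      have h7 := h2 j
      rw [d_of_not_dup hj] at h7
      rw [← demand_congr hT h5, demand_num hcap hT j, cnt_congr (q := fun y => com y = j)]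
      · exact_mod_cast h7
      · intro y
        constructor
        · intro h
          obtain ⟨l', hl', e⟩ := mem_paths_iff.1 h
          obtain ⟨h8, h9⟩ := (hl y).ends_eq hl' (hne y) fun a => by
            rw [← List.mem_toFinset, ← List.mem_toFinset, e]
          exact eq_of_not_dup (hdup y) hj (h8.trans h5.symm) (h9.trans h6.symm)
        · rintro rfl
          have := hmem y
          rwa [comPaths, h5, h6] at this
    · have h5 := h4 S hS
      rw [maxCap_eq hcap, cnt_congr (q := fun y => ∃ a ∈ l y, a ∈ S) fun y => by
        simp [Finset.Nonempty]]
      exact_mod_cast h5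

end MRFMInstance
end RobustFlow

/-! ### Numbering of nodes and arcs, and the encoded instance -/

namespace RobustFlow
namespace Data

variable (X : Data)

/-- Number of nodes of the single-commodity network. -/
def numNodes : ℕ := X.nV + 3 + 2 * X.H + 4 * X.n + X.D + X.k + 1

variable {X}

/-- Numbering of the absorbing arcs. -/
def absIndex : X.Abs → ℕ
  | .inl f => X.nV + 3 + 2 * X.H + 4 * X.n + finSigmaFinEquiv f
  | .inr (.inl (a, b)) => X.nV + 3 + 2 * X.H + 2 * X.n + (if b then X.n else 0) + a
  | .inr (.inr j) => X.nV + 3 + 2 * X.H + 4 * X.n + X.D + j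

/-- Numbering of the nodes. -/
def nodeIndex : X.GV → ℕ
  | .base v => v
  | .s => X.nV
  | .t => X.nV + 1
  | .p l => X.nV + 2 + l
  | .q l => X.nV + 3 + X.H + l
  | .vi a => X.nV + 3 + 2 * X.H + a
  | .wo a => X.nV + 3 + 2 * X.H + X.n + a
  | .ab φ => absIndex φ

theorem sigma_lt (f : Σ i : Fin X.K, Fin (X.d i)) : (finSigmaFinEquiv f : ℕ) < X.D :=
  (finSigmaFinEquiv f).isLt

theorem nodeIndex_lt (v : X.GV) : nodeIndex v < X.numNodes := by
  unfold numNodes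
  rcases v with v | _ | _ | l | l | a | a | (f | ⟨a, b⟩ | j) <;> simp only [nodeIndex, absIndex]
  case ab.inl => have := sigma_lt f; omega
  case ab.inr.inl => split_ifs <;> omega
  all_goals omega

theorem absIndex_ge (φ : X.Abs) : X.nV + 3 + 2 * X.H + 2 * X.n ≤ absIndex φ := by
  rcases φ with f | ⟨a, b⟩ | j <;> simp only [absIndex] <;> omega

theorem absIndex_injective : Function.Injective (absIndex (X := X)) := by
  rintro (f | ⟨a, b⟩ | j) (f' | ⟨a', b'⟩ | j') h
  · rw [finSigmaFinEquiv.injective (Fin.ext (Nat.add_left_cancel h))]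
  · have := a'.isLt
    simp only [absIndex] at h; split_ifs at h <;> omega
  · have := sigma_lt f
    simp only [absIndex] at h; omega
  · have := a.isLt
    simp only [absIndex] at h; split_ifs at h <;> omega
  · have := a.isLt
    have := a'.isLt
    simp only [absIndex] at h
    cases b <;> cases b' <;> simp at h <;> first | omega | (simp; omega)
  · have := a.isLt
    simp only [absIndex] at h; split_ifs at h <;> omega
  · have := sigma_lt f'
    simp only [absIndex] at h; omega
  · have := a'.isLt
    simp only [absIndex] at h; split_ifs at h <;> omega
  · simp only [absIndex] at h
    rw [Fin.ext (by omega : (j : ℕ) = j')]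

theorem nodeIndex_injective : Function.Injective (nodeIndex (X := X)) := by
  intro v w h
  by_cases hv : ∃ φ, v = .ab φ
  · obtain ⟨φ, rfl⟩ := hv
    have hφ := absIndex_ge φ
    by_cases hw : ∃ ψ, w = .ab ψ
    · obtain ⟨ψ, rfl⟩ := hw
      rw [absIndex_injective h]
    · cases w <;> simp only [nodeIndex] at h <;> first | omega | simp at hw
  · by_cases hw : ∃ ψ, w = .ab ψ
    · obtain ⟨ψ, rfl⟩ := hw
      have hψ := absIndex_ge ψ
      cases v <;> simp only [nodeIndex] at h <;> first | omega | simp at hv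
    · cases v <;> cases w <;> simp only [nodeIndex] at h <;>
        first
        | rfl
        | (exfalso; omega)
        | (congr 1; first | exact Fin.ext (by omega))
        | simp at hv hw

variable (X)

/-- The arcs of the single-commodity network in a fixed order. -/
def arcList : List X.GA :=
  GA.zin :: (((List.finRange X.H).flatMap fun l => [GA.sp l, GA.e l, GA.ch l, GA.qt l]) ++
  ((List.finRange X.K).map GA.qs ++
  (((List.finRange X.K).flatMap fun i => (List.finRange (X.d i)).flatMap fun j =>
    [GA.tf ⟨i, j⟩, GA.ss (Sum.inl ⟨i, j⟩), GA.st (Sum.inl ⟨i, j⟩)] ++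
      (List.finRange X.H).map fun l => GA.qf l ⟨i, j⟩) ++
  (((List.finRange X.H).flatMap fun l => (List.finRange X.n).map fun a => GA.qv l a) ++
  (((List.finRange X.n).flatMap fun a =>
    [GA.inn a, GA.mid a, GA.out a, GA.sv a, GA.wt a, GA.wg a false, GA.wg a true,
      GA.ss (Sum.inr (Sum.inl (a, false))), GA.st (Sum.inr (Sum.inl (a, false))),
      GA.ss (Sum.inr (Sum.inl (a, true))), GA.st (Sum.inr (Sum.inl (a, true)))]) ++
  (((List.finRange (X.k + 1)).flatMap fun j =>
    [GA.po j, GA.ss (Sum.inr (Sum.inr j)), GA.st (Sum.inr (Sum.inr j))]) ++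
  (List.finRange (X.k - 2)).map GA.psi))))))

theorem mem_arcList (o : X.GA) : o ∈ X.arcList := by
  cases o <;> simp [arcList]
  case qf l f => exact ⟨_, _, rfl⟩
  case tf f => exact ⟨_, _, rfl⟩
  case ss φ => rcases φ with ⟨i, j⟩ | ⟨a, _ | _⟩ | j <;> simp
  case st φ => rcases φ with ⟨i, j⟩ | ⟨a, _ | _⟩ | j <;> simp
  case wg a b => cases b <;> simp

theorem nodup_flatMap_of {α β : Type*} {s : List α} {f : α → List β} (hs : s.Nodup)
    (h1 : ∀ x, (f x).Nodup) (h2 : ∀ x y o, o ∈ f x → o ∈ f y → x = y) : (s.flatMap f).Nodup :=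
  List.nodup_flatMap.2 ⟨fun x _ => h1 x, hs.imp fun hab o ho ho' => hab (h2 _ _ o ho ho')⟩

variable {X} in
/-- The block of the list of arcs to which an arc belongs. -/
def block : X.GA → ℕ
  | .zin => 0
  | .sp _ | .e _ | .ch _ | .qt _ => 1
  | .qs _ => 2
  | .tf _ | .qf _ _ => 3
  | .qv _ _ => 4
  | .inn _ | .mid _ | .out _ | .sv _ | .wt _ | .wg _ _ => 5
  | .po _ => 6
  | .psi _ => 7
  | .ss (.inl _) | .st (.inl _) => 3
  | .ss (.inr (.inl _)) | .st (.inr (.inl _)) => 5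
  | .ss (.inr (.inr _)) | .st (.inr (.inr _)) => 6

-- Segments of the arc list carry increasing block numbers, so their disjointness reduces to
-- comparing numbers.
variable {X} in
theorem nodup_append_of_block {l₁ l₂ : List X.GA} (i : ℕ) (h₁ : l₁.Nodup) (h₂ : l₂.Nodup)
    (h₃ : ∀ o ∈ l₁, block o = i) (h₄ : ∀ o ∈ l₂, i < block o) : (l₁ ++ l₂).Nodup :=
  List.nodup_append'.2 ⟨h₁, h₂, fun o ho ho' => (h₄ o ho').ne' (h₃ o ho)⟩

theorem nodup_arcList : X.arcList.Nodup := by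
  refine List.nodup_cons.2 ⟨by simp, ?_⟩
  refine nodup_append_of_block 1 ?_ (nodup_append_of_block 2 ?_ (nodup_append_of_block 3 ?_
    (nodup_append_of_block 4 ?_ (nodup_append_of_block 5 ?_ (nodup_append_of_block 6 ?_ ?_ ?_ ?_)
    ?_ ?_) ?_ ?_) ?_ ?_) ?_ ?_) ?_ ?_
  · exact nodup_flatMap_of (List.nodup_finRange _) (by simp) (by simp)
  · exact (List.nodup_finRange _).map fun a b h => by simpa using h
  · refine nodup_flatMap_of (List.nodup_finRange _) (fun i => ?_) ?_
    · refine nodup_flatMap_of (List.nodup_finRange _) (fun j => ?_) ?_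
      · refine List.nodup_append'.2 ⟨by simp, ?_, ?_⟩
        · exact (List.nodup_finRange _).map fun a b h => by simpa using h
        · rintro o h1 h2
          simp at h1 h2
          grind
      · simp
    · simp; grind
  · refine nodup_flatMap_of (List.nodup_finRange _) (fun l => ?_) ?_
    · exact (List.nodup_finRange _).map fun a b h => by simpa using h
    · simp
  · exact nodup_flatMap_of (List.nodup_finRange _) (by simp) (by simp)
  · exact nodup_flatMap_of (List.nodup_finRange _) (by simp) (by simp)
  · exact (List.nodup_finRange _).map fun a b h => by simpa using h
  all_goals
    simp only [List.forall_mem_append, List.forall_mem_flatMap, List.forall_mem_map,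
      List.forall_mem_cons, block]
    simp

/-- The single-commodity network. -/
def network : Network where
  numV := X.numNodes
  numA := X.arcList.length
  tail a := ⟨nodeIndex (gtl X.arcList[a]), nodeIndex_lt _⟩
  head a := ⟨nodeIndex (ghd X.arcList[a]), nodeIndex_lt _⟩
  cap a := (gcap X.arcList[a] : ℕ)

/-- The single-commodity instance. -/
def single : MRFInstance where
  toNetwork := X.network
  source := ⟨nodeIndex (.s : X.GV), nodeIndex_lt _⟩
  sink := ⟨nodeIndex (.t : X.GV), nodeIndex_lt _⟩
  source_ne_sink h := by
    have := congrArg Fin.val h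
    simp [nodeIndex] at this
  budget := X.k
  target := (X.target : ℕ)

/-- Code of an arc. -/
def arcCode (o : X.GA) : List ℕ := [nodeIndex (gtl o), nodeIndex (ghd o), gcap o, 1]

/-- The form in which the program produces its output: a head line, the nodes, and the codes of the
arcs in the order of `arcList`. -/
theorem encode_single : X.single.encode = [X.numNodes, X.arcList.length, X.nV, X.nV + 1, X.k,
    X.target, 1] ++ List.range X.numNodes ++ X.arcList.flatMap X.arcCode := by
  have h : X.single.encodeArcs = X.arcList.flatMap X.arcCode := by
    have : X.arcList = (List.finRange X.arcList.length).map fun a => X.arcList[a] := by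
      simp
    conv_rhs => rw [this, List.flatMap_map]
    simp [Network.encodeArcs, single, network, arcCode]
  rw [MRFInstance.encode, h]
  simp [single, network, nodeIndex]

variable {X}

/-- The numbering of the arcs. -/
noncomputable def arcEquiv : Fin X.arcList.length ≃ X.GA :=
  Equiv.ofBijective (fun a => X.arcList[a]) ⟨fun a b h => Fin.ext
    ((X.nodup_arcList.getElem_inj_iff).1 h), fun o => by
      obtain ⟨i, hi, e⟩ := List.mem_iff_getElem.1 (X.mem_arcList o)
      exact ⟨⟨i, hi⟩, e⟩⟩

/-- The numbering of the nodes. -/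
def node (v : X.GV) : Fin X.network.numV := ⟨nodeIndex v, nodeIndex_lt v⟩

theorem node_injective : Function.Injective (node (X := X)) := fun _ _ h =>
  nodeIndex_injective (congrArg Fin.val h)

theorem simplePath_iff {l : List X.GA} : SimplePath gtl ghd (.s : X.GV) l .t ↔
    SimplePath X.network.tail X.network.head X.single.source (l.map arcEquiv.symm)
      X.single.sink := by
  have ht : ∀ o, X.network.tail (arcEquiv.symm o) = node (gtl o) := fun o => by
    conv_rhs => rw [← arcEquiv.apply_symm_apply o]
    rfl
  have hh : ∀ o, X.network.head (arcEquiv.symm o) = node (ghd o) := fun o => by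
    conv_rhs => rw [← arcEquiv.apply_symm_apply o]
    rfl
  exact (SimplePath.map_iff node_injective ht hh).symm

theorem family_iff_of_equiv {J : MRFInstance} (E : Fin J.numA ≃ X.GA)
    (hpath : ∀ l : List X.GA, SimplePath gtl ghd (.s : X.GV) l .t ↔
      SimplePath J.tail J.head J.source (l.map E.symm) J.sink)
    (hcap : ∀ a, J.cap a = (gcap (E a) : ℕ)) (hb : J.budget = X.k) (ht : J.target = (X.target : ℕ))
    {N : ℕ} : J.FamilyYes N ↔ X.SingleYes N := by
  classical
  constructor
  · rintro ⟨ι, _, c, h1, h2, h3⟩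
    choose l hl hlc using fun y => mem_paths_iff.1 (h1 y)
    have hmem : ∀ y o, o ∈ (l y).map E ↔ E.symm o ∈ c y := by
      intro y o
      rw [← hlc, List.mem_toFinset, List.mem_map]
      constructor
      · rintro ⟨a, ha, rfl⟩
        rwa [E.symm_apply_apply]
      · exact fun h => ⟨_, h, E.apply_symm_apply o⟩
    refine ⟨ι, inferInstance, fun y => (l y).map E, fun y => ?_, fun o => ?_, fun S hS => ?_⟩
    · rw [hpath]
      simpa using hl y
    · have := h2 (E.symm o)
      rw [hcap, E.apply_symm_apply] at this
      rw [cnt_congr fun y => hmem y o]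
      exact_mod_cast this
    · have := h3 (S.map E.symm.toEmbedding) (by rw [Finset.card_map, hb]; exact hS)
      rw [ht] at this
      rw [cnt_congr (q := fun y => c y ∩ S.map E.symm.toEmbedding = ∅)]
      · exact_mod_cast this
      · intro y
        rw [← Finset.disjoint_iff_inter_eq_empty, Finset.disjoint_right]
        simp only [hmem]
        constructor
        · intro h a ha
          obtain ⟨o, ho, rfl⟩ := Finset.mem_map.1 ha
          exact fun h' => h o h' ho
        · exact fun h o ho hS => h (Finset.mem_map_of_mem _ hS) ho
  · rintro ⟨ι, _, l, h1, h2, h3⟩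
    have hmem : ∀ y a, a ∈ ((l y).map E.symm).toFinset ↔ E a ∈ l y := by
      intro y a
      rw [List.mem_toFinset, List.mem_map]
      constructor
      · rintro ⟨o, ho, rfl⟩
        rwa [E.apply_symm_apply]
      · exact fun h => ⟨_, h, E.symm_apply_apply a⟩
    refine ⟨ι, inferInstance, fun y => ((l y).map E.symm).toFinset,
      fun y => mem_paths_iff.2 ⟨_, (hpath _).1 (h1 y), rfl⟩, fun a => ?_, fun S hS => ?_⟩
    · have := h2 (E a)
      rw [hcap, cnt_congr (q := fun y => E a ∈ l y) fun y => hmem y a]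
      exact_mod_cast this
    · have := h3 (S.map E.toEmbedding) (by rw [Finset.card_map, ← hb]; exact hS)
      rw [ht, cnt_congr (q := fun y => ∀ o ∈ l y, o ∉ S.map E.toEmbedding)]
      · exact_mod_cast this
      · intro y
        rw [← Finset.disjoint_iff_inter_eq_empty, Finset.disjoint_right]
        constructor
        · intro h o ho hS
          obtain ⟨a, ha, rfl⟩ := Finset.mem_map.1 hS
          exact h ha ((hmem y a).2 ho)
        · exact fun h a ha h' => h _ ((hmem y a).1 h') (Finset.mem_map_of_mem _ ha)

theorem family_iff_singleYes {N : ℕ} : X.single.FamilyYes N ↔ X.SingleYes N :=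
  family_iff_of_equiv (J := X.single) arcEquiv (fun _ => simplePath_iff) (fun _ => rfl) rfl rfl

end Data
end RobustFlow

/-! ## A structured language with bounded loops -/

namespace RAM

/-- Expressions. The variable `x` is the entry number `x` of an environment; `iter b z s` starts
with the value of `z` and replaces it as many times as `b` says by the value of `s`, for which the
environment is extended by the current value and the number of the iteration. -/
inductive Expr : Type
  | lit (n : ℕ)
  | var (x : ℕ)
  | add (a b : Expr)
  | sub (a b : Expr)
  | load (a : Expr)
  | ite (c a b : Expr)
  | iter (b z s : Expr)

namespace Expr

/-- The value of an expression. -/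
def eval (mem : ℕ → ℕ) : Expr → List ℕ → ℕ
  | lit n, _ => n
  | var x, ρ => ρ.getD x 0
  | add a b, ρ => a.eval mem ρ + b.eval mem ρ
  | sub a b, ρ => a.eval mem ρ - b.eval mem ρ
  | load a, ρ => mem (a.eval mem ρ)
  | ite c a b, ρ => if c.eval mem ρ ≠ 0 then a.eval mem ρ else b.eval mem ρ
  | iter b z s, ρ =>
    Nat.rec (z.eval mem ρ) (fun v acc => s.eval mem (ρ ++ [acc, v])) (b.eval mem ρ)

/-- The value of an iteration after some number of rounds. -/
def iterate (mem : ℕ → ℕ) (z s : Expr) (ρ : List ℕ) (n : ℕ) : ℕ :=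
  Nat.rec (z.eval mem ρ) (fun v acc => s.eval mem (ρ ++ [acc, v])) n

/-- All loops that are met in the evaluation have at most `Z` rounds. -/
def Bounded (mem : ℕ → ℕ) (Z : ℕ) : Expr → List ℕ → Prop
  | lit _, _ => True
  | var _, _ => True
  | add a b, ρ => a.Bounded mem Z ρ ∧ b.Bounded mem Z ρ
  | sub a b, ρ => a.Bounded mem Z ρ ∧ b.Bounded mem Z ρ
  | load a, ρ => a.Bounded mem Z ρ
  | ite c a b, ρ => c.Bounded mem Z ρ ∧ a.Bounded mem Z ρ ∧ b.Bounded mem Z ρ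
  | iter b z s, ρ => b.Bounded mem Z ρ ∧ z.Bounded mem Z ρ ∧ b.eval mem ρ ≤ Z ∧
    ∀ v < b.eval mem ρ, s.Bounded mem Z (ρ ++ [iterate mem z s ρ v, v])

/-- A bound on the running time in terms of a bound on the number of rounds of each loop. -/
noncomputable def time : Expr → Polynomial ℕ
  | lit _ => 1
  | var _ => 2
  | add a b => a.time + b.time + 1
  | sub a b => a.time + b.time + 1
  | load a => a.time + 1
  | ite c a b => c.time + a.time + b.time + 1
  | iter b z s => b.time + z.time + 3 + Polynomial.X * (s.time + 5)

/-- The program that evaluates an expression. The entries of the environment are found in the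
registers listed in `ℓ`; the registers from `t` on are free, and the first of them receives the
value. -/
def compile : Expr → List ℕ → ℕ → Cmd
  | lit n, _, t => .const t n
  -- There is no copy instruction: the target register is cleared and the source is added. A
  -- variable outside the environment has value zero.
  | var x, ℓ, t => if x < ℓ.length then .seq (.const t 0) (.add t (ℓ.getD x 0) t) else .const t 0
  | add a b, ℓ, t => .seq (a.compile ℓ t) (.seq (b.compile ℓ (t + 1)) (.add t t (t + 1)))
  | sub a b, ℓ, t => .seq (a.compile ℓ t) (.seq (b.compile ℓ (t + 1)) (.sub t t (t + 1)))
  | load a, ℓ, t => .seq (a.compile ℓ t) (.load t t)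
  | ite c a b, ℓ, t => .seq (c.compile ℓ t) (.branch t (a.compile ℓ t) (b.compile ℓ t))
  | iter b z s, ℓ, t =>
    .seq (z.compile ℓ t) (.seq (.const (t + 1) 0) (.seq (b.compile ℓ (t + 2))
      (.seq (.const (t + 3) 1) (.loop (t + 2) (.seq (s.compile (ℓ ++ [t, t + 1]) (t + 4))
        (.seq (.const (t + 5) 0) (.seq (.add t (t + 4) (t + 5))
          (.seq (.add (t + 1) (t + 1) (t + 3)) (.sub (t + 2) (t + 2) (t + 3))))))))))

end Expr

/-- The environment is found in the given registers, all of which are below `t`. -/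
def Located (σ : State) (ℓ : List ℕ) (t : ℕ) (ρ : List ℕ) : Prop :=
  ℓ.map σ.reg = ρ ∧ ∀ x ∈ ℓ, x < t

/-- Memory, output and the registers below `t` are unchanged. -/
def Same (t : ℕ) (σ τ : State) : Prop :=
  (∀ x < t, τ.reg x = σ.reg x) ∧ τ.mem = σ.mem

theorem Same.trans {t : ℕ} {σ τ υ : State} (h : Same t σ τ) (h' : Same t τ υ) : Same t σ υ :=
  ⟨fun x hx => (h'.1 x hx).trans (h.1 x hx), h'.2.trans h.2⟩

theorem Same.mono {t t' : ℕ} {σ τ : State} (h : Same t' σ τ) (ht : t ≤ t') : Same t σ τ :=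
  ⟨fun x hx => h.1 x (hx.trans_le ht), h.2⟩

theorem Same.setReg {t x v : ℕ} {σ : State} (h : t ≤ x) : Same t σ (σ.setReg x v) :=
  ⟨fun y hy => Function.update_of_ne (by omega) _ _, rfl⟩

theorem Located.same {σ τ : State} {ℓ ρ : List ℕ} {t : ℕ} (h : Located σ ℓ t ρ)
    (hs : Same t σ τ) : Located τ ℓ t ρ :=
  ⟨by rw [← h.1]; exact List.map_congr_left fun x hx => hs.1 x (h.2 x hx), h.2⟩

theorem Located.mono {σ : State} {ℓ ρ : List ℕ} {t t' : ℕ} (h : Located σ ℓ t ρ)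
    (ht : t ≤ t') : Located σ ℓ t' ρ :=
  ⟨h.1, fun x hx => (h.2 x hx).trans_le ht⟩

theorem Located.snoc {σ : State} {ℓ ρ : List ℕ} {t : ℕ} (h : Located σ ℓ t ρ) :
    Located σ (ℓ ++ [t]) (t + 1) (ρ ++ [σ.reg t]) :=
  ⟨by simp [h.1], fun x hx => by
    rcases List.mem_append.1 hx with hx | hx
    · exact (h.2 x hx).trans (Nat.lt_succ_self t)
    · rw [List.mem_singleton.1 hx]; exact Nat.lt_succ_self t⟩

@[simp] theorem setReg_self (σ : State) (x v : ℕ) : (σ.setReg x v).reg x = v :=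
  Function.update_self ..

theorem setReg_ne (σ : State) {x y : ℕ} (v : ℕ) (h : y ≠ x) : (σ.setReg x v).reg y = σ.reg y :=
  Function.update_of_ne h ..

@[simp] theorem setReg_out (σ : State) (x v : ℕ) : (σ.setReg x v).out = σ.out := rfl

@[simp] theorem setReg_mem (σ : State) (x v : ℕ) : (σ.setReg x v).mem = σ.mem := rfl

/-- The invariant is that the environment lives in registers below `t` and the code writes only to
registers from `t` on. Hence subexpressions can be evaluated one after another without disturbing
earlier results. -/
theorem Expr.compile_spec (mem : ℕ → ℕ) (Z : ℕ) (e : Expr) : ∀ (ρ : List ℕ), e.Bounded mem Z ρ →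
    ∀ (σ : State) (ℓ : List ℕ) (t : ℕ), σ.mem = mem → Located σ ℓ t ρ →
    ∃ n τ, Exec (e.compile ℓ t) σ n τ ∧ n ≤ e.time.eval Z ∧ τ.reg t = e.eval mem ρ ∧
      Same t σ τ ∧ τ.out = σ.out := by
  induction e with
  | lit n =>
    intro ρ _ σ ℓ t _ _
    exact ⟨_, _, .const .., by simp [time], by simp [eval], Same.setReg le_rfl, rfl⟩
  | var x =>
    intro ρ _ σ ℓ t _ hℓ
    unfold compile
    split_ifs with hx
    · have hx' : ℓ.getD x 0 < t := by
        rw [List.getD_eq_getElem _ _ hx]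
        exact hℓ.2 _ (List.getElem_mem hx)
      refine ⟨_, _, .seq (.const ..) (.add ..), by simp [time], ?_,
        (Same.setReg le_rfl).trans (Same.setReg le_rfl), rfl⟩
      rw [setReg_self, setReg_self, setReg_ne _ _ hx'.ne, add_zero, eval, ← hℓ.1]
      simp [hx]
    · refine ⟨_, _, .const .., by simp [time], ?_, Same.setReg le_rfl, rfl⟩
      rw [setReg_self, eval, ← hℓ.1, List.getD_eq_default]
      simpa using hx
  | add a b iha ihb =>
    intro ρ hb σ ℓ t hm hℓ
    obtain ⟨n₁, τ₁, h₁, c₁, v₁, s₁, o₁⟩ := iha ρ hb.1 σ ℓ t hm hℓ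
    obtain ⟨n₂, τ₂, h₂, c₂, v₂, s₂, o₂⟩ := ihb ρ hb.2 τ₁ ℓ (t + 1) (s₁.2.trans hm)
      ((hℓ.same s₁).mono (Nat.le_succ t))
    refine ⟨_, _, .seq h₁ (.seq h₂ (.add ..)), by simp [time]; omega, ?_,
      (s₁.trans (s₂.mono (Nat.le_succ t))).trans (Same.setReg le_rfl), o₂.trans o₁⟩
    rw [setReg_self, v₂, s₂.1 t (Nat.lt_succ_self t), v₁, eval]
  | sub a b iha ihb =>
    intro ρ hb σ ℓ t hm hℓ
    obtain ⟨n₁, τ₁, h₁, c₁, v₁, s₁, o₁⟩ := iha ρ hb.1 σ ℓ t hm hℓ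
    obtain ⟨n₂, τ₂, h₂, c₂, v₂, s₂, o₂⟩ := ihb ρ hb.2 τ₁ ℓ (t + 1) (s₁.2.trans hm)
      ((hℓ.same s₁).mono (Nat.le_succ t))
    refine ⟨_, _, .seq h₁ (.seq h₂ (.sub ..)), by simp [time]; omega, ?_,
      (s₁.trans (s₂.mono (Nat.le_succ t))).trans (Same.setReg le_rfl), o₂.trans o₁⟩
    rw [setReg_self, v₂, s₂.1 t (Nat.lt_succ_self t), v₁, eval]
  | load a iha =>
    intro ρ hb σ ℓ t hm hℓ
    obtain ⟨n₁, τ₁, h₁, c₁, v₁, s₁, o₁⟩ := iha ρ hb σ ℓ t hm hℓ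
    refine ⟨_, _, .seq h₁ (.load ..), by simp [time]; omega, ?_,
      s₁.trans (Same.setReg le_rfl), o₁⟩
    rw [setReg_self, v₁, s₁.2, hm, eval]
  | ite c a b ihc iha ihb =>
    intro ρ hb σ ℓ t hm hℓ
    obtain ⟨n₁, τ₁, h₁, c₁, v₁, s₁, o₁⟩ := ihc ρ hb.1 σ ℓ t hm hℓ
    by_cases hc : c.eval mem ρ ≠ 0
    · obtain ⟨n₂, τ₂, h₂, c₂, v₂, s₂, o₂⟩ := iha ρ hb.2.1 τ₁ ℓ t (s₁.2.trans hm) (hℓ.same s₁)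
      refine ⟨_, _, .seq h₁ (.branch_pos (v₁ ▸ hc) h₂), by simp [time]; omega, ?_,
        s₁.trans s₂, o₂.trans o₁⟩
      rw [v₂, eval, if_pos hc]
    · obtain ⟨n₂, τ₂, h₂, c₂, v₂, s₂, o₂⟩ := ihb ρ hb.2.2 τ₁ ℓ t (s₁.2.trans hm) (hℓ.same s₁)
      refine ⟨_, _, .seq h₁ (.branch_zero (v₁.trans (not_not.1 hc)) h₂), by simp [time]; omega, ?_,
        s₁.trans s₂, o₂.trans o₁⟩
      rw [v₂, eval, if_neg hc]
  | iter b z s ihb ihz ihs =>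
    intro ρ hb σ ℓ t hm hℓ
    obtain ⟨hb₁, hb₂, hZ, hb₃⟩ := hb
    obtain ⟨n₁, τ₁, h₁, c₁, v₁, s₁, o₁⟩ := ihz ρ hb₂ σ ℓ t hm hℓ
    set τ₂ := τ₁.setReg (t + 1) 0 with hτ₂
    have s₂ : Same t σ τ₂ := s₁.trans (Same.setReg (Nat.le_succ t))
    obtain ⟨n₃, τ₃, h₃, c₃, v₃, s₃, o₃⟩ := ihb ρ hb₁ τ₂ ℓ (t + 2) (s₂.2.trans hm)
      ((hℓ.same s₂).mono (by omega))
    -- In the loop, register `t` holds the current value, `t + 1` the number of the round, `t + 2`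
    -- the rounds left and `t + 3` the constant one; the induction is on the rounds left.
    have key : ∀ m v (υ : State), v + m = b.eval mem ρ → Same t σ υ → υ.out = σ.out →
        υ.reg t = iterate mem z s ρ v → υ.reg (t + 1) = v → υ.reg (t + 2) = m →
        υ.reg (t + 3) = 1 → ∃ n τ, Exec (.loop (t + 2) (.seq (s.compile (ℓ ++ [t, t + 1]) (t + 4))
        (.seq (.const (t + 5) 0) (.seq (.add t (t + 4) (t + 5))
          (.seq (.add (t + 1) (t + 1) (t + 3)) (.sub (t + 2) (t + 2) (t + 3))))))) υ n τ ∧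
        n ≤ 1 + m * (s.time.eval Z + 5) ∧ τ.reg t = iterate mem z s ρ (b.eval mem ρ) ∧
        Same t σ τ ∧ τ.out = σ.out := by
      intro m
      induction m with
      | zero =>
        intro v υ hv hs ho h0 h1 h2 h3
        exact ⟨_, _, .loop_zero h2, by omega, by rw [h0, ← hv, add_zero], hs, ho⟩
      | succ m ih =>
        intro v υ hv hs ho h0 h1 h2 h3
        have hloc : Located υ (ℓ ++ [t, t + 1]) (t + 4) (ρ ++ [iterate mem z s ρ v, v]) := by
          have := ((hℓ.same hs).snoc.snoc).mono (show t + 1 + 1 ≤ t + 4 by omega)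
          rw [List.append_assoc, List.append_assoc, h0, h1] at this
          exact this
        obtain ⟨n, τ, e, c, w, ss, oo⟩ := ihs _ (hb₃ v (by omega)) υ _ _ (hs.2.trans hm) hloc
        have r1 := ss.1 (t + 1) (by omega)
        have r2 := ss.1 (t + 2) (by omega)
        have r3 := ss.1 (t + 3) (by omega)
        obtain ⟨υ', e', hsame, ho', g0, g1, g2, g3⟩ : ∃ υ', Exec (.seq (.const (t + 5) 0)
            (.seq (.add t (t + 4) (t + 5)) (.seq (.add (t + 1) (t + 1) (t + 3))
              (.sub (t + 2) (t + 2) (t + 3))))) τ 4 υ' ∧ Same t τ υ' ∧ υ'.out = τ.out ∧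
            υ'.reg t = τ.reg (t + 4) ∧ υ'.reg (t + 1) = τ.reg (t + 1) + τ.reg (t + 3) ∧
            υ'.reg (t + 2) = τ.reg (t + 2) - τ.reg (t + 3) ∧ υ'.reg (t + 3) = τ.reg (t + 3) := by
          refine ⟨_, .seq (.const ..) (.seq (.add ..) (.seq (.add ..) (.sub ..))),
            (((Same.setReg ?_).trans (Same.setReg ?_)).trans (Same.setReg ?_)).trans
            (Same.setReg ?_), rfl, ?_, ?_, ?_, ?_⟩
          all_goals first | omega | simp [State.setReg]
        obtain ⟨n', τ', e'', c'', w'', ss'', oo''⟩ := ih (v + 1) υ' (by omega)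
          (hs.trans ((ss.mono (by omega)).trans hsame)) (ho'.trans (oo.trans ho))
          (g0.trans w) (by omega) (by omega) (by omega)
        refine ⟨_, _, .loop_pos (by omega) (e.seq e') e'', ?_, w'', ss'', oo''⟩
        rw [add_mul, one_mul]
        omega
    have s₃' : Same t σ (τ₃.setReg (t + 3) 1) :=
      (s₂.trans (s₃.mono (by omega))).trans (Same.setReg (by omega))
    obtain ⟨n₄, τ₄, h₄, c₄, v₄, s₄, o₄⟩ := key (b.eval mem ρ) 0 (τ₃.setReg (t + 3) 1) (Nat.zero_add _) s₃'
      (o₃.trans o₁)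
      (by
        rw [setReg_ne _ _ (by omega), s₃.1 t (by omega), setReg_ne _ _ (by omega), v₁]
        rfl)
      (by rw [setReg_ne _ _ (by omega), s₃.1 (t + 1) (by omega), setReg_self])
      (by rw [setReg_ne _ _ (by omega), v₃]) (by rw [setReg_self])
    refine ⟨_, _, .seq h₁ (.seq (.const ..) (.seq h₃ (.seq (.const ..) h₄))), ?_, v₄, s₄, o₄⟩
    have : b.eval mem ρ * (s.time.eval Z + 5) ≤ Z * (s.time.eval Z + 5) :=
      Nat.mul_le_mul_right _ hZ
    simp [time]
    omega

/-- Programs that only produce output. -/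
inductive Prog : Type
  | nil
  | emit (e : Expr)
  | seq (p q : Prog)
  | bind (e : Expr) (p : Prog)
  | rep (b : Expr) (p : Prog)

namespace Prog

/-- The output of a program. -/
def run (mem : ℕ → ℕ) : Prog → List ℕ → List ℕ
  | nil, _ => []
  | emit e, ρ => [e.eval mem ρ]
  | seq p q, ρ => p.run mem ρ ++ q.run mem ρ
  | bind e p, ρ => p.run mem (ρ ++ [e.eval mem ρ])
  | rep b p, ρ => (List.range (b.eval mem ρ)).flatMap fun v => p.run mem (ρ ++ [v])

/-- All loops that are met have at most `Z` rounds. -/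
def Bounded (mem : ℕ → ℕ) (Z : ℕ) : Prog → List ℕ → Prop
  | nil, _ => True
  | emit e, ρ => e.Bounded mem Z ρ
  | seq p q, ρ => p.Bounded mem Z ρ ∧ q.Bounded mem Z ρ
  | bind e p, ρ => e.Bounded mem Z ρ ∧ p.Bounded mem Z (ρ ++ [e.eval mem ρ])
  | rep b p, ρ => b.Bounded mem Z ρ ∧ b.eval mem ρ ≤ Z ∧
    ∀ v < b.eval mem ρ, p.Bounded mem Z (ρ ++ [v])

/-- A bound on the running time in terms of a bound on the number of rounds of each loop. -/
noncomputable def time : Prog → Polynomial ℕ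
  | nil => 1
  | emit e => e.time + 1
  | seq p q => p.time + q.time
  | bind e p => e.time + p.time
  | rep b p => b.time + 3 + Polynomial.X * (p.time + 3)

/-- Translation to the random access machine. -/
def compile : Prog → List ℕ → ℕ → Cmd
  | nil, _, _ => .skip
  | emit e, ℓ, t => .seq (e.compile ℓ t) (.emit t)
  | seq p q, ℓ, t => .seq (p.compile ℓ t) (q.compile ℓ t)
  | bind e p, ℓ, t => .seq (e.compile ℓ t) (p.compile (ℓ ++ [t]) (t + 1))
  | rep b p, ℓ, t =>
    .seq (.const t 0) (.seq (b.compile ℓ (t + 1)) (.seq (.const (t + 2) 1)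
      (.loop (t + 1) (.seq (p.compile (ℓ ++ [t]) (t + 3))
        (.seq (.add t t (t + 2)) (.sub (t + 1) (t + 1) (t + 2)))))))

theorem compile_spec (mem : ℕ → ℕ) (Z : ℕ) (p : Prog) : ∀ (ρ : List ℕ), p.Bounded mem Z ρ →
    ∀ (σ : State) (ℓ : List ℕ) (t : ℕ), σ.mem = mem → Located σ ℓ t ρ →
    ∃ n τ, Exec (p.compile ℓ t) σ n τ ∧ n ≤ p.time.eval Z ∧
      Same t σ τ ∧ τ.out = σ.out ++ p.run mem ρ := by
  induction p with
  | nil =>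
    intro ρ _ σ ℓ t _ _
    exact ⟨_, _, .skip _, by simp [time], ⟨fun _ _ => rfl, rfl⟩, by simp [run]⟩
  | emit e =>
    intro ρ hb σ ℓ t hm hℓ
    obtain ⟨n₁, τ₁, h₁, c₁, v₁, s₁, o₁⟩ := e.compile_spec mem Z ρ hb σ ℓ t hm hℓ
    exact ⟨_, _, .seq h₁ (.emit ..), by simp [time]; omega, ⟨s₁.1, s₁.2⟩, by simp [run, o₁, v₁]⟩
  | seq p q ihp ihq =>
    intro ρ hb σ ℓ t hm hℓ
    obtain ⟨n₁, τ₁, h₁, c₁, s₁, o₁⟩ := ihp ρ hb.1 σ ℓ t hm hℓ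
    obtain ⟨n₂, τ₂, h₂, c₂, s₂, o₂⟩ := ihq ρ hb.2 τ₁ ℓ t (s₁.2.trans hm) (hℓ.same s₁)
    exact ⟨_, _, .seq h₁ h₂, by simp [time]; omega, s₁.trans s₂, by simp [run, o₁, o₂]⟩
  | bind e p ihp =>
    intro ρ hb σ ℓ t hm hℓ
    obtain ⟨n₁, τ₁, h₁, c₁, v₁, s₁, o₁⟩ := e.compile_spec mem Z ρ hb.1 σ ℓ t hm hℓ
    obtain ⟨n₂, τ₂, h₂, c₂, s₂, o₂⟩ := ihp _ hb.2 τ₁ _ _ (s₁.2.trans hm)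
      (v₁ ▸ (hℓ.same s₁).snoc)
    exact ⟨_, _, .seq h₁ h₂, by simp [time]; omega, s₁.trans (s₂.mono (Nat.le_succ t)),
      by simp [run, o₁, o₂]⟩
  | rep b p ihp =>
    intro ρ hb σ ℓ t hm hℓ
    obtain ⟨hb₁, hZ, hb₃⟩ := hb
    set τ₁ := σ.setReg t 0 with hτ₁
    have s₁ : Same t σ τ₁ := Same.setReg le_rfl
    obtain ⟨n₂, τ₂, h₂, c₂, v₂, s₂, o₂⟩ := b.compile_spec mem Z ρ hb₁ τ₁ ℓ (t + 1)
      (s₁.2.trans hm) ((hℓ.same s₁).mono (by omega))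
    have key : ∀ m v (υ : State), v + m = b.eval mem ρ → Same t σ υ →
        υ.out = σ.out ++ (List.range v).flatMap (fun v => p.run mem (ρ ++ [v])) →
        υ.reg t = v → υ.reg (t + 1) = m → υ.reg (t + 2) = 1 →
        ∃ n τ, Exec (.loop (t + 1) (.seq (p.compile (ℓ ++ [t]) (t + 3))
          (.seq (.add t t (t + 2)) (.sub (t + 1) (t + 1) (t + 2))))) υ n τ ∧
        n ≤ 1 + m * (p.time.eval Z + 3) ∧ Same t σ τ ∧ τ.out = σ.out ++
          (List.range (b.eval mem ρ)).flatMap (fun v => p.run mem (ρ ++ [v])) := by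
      intro m
      induction m with
      | zero =>
        intro v υ hv hs ho h0 h1 h2
        exact ⟨_, _, .loop_zero h1, by omega, hs, by rw [ho, ← hv, add_zero]⟩
      | succ m ih =>
        intro v υ hv hs ho h0 h1 h2
        have hloc : Located υ (ℓ ++ [t]) (t + 3) (ρ ++ [v]) := by
          have := (hℓ.same hs).snoc.mono (show t + 1 ≤ t + 3 by omega)
          rwa [h0] at this
        obtain ⟨n, τ, e, c, ss, oo⟩ := ihp _ (hb₃ v (by omega)) υ _ _ (hs.2.trans hm) hloc
        have r0 := ss.1 t (by omega)
        have r1 := ss.1 (t + 1) (by omega)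
        have r2 := ss.1 (t + 2) (by omega)
        obtain ⟨υ', e', hsame, ho', g0, g1, g2⟩ : ∃ υ', Exec (.seq (.add t t (t + 2))
            (.sub (t + 1) (t + 1) (t + 2))) τ 2 υ' ∧ Same t τ υ' ∧ υ'.out = τ.out ∧
            υ'.reg t = τ.reg t + τ.reg (t + 2) ∧ υ'.reg (t + 1) = τ.reg (t + 1) - τ.reg (t + 2) ∧
            υ'.reg (t + 2) = τ.reg (t + 2) := by
          refine ⟨_, .seq (.add ..) (.sub ..),
            (Same.setReg ?_).trans (Same.setReg ?_), rfl, ?_, ?_, ?_⟩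
          all_goals first | omega | simp [State.setReg]
        obtain ⟨n', τ', e'', c'', ss'', oo''⟩ := ih (v + 1) υ' (by omega)
          (hs.trans ((ss.mono (by omega)).trans hsame))
          (by
            rw [ho', oo, ho, List.range_succ, List.flatMap_append, List.append_assoc]
            simp)
          (by omega) (by omega) (by omega)
        refine ⟨_, _, .loop_pos (by omega) (e.seq e') e'', ?_, ss'', oo''⟩
        rw [add_mul, one_mul]
        omega
    have s₃ : Same t σ (τ₂.setReg (t + 2) 1) :=
      (s₁.trans (s₂.mono (by omega))).trans (Same.setReg (by omega))
    obtain ⟨n₄, τ₄, h₄, c₄, s₄, o₄⟩ := key (b.eval mem ρ) 0 (τ₂.setReg (t + 2) 1) (Nat.zero_add _) s₃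
      (by simp [o₂, hτ₁])
      (by rw [setReg_ne _ _ (by omega), s₂.1 t (by omega), setReg_self])
      (by rw [setReg_ne _ _ (by omega), v₂]) (by rw [setReg_self])
    refine ⟨_, _, .seq (.const ..) (.seq h₂ (.seq (.const ..) h₄)), ?_, s₄, o₄⟩
    have : b.eval mem ρ * (p.time.eval Z + 3) ≤ Z * (p.time.eval Z + 3) :=
      Nat.mul_le_mul_right _ hZ
    simp [time]
    omega

end Prog

/-- A function is computable in polynomial time if some program with bounded loops computes it,
and the number of rounds of each loop is bounded by a polynomial. -/
theorem PolyTimeOn.of_prog {α β : Type} {C : α → Prop} {encA : α → List ℕ} {encB : β → List ℕ}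
    {f : α → β} (p : Prog) (Z : Polynomial ℕ)
    (h : ∀ a, C a → p.run (fun i => (encA a).getD i 0) [] = encB (f a) ∧
      p.Bounded (fun i => (encA a).getD i 0) (Z.eval (bitSize (encA a))) []) :
    PolyTimeOn C encA encB f := by
  refine ⟨p.compile [] 0, p.time.comp Z, fun a ha => ?_⟩
  obtain ⟨h₁, h₂⟩ := h a ha
  obtain ⟨n, τ, e, c, -, o⟩ := p.compile_spec _ _ [] h₂ (State.initial (encA a)) [] 0 rfl
    ⟨rfl, by simp⟩
  refine ⟨n, τ, e, ?_, by rwa [Polynomial.eval_comp]⟩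
  rw [o, h₁]
  rfl

end RAM

namespace RobustFlow
namespace Reduction

open RAM RAM.Expr

/-! ### The program -/

/-- Four times a number. -/
def four (e : Expr) : Expr := add (add e e) (add e e)

/-- Data of commodity number `i`: source, sink, demand for `c = 0, 1, 2`. -/
def comE (i c : ℕ) : Expr := load (add (add (var 5) (four (var i))) (lit c))

/-- Data of arc number `a`: tail, head, capacity for `c = 0, 1, 2`. -/
def arcE (a c : ℕ) : Expr := load (add (add (var 4) (four (var a))) (lit c))

/-- Distance of two numbers. -/
def distE (a b : Expr) : Expr := add (sub a b) (sub b a)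

/-- The demand of commodity number `i`, or zero if an earlier commodity has the same terminals. -/
def demandE (l i : ℕ) : Expr :=
  ite (iter (var i) (lit 0) (add (var l) (sub (lit 1) (add (distE (comE (l + 1) 0) (comE i 0))
    (distE (comE (l + 1) 1) (comE i 1)))))) (lit 0) (comE i 2)

/-- The sum of the first demands. -/
def demandsE (l i : ℕ) : Expr := iter (var i) (lit 0) (add (var l) (demandE (l + 2) (l + 1)))

/-- The maximum capacity. -/
def maxE : Expr := iter (var 1) (lit 0) (add (var 6) (sub (arcE 7 2) (var 6)))

/-- A product. -/
def mulE (a b : Expr) : Expr := iter a (lit 0) (add (var 14) b)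

/-- Values of the parameters in terms of the maximum capacity and the total demand. -/
def numE : Expr := add (var 8) (add (var 8) (add (var 7) (add (var 1) (add (var 1) (var 3)))))

/-- Output of an arc. -/
def arcP (t h c : Expr) : Prog := .seq (.emit t) (.seq (.emit h) (.seq (.emit c) (.emit (lit 1))))

/-- Numbers of the nodes `p l` and `q l`. -/
def pE (l : Expr) : Expr := add (var 0) (add (lit 2) l)
def qE (l : Expr) : Expr := add (var 0) (add (lit 3) (add (var 8) l))
/-- Number of the sink. -/
def tE : Expr := add (var 0) (lit 1)
/-- Numbers of the nodes that belong to an arc. -/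
def viE (c : ℕ) (a : Expr) : Expr := Nat.rec (add (var 9) a) (fun _ e => add (var 1) e) c
/-- Capacity of an absorbing arc. -/
def stE : Expr := add (var 11) (lit 1)

/-- Output of the arcs of the bundles. -/
def bundleP : Prog := .rep (var 8) (.seq (arcP (var 0) (pE (var 14)) (var 11))
  (.seq (arcP (pE (var 14)) (qE (var 14)) (add (var 11) (add (var 3) (lit 1))))
  (.seq (arcP (qE (var 14)) (pE (add (var 14) (lit 1))) (add (var 3) (lit 1)))
  (arcP (qE (var 14)) tE (var 13)))))

/-- Output of the arcs into the sources. -/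
def sourceP : Prog := .rep (var 2) (arcP (qE (var 14)) (comE 14 0) (demandE 15 14))

/-- Output of the arcs that belong to units of demand. -/
def demandP : Prog := .rep (var 2) (.bind (demandE 15 14)
  (.bind (viE 4 (demandsE 16 14)) (.rep (var 15)
    (.seq (arcP (comE 14 1) (add (var 16) (var 17)) (lit 1))
    (.seq (arcP (var 0) (add (var 16) (var 17)) (var 12))
    (.seq (arcP (add (var 16) (var 17)) tE stE)
    (.rep (var 8) (arcP (qE (var 18)) (add (var 16) (var 17))
      (ite (distE (var 18) (var 14)) (lit 1) (lit 0))))))))))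

/-- Output of the arcs from the bundles to the raised arcs. -/
def feedP : Prog := .rep (var 8) (.rep (var 1) (arcP (qE (var 14)) (viE 0 (var 15)) (lit 2)))

/-- Output of the arcs that belong to an arc. -/
def copyP : Prog := .rep (var 1) (.bind (arcE 14 2)
  (.seq (arcP (arcE 14 0) (viE 0 (var 14)) (var 15))
  (.seq (arcP (viE 0 (var 14)) (viE 1 (var 14)) (add (var 15) (add (add (var 8) (var 8)) (var 10))))
  (.seq (arcP (viE 1 (var 14)) (arcE 14 1) (var 15))
  (.seq (arcP (var 0) (viE 0 (var 14)) (var 10))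
  (.seq (arcP (viE 1 (var 14)) tE (var 10))
  (.seq (arcP (viE 1 (var 14)) (viE 2 (var 14)) (var 8))
  (.seq (arcP (viE 1 (var 14)) (viE 3 (var 14)) (var 8))
  (.seq (arcP (var 0) (viE 2 (var 14)) (var 12))
  (.seq (arcP (viE 2 (var 14)) tE stE)
  (.seq (arcP (var 0) (viE 3 (var 14)) (var 12))
  (arcP (viE 3 (var 14)) tE stE))))))))))))

/-- Output of the arcs at the end of the bundles. -/
def tailP : Prog := .rep (add (var 3) (lit 1))
  (.seq (arcP (pE (var 8)) (viE 4 (add (var 7) (var 14))) (lit 1))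
  (.seq (arcP (var 0) (viE 4 (add (var 7) (var 14))) (var 11))
  (arcP (viE 4 (add (var 7) (var 14))) tE stE)))

/-- Output of the direct arcs. -/
def directP : Prog := .rep (sub (var 3) (lit 2)) (arcP (var 0) tE stE)

/-- Output of all arcs. -/
def arcsP : Prog := .seq (arcP (var 0) (pE (lit 0)) (add (var 3) (lit 1))) (.seq bundleP
  (.seq sourceP (.seq demandP (.seq feedP (.seq copyP (.seq tailP directP))))))

/-- The number of nodes. -/
def nodesE : Expr := viE 4 (add (var 7) (add (var 3) (lit 1)))

/-- The number of arcs. -/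
def countE : Expr := add (lit 1) (add (four (var 8)) (add (var 2)
  (add (mulE (var 7) (add (lit 3) (var 8))) (add (mulE (var 8) (var 1)) (add (mulE (var 1) (lit 11))
  (add (mulE (add (var 3) (lit 1)) (lit 3)) (sub (var 3) (lit 2))))))))

/-- The target value. -/
def targetE : Expr := add (add (mulE (add (var 2) (lit 1)) (var 11)) (mulE (var 1) (var 10)))
  (add (mulE (var 7) (var 12)) (add (add (mulE (var 1) (var 12)) (mulE (var 1) (var 12)))
    (mulE (add (var 3) (lit 1)) (var 11))))

/-- Output of the head line and the list of nodes. -/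
def headP : Prog := .seq (.emit nodesE) (.seq (.emit countE) (.seq (.emit (var 0)) (.seq (.emit tE)
  (.seq (.emit (var 3)) (.seq (.emit targetE) (.seq (.emit (lit 1)) (.rep nodesE (.emit (var 14)))))))))

/-- The program that performs the reduction. -/
def program : Prog :=
  -- Variables `0` to `13` receive, in this order, the number of nodes, of arcs and of commodities,
  -- the budget, the addresses of the arc and commodity records, then `M`, `D`, `H`, the number of
  -- the first node `.vi`, `r₀`, `Q`, `B` and `w`. Loop variables start at `14`.
  .bind (load (lit 0)) (.bind (load (lit 1)) (.bind (load (lit 2)) (.bind (load (lit 3))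
  (.bind (add (var 0) (lit 4)) (.bind (add (var 4) (four (var 1)))
  (.bind maxE (.bind (demandsE 7 2)
  (.bind (add (var 2) (lit 3))
  (.bind (add (var 0) (add (lit 3) (add (var 8) (var 8))))
  (.bind (add (add (var 7) (add (var 1) (var 1))) (add (var 3) (lit 3)))
  (.bind (add (var 6) (add (numE) (lit 1)))
  (.bind (sub (add (var 11) (lit 1)) (var 8))
  (.bind (add (var 6) (add (add (var 8) (var 8)) (add (var 3) (lit 1)))) (.seq headP arcsP))))))))))))))

/-! ### Correctness -/

/-- The memory holds an instance with the given data. -/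
structure Loaded (mem : ℕ → ℕ) (X : Data) (dem : Fin X.K → ℕ) : Prop where
  nV : mem 0 = X.nV
  n : mem 1 = X.n
  K : mem 2 = X.K
  k : mem 3 = X.k
  tl : ∀ a : Fin X.n, mem (X.nV + 4 + 4 * a) = X.tl a
  hd : ∀ a : Fin X.n, mem (X.nV + 4 + 4 * a + 1) = X.hd a
  u : ∀ a : Fin X.n, mem (X.nV + 4 + 4 * a + 2) = X.u a
  src : ∀ i : Fin X.K, mem (X.nV + 4 + 4 * X.n + 4 * i) = X.src i
  snk : ∀ i : Fin X.K, mem (X.nV + 4 + 4 * X.n + 4 * i + 1) = X.snk i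
  demand : ∀ i : Fin X.K, mem (X.nV + 4 + 4 * X.n + 4 * i + 2) = dem i
  d_of : ∀ i : Fin X.K, (∃ j < i, X.src j = X.src i ∧ X.snk j = X.snk i) → X.d i = 0
  d_of_not : ∀ i : Fin X.K, (¬ ∃ j < i, X.src j = X.src i ∧ X.snk j = X.snk i) → X.d i = dem i
  M : X.M = Finset.univ.sup X.u

variable {mem : ℕ → ℕ} {Z : ℕ} {ρ : List ℕ}

theorem getD_snoc_lt {x : ℕ} {ρ' : List ℕ} (h : x < ρ.length) :
    (ρ ++ ρ').getD x 0 = ρ.getD x 0 := List.getD_append _ _ _ _ h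

theorem getD_snoc_zero {ρ' : List ℕ} {a l : ℕ} (h : ρ.length = l) :
    (ρ ++ (a :: ρ')).getD l 0 = a := by
  subst h; simp

theorem getD_snoc_one {ρ' : List ℕ} {a b l : ℕ} (h : ρ.length = l) :
    (ρ ++ (a :: b :: ρ')).getD (l + 1) 0 = b := by
  subst h; simp

theorem eval_iter_sum {b s : Expr} {F : ℕ → ℕ}
    (h : ∀ v < b.eval mem ρ, ∀ acc, s.eval mem (ρ ++ [acc, v]) = acc + F v) :
    (iter b (lit 0) s).eval mem ρ = ∑ v ∈ Finset.range (b.eval mem ρ), F v := by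
  have key : ∀ m ≤ b.eval mem ρ, iterate mem (lit 0) s ρ m = ∑ v ∈ Finset.range m, F v := by
    intro m
    induction m with
    | zero => intro _; rfl
    | succ m ih =>
      intro hm
      rw [Finset.sum_range_succ, ← ih (by omega), ← h m (by omega)]
      rfl
  exact key _ le_rfl

theorem bounded_iter {b s : Expr} (hb : b.Bounded mem Z ρ) (h : b.eval mem ρ ≤ Z)
    (hs : ∀ v < b.eval mem ρ, ∀ acc, s.Bounded mem Z (ρ ++ [acc, v])) :
    (iter b (lit 0) s).Bounded mem Z ρ :=
  ⟨hb, trivial, h, fun v hv => hs v hv _⟩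

variable {X : Data} {dem : Fin X.K → ℕ}

/-- The demand of a commodity, given by its number. -/
def dN (X : Data) (i : ℕ) : ℕ := if h : i < X.K then X.d ⟨i, h⟩ else 0

/-- Each earlier commodity contributes one minus the distance of the terminal pairs, truncated at
zero, so the sum is nonzero iff some earlier commodity has the same terminals. -/
theorem eval_demandE (H : Loaded mem X dem) {l i : ℕ} (hl : ρ.length = l) (hl5 : 5 < l)
    (hil : i < l) (h5 : ρ.getD 5 0 = X.nV + 4 + 4 * X.n) (j : Fin X.K) (hi : ρ.getD i 0 = j)
    (hZ : X.K ≤ Z) :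
    (demandE l i).eval mem ρ = X.d j ∧ (demandE l i).Bounded mem Z ρ := by
  have hcom : ∀ (y : Fin X.K) (c : ℕ), mem (X.nV + 4 + 4 * X.n + (y + y + (y + y)) + c) =
      mem (X.nV + 4 + 4 * X.n + 4 * y + c) := fun y c => by
    congr 1; omega
  have key : (iter (var i) (lit 0) (add (var l) (sub (lit 1) (add (distE (comE (l + 1) 0)
      (comE i 0)) (distE (comE (l + 1) 1) (comE i 1)))))).eval mem ρ =
      ∑ v ∈ Finset.range j, (1 - ((mem (X.nV + 4 + 4 * X.n + 4 * v) - X.src j +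
        (X.src j - mem (X.nV + 4 + 4 * X.n + 4 * v))) +
        (mem (X.nV + 4 + 4 * X.n + 4 * v + 1) - X.snk j +
        (X.snk j - mem (X.nV + 4 + 4 * X.n + 4 * v + 1))))) := by
    rw [eval_iter_sum (F := fun v => (1 - ((mem (X.nV + 4 + 4 * X.n + 4 * v) - X.src j +
        (X.src j - mem (X.nV + 4 + 4 * X.n + 4 * v))) +
        (mem (X.nV + 4 + 4 * X.n + 4 * v + 1) - X.snk j +
        (X.snk j - mem (X.nV + 4 + 4 * X.n + 4 * v + 1)))))), eval, hi]
    intro v hv acc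
    have e0 : X.nV + 4 + 4 * X.n + 4 * v = X.nV + 4 + 4 * X.n + (v + v + (v + v)) := by omega
    have s0 := H.src j
    have s1 := H.snk j
    rw [← s0, ← s1, ← hcom j 1]
    have e1 : X.nV + 4 + 4 * X.n + 4 * (j : ℕ) = X.nV + 4 + 4 * X.n + (j + j + (j + j)) := by omega
    rw [e0, e1]
    simp only [eval, distE, comE, four, getD_snoc_zero hl, getD_snoc_one hl,
      getD_snoc_lt (hl ▸ hil), getD_snoc_lt (hl ▸ hl5), h5, hi, add_zero]
  constructor
  · unfold demandE
    rw [eval, key]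
    split_ifs with h
    · rw [H.d_of]
      · rfl
      · obtain ⟨v, hv, h0⟩ := Finset.exists_ne_zero_of_sum_ne_zero h
        have hv' : v < j := Finset.mem_range.1 hv
        refine ⟨⟨v, hv'.trans j.isLt⟩, hv', ?_⟩
        have s0 := H.src ⟨v, hv'.trans j.isLt⟩
        have s1 := H.snk ⟨v, hv'.trans j.isLt⟩
        simp only at s0 s1
        rw [s0, s1] at h0
        exact ⟨Fin.ext (by omega), Fin.ext (by omega)⟩
    · rw [H.d_of_not, ← H.demand, ← hcom]
      · simp only [eval, comE, four, h5, hi]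
      · rintro ⟨v, hv, h1, h2⟩
        rw [not_not, Finset.sum_eq_zero_iff] at h
        have := h v (Finset.mem_range.2 hv)
        rw [H.src, H.snk, h1, h2] at this
        omega
  · refine ⟨bounded_iter trivial (by rw [eval, hi]; omega) fun v hv acc => ?_, trivial, ?_⟩ <;>
      simp [Bounded, distE, comE, four]

theorem eval_demandsE (H : Loaded mem X dem) {l i j : ℕ} (hl : ρ.length = l) (hl5 : 5 < l)
    (h5 : ρ.getD 5 0 = X.nV + 4 + 4 * X.n) (hj : j ≤ X.K) (hi : ρ.getD i 0 = j)
    (hZ : X.K ≤ Z) :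
    (demandsE l i).eval mem ρ = ∑ v ∈ Finset.range j, dN X v ∧
      (demandsE l i).Bounded mem Z ρ := by
  have key : ∀ v < (var i).eval mem ρ, ∀ acc,
      (demandE (l + 2) (l + 1)).eval mem (ρ ++ [acc, v]) = dN X v ∧
      (demandE (l + 2) (l + 1)).Bounded mem Z (ρ ++ [acc, v]) := by
    intro v hv acc
    rw [eval, hi] at hv
    have := eval_demandE (ρ := ρ ++ [acc, v]) (Z := Z) (l := l + 2) (i := l + 1) H
      (by simp [hl]) (by omega) (by omega) (by rw [getD_snoc_lt (hl ▸ hl5), h5])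
      ⟨v, hv.trans_le hj⟩ (by rw [getD_snoc_one hl]) hZ
    rwa [dN, dif_pos (hv.trans_le hj)]
  constructor
  · unfold demandsE
    rw [eval_iter_sum (F := dN X), eval, hi]
    intro v hv acc
    rw [eval, (key v hv acc).1, eval, getD_snoc_zero hl]
  · exact bounded_iter trivial (by rw [eval, hi]; omega) fun v hv acc => ⟨trivial, (key v hv acc).2⟩

theorem eval_maxE (H : Loaded mem X dem) (hl : ρ.length = 6) (h1 : ρ.getD 1 0 = X.n)
    (h4 : ρ.getD 4 0 = X.nV + 4) (hZ : X.n ≤ Z) :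
    maxE.eval mem ρ = X.M ∧ maxE.Bounded mem Z ρ := by
  constructor
  · have key : ∀ m (hm : m ≤ X.n), iterate mem (lit 0) (add (var 6) (sub (arcE 7 2) (var 6))) ρ m =
        Finset.univ.sup fun a : Fin m => X.u (a.castLE hm) := by
      intro m
      induction m with
      | zero => intro _; rfl
      | succ m ih =>
        intro hm
        have hu := H.u ⟨m, hm⟩
        rw [show X.nV + 4 + 4 * ((⟨m, hm⟩ : Fin X.n) : ℕ) = X.nV + 4 + (m + m + (m + m)) by
          simp only; omega] at hu
        change (add (var 6) (sub (arcE 7 2) (var 6))).eval mem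
          (ρ ++ [iterate mem (lit 0) (add (var 6) (sub (arcE 7 2) (var 6))) ρ m, m]) = _
        rw [ih (by omega)]
        simp only [eval, arcE, four, getD_snoc_zero hl, getD_snoc_one hl,
          getD_snoc_lt (show 4 < ρ.length by omega), h4, hu]
        rw [Fin.univ_castSuccEmb, Finset.sup_cons, Finset.sup_map]
        -- With truncated subtraction, `max x y = y + (x - y)`.
        change _ = max (X.u ⟨m, hm⟩) (Finset.univ.sup fun a : Fin m => X.u (a.castLE (by omega)))
        omega
    rw [H.M]
    exact (congrArg (iterate mem (lit 0) (add (var 6) (sub (arcE 7 2) (var 6))) ρ) h1).trans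
      (key X.n le_rfl)
  · refine bounded_iter trivial (by rw [eval, h1]; exact hZ) fun v hv acc => ?_
    simp [Bounded, arcE, four]

end Reduction
end RobustFlow

/-! ### The output of the program -/

namespace RobustFlow
namespace Reduction

open RAM RAM.Expr Data

set_option linter.unusedSimpArgs false

variable {mem : ℕ → ℕ} {Z : ℕ} {ρ : List ℕ}

/-- The expression has the given value and bounded loops. -/
def Evals (mem : ℕ → ℕ) (Z : ℕ) (e : Expr) (ρ : List ℕ) (v : ℕ) : Prop :=
  e.eval mem ρ = v ∧ e.Bounded mem Z ρ

/-- The program has the given output and bounded loops. -/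
def Prints (mem : ℕ → ℕ) (Z : ℕ) (p : Prog) (ρ : List ℕ) (w : List ℕ) : Prop :=
  p.run mem ρ = w ∧ p.Bounded mem Z ρ

theorem Prints.seq {p q : Prog} {w w' : List ℕ} (h : Prints mem Z p ρ w)
    (h' : Prints mem Z q ρ w') : Prints mem Z (.seq p q) ρ (w ++ w') :=
  ⟨congrArg₂ _ h.1 h'.1, h.2, h'.2⟩

theorem Prints.emit {e : Expr} {v : ℕ} (h : Evals mem Z e ρ v) : Prints mem Z (.emit e) ρ [v] :=
  ⟨congrArg (fun v => [v]) h.1, h.2⟩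

theorem Prints.bind {e : Expr} {v : ℕ} {p : Prog} {w : List ℕ} (h : Evals mem Z e ρ v)
    (h' : Prints mem Z p (ρ ++ [v]) w) : Prints mem Z (.bind e p) ρ w := by
  obtain ⟨rfl, hb⟩ := h
  exact ⟨h'.1, hb, h'.2⟩

theorem Prints.rep {b : Expr} {m : ℕ} {p : Prog} {g : Fin m → List ℕ} (h : Evals mem Z b ρ m)
    (hm : m ≤ Z) (h' : ∀ v : Fin m, Prints mem Z p (ρ ++ [(v : ℕ)]) (g v)) :
    Prints mem Z (.rep b p) ρ ((List.finRange m).flatMap g) := by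
  obtain ⟨rfl, hb⟩ := h
  refine ⟨?_, hb, hm, fun v hv => (h' ⟨v, hv⟩).2⟩
  rw [Prog.run, ← List.map_coe_finRange_eq_range, List.flatMap_map]
  exact congrArg (List.flatMap · _) (funext fun v => (h' v).1)

theorem Evals.add {a b : Expr} {x y : ℕ} (ha : Evals mem Z a ρ x) (hb : Evals mem Z b ρ y) :
    Evals mem Z (.add a b) ρ (x + y) :=
  ⟨congrArg₂ _ ha.1 hb.1, ha.2, hb.2⟩

/-- Products are repeated additions, so only the first factor has to be small; `mulE` is always
called with a count of objects there. The accumulator is variable `14`, the first one after the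
parameters. -/
theorem Evals.mul {a b : Expr} {x y : ℕ} (hl : ρ.length = 14) (ha : Evals mem Z a ρ x)
    (hx : x ≤ Z) (hb : ∀ acc v, Evals mem Z b (ρ ++ [acc, v]) y) :
    Evals mem Z (mulE a b) ρ (x * y) := by
  obtain ⟨rfl, h⟩ := ha
  refine ⟨?_, bounded_iter h hx fun v _ acc => ⟨trivial, (hb acc v).2⟩⟩
  rw [mulE, eval_iter_sum (F := fun _ => y)]
  · simp
  · intro v _ acc
    rw [eval, eval, getD_snoc_zero hl, (hb acc v).1]

variable {X : Data} {dem : Fin X.K → ℕ}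

theorem Prints.arc {t h c : Expr} {o : X.GA} (ht : Evals mem Z t ρ (nodeIndex (gtl o)))
    (hh : Evals mem Z h ρ (nodeIndex (ghd o))) (hc : Evals mem Z c ρ (gcap o)) :
    Prints mem Z (arcP t h c) ρ (X.arcCode o) :=
  (Prints.emit ht).seq ((Prints.emit hh).seq ((Prints.emit hc).seq (Prints.emit ⟨rfl, trivial⟩)))

variable (X) in
/-- The values of the parameters. -/
def env : List ℕ := [X.nV, X.n, X.K, X.k, X.nV + 4, X.nV + 4 + 4 * X.n, X.M, X.D, X.H,
  X.nV + 3 + 2 * X.H, X.r₀, X.Q, X.B, X.w]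

@[simp] theorem eval_viE (c : ℕ) (a : Expr) :
    (viE c a).eval mem ρ = ρ.getD 1 0 * c + (ρ.getD 9 0 + a.eval mem ρ) := by
  induction c with
  | zero => simp [viE, eval]
  | succ c ih =>
    change ρ.getD 1 0 + (viE c a).eval mem ρ = _
    rw [ih]; ring

@[simp] theorem bounded_viE (c : ℕ) (a : Expr) :
    (viE c a).Bounded mem Z ρ ↔ a.Bounded mem Z ρ := by
  induction c with
  | zero => simp [viE, Bounded]
  | succ c ih => exact (and_iff_right trivial).trans ih

theorem evals_comE (H : Loaded mem X dem) {i : ℕ} (h5 : ρ.getD 5 0 = X.nV + 4 + 4 * X.n)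
    (j : Fin X.K) (hi : ρ.getD i 0 = j) :
    Evals mem Z (comE i 0) ρ (X.src j) ∧ Evals mem Z (comE i 1) ρ (X.snk j) := by
  have e : 4 * (j : ℕ) = j + j + (j + j) := by omega
  refine ⟨⟨?_, by simp [comE, Bounded, four]⟩, ⟨?_, by simp [comE, Bounded, four]⟩⟩
  · rw [← H.src, e]; simp only [comE, eval, four, h5, hi, add_zero]
  · rw [← H.snk, e]; simp only [comE, eval, four, h5, hi]

theorem evals_arcE (H : Loaded mem X dem) {i : ℕ} (h4 : ρ.getD 4 0 = X.nV + 4)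
    (j : Fin X.n) (hi : ρ.getD i 0 = j) :
    Evals mem Z (arcE i 0) ρ (X.tl j) ∧ Evals mem Z (arcE i 1) ρ (X.hd j) ∧
      Evals mem Z (arcE i 2) ρ (X.u j) := by
  have e : 4 * (j : ℕ) = j + j + (j + j) := by omega
  refine ⟨⟨?_, by simp [arcE, Bounded, four]⟩, ⟨?_, by simp [arcE, Bounded, four]⟩,
    ⟨?_, by simp [arcE, Bounded, four]⟩⟩
  · rw [← H.tl, e]; simp only [arcE, eval, four, h4, hi, add_zero]
  · rw [← H.hd, e]; simp only [arcE, eval, four, h4, hi]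
  · rw [← H.u, e]; simp only [arcE, eval, four, h4, hi]

theorem prints_bundleP (hZ : X.numNodes ≤ Z) : Prints mem Z bundleP (env X)
    ((List.finRange X.H).flatMap fun l => X.arcCode (.sp l) ++ (X.arcCode (.e l) ++
      (X.arcCode (.ch l) ++ X.arcCode (.qt l)))) := by
  unfold numNodes at hZ
  refine .rep ?_ (by omega) fun l => .seq (.arc ?_ ?_ ?_) (.seq (.arc ?_ ?_ ?_)
    (.seq (.arc ?_ ?_ ?_) (.arc ?_ ?_ ?_)))
  all_goals
    refine ⟨?_, ?_⟩
    · simp [eval, env, pE, qE, tE, nodeIndex, gtl, ghd, gcap]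
      try omega
    · simp [Bounded, pE, qE, tE]

theorem prints_sourceP (H : Loaded mem X dem) (hZ : X.numNodes ≤ Z) : Prints mem Z sourceP (env X)
    ((List.finRange X.K).flatMap fun i => X.arcCode (.qs i)) := by
  unfold numNodes Data.H at hZ
  refine .rep ?_ (by omega) fun i => .arc ?_ (evals_comE H ?_ i ?_).1
    (eval_demandE H rfl ?_ ?_ ?_ i ?_ ?_)
  rotate_left 2
  all_goals first
    | omega
    | rfl
    | simp [env]; done
    | refine ⟨?_, ?_⟩
      · simp [eval, env, pE, qE, tE, nodeIndex, gtl, ghd, gcap, bun]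
        try omega
      · simp [Bounded, pE, qE, tE]

theorem prints_feedP (hZ : X.numNodes ≤ Z) : Prints mem Z feedP (env X)
    ((List.finRange X.H).flatMap fun l => (List.finRange X.n).flatMap fun a =>
      X.arcCode (.qv l a)) := by
  unfold numNodes at hZ
  refine .rep ?_ (by omega) fun l => .rep ?_ (by omega) fun a => .arc ?_ ?_ ?_
  all_goals
    refine ⟨?_, ?_⟩
    · simp [eval, env, pE, qE, tE, nodeIndex, gtl, ghd, gcap]
      try omega
    · simp [Bounded, pE, qE, tE]

theorem prints_tailP (hZ : X.numNodes ≤ Z) : Prints mem Z tailP (env X)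
    ((List.finRange (X.k + 1)).flatMap fun j => X.arcCode (.po j) ++
      (X.arcCode (.ss (.inr (.inr j))) ++ X.arcCode (.st (.inr (.inr j))))) := by
  unfold numNodes at hZ
  refine .rep ?_ (by omega) fun l => .seq (.arc ?_ ?_ ?_) (.seq (.arc ?_ ?_ ?_) (.arc ?_ ?_ ?_))
  all_goals
    refine ⟨?_, ?_⟩
    · simp [eval, env, pE, qE, tE, nodeIndex, gtl, ghd, gcap, absIndex, ssCap, stE]
      try omega
    · simp [Bounded, pE, qE, tE, stE]

theorem prints_directP (hZ : X.numNodes ≤ Z) : Prints mem Z directP (env X)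
    ((List.finRange (X.k - 2)).flatMap fun j => X.arcCode (.psi j)) := by
  unfold numNodes at hZ
  refine .rep ?_ (by omega) fun l => .arc ?_ ?_ ?_
  all_goals
    refine ⟨?_, ?_⟩
    · simp [eval, env, pE, qE, tE, nodeIndex, gtl, ghd, gcap, absIndex, ssCap, stE]
    · simp [Bounded, pE, qE, tE, stE]

theorem prints_copyP (H : Loaded mem X dem) (hZ : X.numNodes ≤ Z) : Prints mem Z copyP (env X)
    ((List.finRange X.n).flatMap fun a => X.arcCode (.inn a) ++ (X.arcCode (.mid a) ++
      (X.arcCode (.out a) ++ (X.arcCode (.sv a) ++ (X.arcCode (.wt a) ++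
      (X.arcCode (.wg a false) ++ (X.arcCode (.wg a true) ++
      (X.arcCode (.ss (.inr (.inl (a, false)))) ++ (X.arcCode (.st (.inr (.inl (a, false)))) ++
      (X.arcCode (.ss (.inr (.inl (a, true)))) ++ X.arcCode (.st (.inr (.inl (a, true)))))))))))))) := by
  unfold numNodes at hZ
  refine .rep ?_ (by omega) fun a => .bind (evals_arcE H ?_ a ?_).2.2
    (.seq (.arc (evals_arcE H ?_ a ?_).1 ?_ ?_) (.seq (.arc ?_ ?_ ?_)
    (.seq (.arc ?_ (evals_arcE H ?_ a ?_).2.1 ?_) (.seq (.arc ?_ ?_ ?_) (.seq (.arc ?_ ?_ ?_)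
    (.seq (.arc ?_ ?_ ?_) (.seq (.arc ?_ ?_ ?_) (.seq (.arc ?_ ?_ ?_) (.seq (.arc ?_ ?_ ?_)
    (.seq (.arc ?_ ?_ ?_) (.arc ?_ ?_ ?_)))))))))))
  all_goals first
    | rfl
    | refine ⟨?_, ?_⟩
      · simp [eval, env, pE, qE, tE, nodeIndex, gtl, ghd, gcap, absIndex, ssCap, stE]
        try omega
      · simp [Bounded, pE, qE, tE, stE]

theorem sum_dN {j : ℕ} (h : j ≤ X.K) :
    ∑ v ∈ Finset.range j, dN X v = ∑ i : Fin j, X.d (i.castLE h) := by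
  rw [Finset.sum_range]
  exact Finset.sum_congr rfl fun i _ => dif_pos _

/-- The absorbing nodes of commodity `i` start at the sum of the earlier demands, which is how
`finSigmaFinEquiv` numbers the units of demand. -/
theorem prints_demandP (H : Loaded mem X dem) (hZ : X.numNodes ≤ Z) : Prints mem Z demandP (env X)
    ((List.finRange X.K).flatMap fun i => (List.finRange (X.d i)).flatMap fun j =>
      X.arcCode (.tf ⟨i, j⟩) ++ (X.arcCode (.ss (.inl ⟨i, j⟩)) ++ (X.arcCode (.st (.inl ⟨i, j⟩)) ++
        (List.finRange X.H).flatMap fun l => X.arcCode (.qf l ⟨i, j⟩)))) := by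
  have hK : X.K ≤ Z := by unfold numNodes Data.H at hZ; omega
  have hd : ∀ i, X.d i ≤ Z := fun i => by
    have : X.d i ≤ X.D := Finset.single_le_sum (fun _ _ => Nat.zero_le _) (Finset.mem_univ i)
    unfold numNodes at hZ
    omega
  have hH : X.H ≤ Z := by unfold numNodes at hZ; omega
  refine .rep ?_ hK fun i => .bind (eval_demandE H rfl (by simp [env]) (by simp [env]) rfl i rfl hK)
    (.bind (v := X.nV + 3 + 2 * X.H + 4 * X.n + ∑ v ∈ Finset.range i, dN X v) ?_
    (.rep ?_ (hd i) fun j => .seq (.arc (evals_comE H rfl i rfl).2 ?_ ?_)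
    (.seq (.arc ?_ ?_ ?_) (.seq (.arc ?_ ?_ ?_) (.rep ?_ hH fun l => .arc ?_ ?_ ?_)))))
  · exact ⟨rfl, trivial⟩
  · have := eval_demandsE (ρ := env X ++ [(i : ℕ)] ++ [X.d i]) (l := 16) (i := 14) H rfl
      (by norm_num) rfl i.isLt.le rfl hK
    refine ⟨?_, by simpa using this.2⟩
    rw [eval_viE, this.1]
    simp [env]
    omega
  rotate_right 1
  · refine ⟨?_, by simp [Bounded, distE]⟩
    have h : l = X.bun i ↔ (l : ℕ) = i := Fin.ext_iff
    simp only [gcap, h]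
    simp [eval, distE, env]
    split_ifs <;> omega
  all_goals
    have hi := i.isLt.le
    refine ⟨?_, ?_⟩
    · simp [eval, env, pE, qE, tE, nodeIndex, gtl, ghd, gcap, absIndex, ssCap, stE, distE,
        finSigmaFinEquiv_apply, sum_dN hi]
      try omega
    · simp [Bounded, pE, qE, tE, stE, distE]

theorem length_arcList : X.arcList.length = 1 + (4 * X.H + (X.K + (X.D * (3 + X.H) +
    (X.H * X.n + (X.n * 11 + ((X.k + 1) * 3 + (X.k - 2))))))) := by
  have h : ∀ {m c : ℕ}, ((List.finRange m).map fun _ => c).sum = m * c := by simp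
  simp only [arcList, List.length_cons, List.length_append, List.length_flatMap, List.length_map,
    List.length_finRange, List.length_nil, h]
  have : ((List.finRange X.K).map fun i => X.d i * (0 + 1 + 1 + 1 + X.H)).sum =
      X.D * (3 + X.H) := by
    rw [List.sum_map_mul_right, D, Fin.sum_univ_def]
  rw [this]
  ring

theorem target_eq : X.target = (X.K + 1) * X.Q + X.n * X.r₀ + (X.D * X.B + (X.n * X.B + X.n * X.B +
    (X.k + 1) * X.Q)) := by
  simp [target, ssCap, D]
  ring

theorem prints_headP (hZ : X.numNodes ≤ Z) : Prints mem Z headP (env X)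
    ([X.numNodes, X.arcList.length, X.nV, X.nV + 1, X.k, X.target, 1] ++
      List.range X.numNodes) := by
  have hn : X.n ≤ Z := by unfold numNodes at hZ; omega
  have hH : X.H ≤ Z := by unfold numNodes at hZ; omega
  have hD : X.D ≤ Z := by unfold numNodes at hZ; omega
  have hk : X.k + 1 ≤ Z := by unfold numNodes at hZ; omega
  have hK : X.K + 1 ≤ Z := by unfold Data.H at hH; omega
  have hnodes : Evals mem Z nodesE (env X) X.numNodes := by
    refine ⟨?_, by simp [nodesE, Bounded]⟩
    simp [nodesE, eval, env, numNodes]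
    omega
  have hcount : Evals mem Z countE (env X) X.arcList.length := by
    rw [length_arcList]
    refine .add ?_ (.add ?_ (.add ?_ (.add (.mul rfl ?_ hD fun acc v => ?_)
      (.add (.mul rfl ?_ hH fun acc v => ?_) (.add (.mul rfl ?_ hn fun acc v => ?_)
      (.add (.mul rfl ?_ hk fun acc v => ?_) ?_))))))
    all_goals
      refine ⟨?_, ?_⟩
      · simp [eval, env, four]
        try omega
      · simp [Bounded, four]
  have htarget : Evals mem Z targetE (env X) X.target := by
    rw [target_eq]
    refine .add (.add (.mul rfl ?_ hK fun acc v => ?_) (.mul rfl ?_ hn fun acc v => ?_))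
      (.add (.mul rfl ?_ hD fun acc v => ?_) (.add (.add (.mul rfl ?_ hn fun acc v => ?_)
      (.mul rfl ?_ hn fun acc v => ?_)) (.mul rfl ?_ hk fun acc v => ?_)))
    all_goals
      refine ⟨?_, ?_⟩
      · simp [eval, env]
      · simp [Bounded]
  have hrange : Prints mem Z (.rep nodesE (.emit (var 14))) (env X) (List.range X.numNodes) := by
    have := Prints.rep (p := .emit (var 14)) (g := fun v : Fin X.numNodes => [(v : ℕ)]) hnodes hZ
      fun v => .emit ⟨rfl, trivial⟩
    rwa [← List.map_coe_finRange_eq_range, List.map_eq_flatMap]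
  have hvar : ∀ x, Prints mem Z (.emit (var x)) (env X) [(env X).getD x 0] := fun x =>
    .emit ⟨rfl, trivial⟩
  have ht : Prints mem Z (.emit tE) (env X) [X.nV + 1] := .emit ⟨rfl, trivial, trivial⟩
  have h1 : Prints mem Z (.emit (lit 1)) (env X) [1] := .emit ⟨rfl, trivial⟩
  exact (Prints.emit hnodes).seq ((Prints.emit hcount).seq ((hvar 0).seq (ht.seq ((hvar 3).seq
    ((Prints.emit htarget).seq (h1.seq hrange))))))

theorem prints_arcsP (H : Loaded mem X dem) (hZ : X.numNodes ≤ Z) :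
    Prints mem Z arcsP (env X) (X.arcList.flatMap X.arcCode) := by
  have h0 : Prints mem Z (arcP (var 0) (pE (lit 0)) (add (var 3) (lit 1))) (env X)
      (X.arcCode .zin) := by
    refine .arc ⟨rfl, trivial⟩ ⟨?_, by simp [pE, Bounded]⟩ ⟨rfl, trivial, trivial⟩
    simp [pE, eval, env, nodeIndex, ghd]
  have := h0.seq ((prints_bundleP hZ).seq ((prints_sourceP H hZ).seq ((prints_demandP H hZ).seq
    ((prints_feedP hZ).seq ((prints_copyP H hZ).seq ((prints_tailP hZ).seq
    (prints_directP hZ)))))))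
  change Prints mem Z arcsP _ _ at this
  simpa only [arcList, List.flatMap_cons, List.flatMap_append, List.flatMap_assoc, List.flatMap_map,
    List.flatMap_nil, List.append_nil, List.append_assoc] using this

/-- The program prints the code of the single-commodity instance. -/
theorem prints_program (H : Loaded mem X dem) (hZ : X.numNodes ≤ Z) :
    Prints mem Z program [] X.single.encode := by
  rw [encode_single]
  have hn : X.n ≤ Z := by unfold numNodes at hZ; omega
  have hK : X.K ≤ Z := by unfold numNodes Data.H at hZ; omega
  refine .bind (v := X.nV) ⟨H.nV, trivial⟩ (.bind (v := X.n) ⟨H.n, trivial⟩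
    (.bind (v := X.K) ⟨H.K, trivial⟩ (.bind (v := X.k) ⟨H.k, trivial⟩
    (.bind (v := X.nV + 4) ⟨rfl, trivial, trivial⟩ (.bind (v := X.nV + 4 + 4 * X.n) ⟨?_, ?_⟩
    (.bind (eval_maxE H rfl rfl rfl hn) (.bind (v := X.D) ?_
    (.bind (v := X.H) ⟨rfl, trivial, trivial⟩ (.bind (v := X.nV + 3 + 2 * X.H) ⟨?_, ?_⟩
    (.bind (v := X.r₀) ⟨?_, ?_⟩ (.bind (v := X.Q) ⟨?_, ?_⟩ (.bind (v := X.B) ⟨?_, ?_⟩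
    (.bind (v := X.w) ⟨?_, ?_⟩ ((prints_headP hZ).seq (prints_arcsP H hZ)))))))))))))))
  case refine_3 =>
    have := eval_demandsE (l := 7) (i := 2) (ρ := [X.nV, X.n, X.K, X.k, X.nV + 4,
      X.nV + 4 + 4 * X.n, X.M]) H rfl (by norm_num) rfl le_rfl rfl hK
    rwa [sum_dN le_rfl] at this
  all_goals simp [eval, Bounded, four, numE, r₀, Data.Q, Data.B, Data.w]
  all_goals try omega

end Reduction
end RobustFlow

/-! ### Layout of the input and polynomial bounds -/

namespace RobustFlow

theorem eval_mono_of_nat (p : Polynomial ℕ) : Monotone fun x => p.eval x := by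
  intro x y h
  induction p using Polynomial.induction_on' with
  | add p q hp hq => simpa only [Polynomial.eval_add] using Nat.add_le_add hp hq
  | monomial n a =>
    simpa only [Polynomial.eval_monomial] using Nat.mul_le_mul_left a (Nat.pow_le_pow_left h n)

theorem length_le_bitSize (w : List ℕ) : w.length ≤ RAM.bitSize w := by
  unfold RAM.bitSize
  induction w with
  | nil => simp
  | cons a w ih => simp only [List.map_cons, List.sum_cons, List.length_cons]; omega

section Blocks

variable {α : Type*} {f : α → List ℕ} (hf : ∀ x, (f x).length = 4)
include hf

theorem length_flatMap_four (l : List α) : (l.flatMap f).length = 4 * l.length := by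
  induction l with
  | nil => rfl
  | cons a l ih => rw [List.flatMap_cons, List.length_append, hf, ih, List.length_cons]; ring

/-- Arcs and commodities are records of four numbers, so entry `c` of record `i` stands at offset `4
* i + c`. -/
theorem getD_flatMap_four (l : List α) (i : ℕ) (hi : i < l.length) {c : ℕ} (hc : c < 4) :
    (l.flatMap f).getD (4 * i + c) 0 = (f l[i]).getD c 0 := by
  induction l generalizing i with
  | nil => simp at hi
  | cons a l ih =>
    rw [List.flatMap_cons]
    cases i with
    | zero => rw [List.getD_append _ _ _ _ (by rw [hf]; omega)]; simp
    | succ i =>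
      rw [List.getD_append_right _ _ _ _ (by rw [hf]; omega), hf]
      have := ih i (by simpa using hi)
      rw [show 4 * (i + 1) + c - 4 = 4 * i + c by omega, this]
      simp

end Blocks

theorem getD_flatMap_finRange {m : ℕ} {f : Fin m → List ℕ} (hf : ∀ x, (f x).length = 4)
    (i : Fin m) {c : ℕ} (hc : c < 4) :
    ((List.finRange m).flatMap f).getD (4 * i + c) 0 = (f i).getD c 0 := by
  rw [getD_flatMap_four hf _ _ (by simp) hc]
  simp

namespace MRFMInstance

open Reduction

variable {I : MRFMInstance}

theorem length_encode : I.encode.length = 4 + I.numV + 4 * I.numA + 4 * I.numK := by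
  unfold encode Network.encodeArcs
  simp only [List.length_append, List.length_range]
  rw [length_flatMap_four (fun _ => rfl), length_flatMap_four (fun _ => rfl)]
  simp

theorem getD_encode_arc (a : Fin I.numA) {c : ℕ} (hc : c < 4) :
    I.encode.getD (I.numV + 4 + 4 * a + c) 0 =
      [(I.tail a : ℕ), (I.head a : ℕ), (I.cap a).num, (I.cap a).den].getD c 0 := by
  have hl : I.encodeArcs.length = 4 * I.numA := by
    rw [Network.encodeArcs, length_flatMap_four (fun _ => rfl), List.length_finRange]
  rw [encode, List.getD_append _ _ _ _ (by simp [hl]; omega),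
    List.getD_append_right _ _ _ _ (by simp; omega)]
  rw [show I.numV + 4 + 4 * (a : ℕ) + c - _ = 4 * a + c by simp; omega]
  exact getD_flatMap_finRange (fun _ => rfl) a hc

theorem getD_encode_com (i : Fin I.numK) {c : ℕ} (hc : c < 4) :
    I.encode.getD (I.numV + 4 + 4 * I.numA + 4 * i + c) 0 =
      [(I.source i : ℕ), (I.sink i : ℕ), (I.demand i).num, (I.demand i).den].getD c 0 := by
  have hl : I.encodeArcs.length = 4 * I.numA := by
    rw [Network.encodeArcs, length_flatMap_four (fun _ => rfl), List.length_finRange]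
  rw [encode, List.getD_append_right _ _ _ _ (by simp [hl]; omega)]
  rw [show I.numV + 4 + 4 * I.numA + 4 * (i : ℕ) + c - _ = 4 * i + c by simp [hl]; omega]
  exact getD_flatMap_finRange (fun _ => rfl) i hc

theorem loaded : Loaded (fun i => I.encode.getD i 0) I.data fun i => (I.demand i).num where
  nV := rfl
  n := rfl
  K := rfl
  k := rfl
  tl a := getD_encode_arc a (c := 0) (by norm_num)
  hd a := getD_encode_arc a (c := 1) (by norm_num)
  u a := getD_encode_arc a (c := 2) (by norm_num)
  src i := getD_encode_com i (c := 0) (by norm_num)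
  snk i := getD_encode_com i (c := 1) (by norm_num)
  demand i := getD_encode_com i (c := 2) (by norm_num)
  d_of _ h := d_of_dup h
  d_of_not _ h := d_of_not_dup h
  M := rfl

namespace Special

variable {p : Polynomial ℕ} (h : I.Special p)
include h

/-- The demands in `SmallDemandsExcept` are nonnegative, hence so is `M - 3`. -/
theorem three_le : 3 ≤ I.data.M := by
  obtain ⟨i₀, h1, -⟩ := h.commodities
  have h2 : (0 : ℚ) ≤ I.maxCap - 3 := le_trans (NNRat.coe_nonneg _) h1
  rw [maxCap_eq h.caps.1] at h2
  have : (3 : ℚ) ≤ (I.data.M : ℕ) := by push_cast at h2; linarith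
  exact_mod_cast this

theorem max_le : I.data.M ≤ p.eval I.numA := by
  have := h.caps.2
  rw [maxCap_eq h.caps.1] at this
  exact_mod_cast this

/-- The demand is the capacity leaving the source. Its value has to be bounded, not just its bit
length, as each unit of demand becomes a node. -/
theorem demand_le (i : Fin I.numK) : I.data.d i ≤ I.numA * I.data.M := by
  refine le_trans (b := (I.demand i).num) ?_ ?_
  · by_cases hi : I.Dup i
    · rw [d_of_dup hi]; exact Nat.zero_le _
    · rw [d_of_not_dup hi]
  · have e : ((I.demand i).num : ℚ≥0) = (∑ a ∈ I.outArcs {I.source i}, (I.cap a).num : ℕ) := by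
      rw [← demand_num h.caps.1 h.terminals, ← (h.terminals i).1, Nat.cast_sum]
      exact Finset.sum_congr rfl fun a _ => cap_eq h.caps.1 a
    rw [Nat.cast_injective e]
    calc _ ≤ ∑ a ∈ I.outArcs {I.source i}, I.data.M := Finset.sum_le_sum fun a _ => u_le a
      _ = (I.outArcs {I.source i}).card * I.data.M := by rw [Finset.sum_const, smul_eq_mul]
      _ ≤ _ := Nat.mul_le_mul_right _ ((Finset.card_le_univ _).trans (Fintype.card_fin _).le)

theorem total_le : I.data.D ≤ I.numK * (I.numA * I.data.M) := by
  have := Finset.sum_le_card_nsmul Finset.univ I.data.d _ fun i _ => h.demand_le i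
  rwa [Finset.card_univ, Fintype.card_fin, smul_eq_mul] at this

/-- The tight cut has `k - 1` arcs of maximum capacity. The budget is given in binary, but the
network has a number of arcs linear in it, so this bound is needed for polynomial time. -/
theorem budget_le : I.budget ≤ I.numA + 1 := by
  obtain ⟨U, -, -, -, hU⟩ := h.cut
  rw [← hU]
  exact Nat.succ_le_succ ((Finset.card_le_univ _).trans (Fintype.card_fin _).le)

/-- The number of nodes of the single-commodity network is polynomial. -/
theorem numNodes_le : I.data.numNodes ≤ (Polynomial.X ^ 2 * p + 2 * Polynomial.X +
    6 : Polynomial ℕ).eval (RAM.bitSize I.encode) := by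
  have hs := length_le_bitSize I.encode
  rw [length_encode] at hs
  set s := RAM.bitSize I.encode
  have hk := h.budget_le
  -- The input length, and so `s`, is at least `4 + numV + 4 * numA + 4 * numK`; thus `2 * s + 6`
  -- covers all nodes other than the `D` for the units of demand.
  have hD : I.data.D ≤ s * (s * p.eval s) := h.total_le.trans <|
    Nat.mul_le_mul (by omega) <| Nat.mul_le_mul (by omega) <|
      h.max_le.trans (eval_mono_of_nat p (by omega))
  have e : (Polynomial.X ^ 2 * p + 2 * Polynomial.X + 6 : Polynomial ℕ).eval s =
      s * (s * p.eval s) + 2 * s + 6 := by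
    simp
    ring
  rw [e]
  unfold Data.numNodes Data.H
  simp only [data] at hD ⊢
  omega

/-- The same `N` occurs on both sides, so no divisibility is lost and `N = 1` gives the integral
statement. -/
theorem family_iff_single {N : ℕ} : I.FamilyYes N ↔ I.data.single.FamilyYes N := by
  rw [family_iff h.caps.1 h.terminals, Data.family_iff_singleYes,
    Data.singleYes_iff_multiYes h.two_le_budget ((by norm_num : 1 ≤ 3).trans h.three_le) u_le]

end Special

end MRFMInstance

end RobustFlow

theorem theorem7 :
    ∃ f : RobustFlow.MRFMInstance → RobustFlow.MRFInstance, ∀ p : Polynomial ℕ,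
      RAM.PolyTimeOn (fun I : RobustFlow.MRFMInstance => I.Special p)
        RobustFlow.MRFMInstance.encode RobustFlow.MRFInstance.encode f ∧
      ∀ I : RobustFlow.MRFMInstance, I.Special p →
        (f I).budget = I.budget ∧
        (I.Yes ↔ (f I).Yes) ∧
        (I.IntegralYes ↔ (f I).IntegralYes) := by
  refine ⟨fun I => I.data.single, fun p => ⟨.of_prog RobustFlow.Reduction.program _ fun I h =>
    RobustFlow.Reduction.prints_program RobustFlow.MRFMInstance.loaded h.numNodes_le,
    fun I h => ⟨rfl, ?_, ?_⟩⟩⟩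
  · rw [RobustFlow.MRFMInstance.yes_iff, RobustFlow.MRFInstance.yes_iff]
    exact exists_congr fun N => and_congr_right fun _ => h.family_iff_single
  · rw [RobustFlow.MRFMInstance.integralYes_iff, RobustFlow.MRFInstance.integralYes_iff]
    exact h.family_iff_single
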